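/- **Setting.** Let $d\in\mathbb N=\{1,2,\dots\}$, $p_v\in[1,\infty)$, $c,T\in(0,\infty)$, let $f\colon\mathbb R\to\mathbb R$ and $g\colon\mathbb R^d\to\mathbb R$ be continuous, let $V\colon[0,T]\times\mathbb R^d\to[1,\infty)$ be continuous, and let $\Theta=\bigcup_{n\in\mathbb N}\mathbb Z^n$; write $0\in\Theta$ for $0\in\mathbb Z^1$ and $(\theta,k,i)\in\mathbb Z^{n+2}$ for $\theta\in\mathbb Z^n$, $k,i\in\mathbb Z$. Let $(\Omega,\mathcal F,\mathbb P)$ be a probability space and write $\lVert Z\rVert_r=(\mathbb E[|Z|^r])^{1/r}\in[0,\infty]$. Let $\mathfrak t^\theta\colon\Omega\to[0,1]$, $\theta\in\Theta$, be i.i.d. random variables with $\mathbb P(\mathfrak t^0\le t)=t$ for all $t\in[0,1]$. Let $X^\theta=(X^{\theta,s,x}_t)_{0\le s\le t\le T,\,x\in\mathbb R^d}$, $\theta\in\Theta$, be measurable, independent and identically distributed $\mathbb R^d$-valued random fields which are independent of $(\mathfrak t^\theta)_{\theta\in\Theta}$. Here measurability and independence mean: there are independent $\sigma$-algebras $\mathcal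 G^\theta\subseteq\mathcal F$, $\theta\in\Theta$, such that $\sigma(\bigcup_\theta\mathcal G^\theta)$ is independent of $(\mathfrak t^\theta)_{\theta\in\Theta}$ and, for every $\theta$, the map $(s,t,x,\omega)\mapsto X^{\theta,s,x}_t(\omega)$ on $\{(s,t)\in[0,T]^2\colon s\le t\}\times\mathbb R^d\times\Omega$ is measurable with respect to the product of the Borel $\sigma$-algebra and $\mathcal G^\theta$; identically distributed means equality of the finite-dimensional distributions. Assume for all $s\in[0,T]$, $t\in[s,T]$, $x\in\mathbb R^d$, $w_1,w_2\in\mathbb R$ that $$|g(x)|\le V(T,x),\qquad |Tf(0)|\le V(s,x),\qquad |f(w_1)-f(w_2)|\le c|w_1-w_2|,\qquad \lVert V(t,X^{0,s,x}_t)\rVert_{p_v}\le V(s,x).$$ Let $U^\theta_{n,m}\colon[0,T]\times\mathbb R^d\times\Omega\to\mathbb R$, $n,m\in\mathbb Z$, $\theta\in\Theta$, satisfy for all $n,m\in\mathbb N$, $\theta\in\Theta$, $t\in[0,T]$, $x\in\mathbb R^d$ that $U^\theta_{-1,m}(t,x)=U^\theta_{0,m}(t,x)=0$ and $$U^\theta_{n,m}(t,x)=\frac1{m^n}\sum_{i=1}^{m^n}g\bigl(X^{(\theta,0,-i),t,x}_T\bigr)+\sum_{\ell=0}^{n-1}\frac{T-t}{m^{n-\ell}}\sum_{i=1}^{m^{n-\ell}}\bigl(f\circ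 U^{(\theta,\ell,i)}_{\ell,m}-\mathbf 1_{\mathbb N}(\ell)\,f\circ U^{(\theta,-\ell,i)}_{\ell-1,m}\bigr)\Bigl(t+(T-t)\mathfrak t^{(\theta,\ell,i)},X^{(\theta,\ell,i),t,x}_{t+(T-t)\mathfrak t^{(\theta,\ell,i)}}\Bigr).$$ **Theorem 2.2.** Let $p\in[2,\infty)$ and $q_1\in[1,\infty)$ satisfy $pq_1\le p_v$. Then: (i) There exists a unique measurable $u\colon[0,T]\times\mathbb R^d\to\mathbb R$ which satisfies for all $t\in[0,T]$, $x\in\mathbb R^d$ that $$\mathbb E\bigl[|g(X^{0,t,x}_T)|\bigr]+\int_t^T\mathbb E\bigl[|f(u(s,X^{0,t,x}_s))|\bigr]\,ds+\sup_{y\in\mathbb R^d,\,s\in[0,T]}\frac{|u(s,y)|}{V(s,y)}<\infty$$ and $$u(t,x)=\mathbb E\bigl[g(X^{0,t,x}_T)\bigr]+\int_t^T\mathbb E\bigl[f(u(s,X^{0,t,x}_s))\bigr]\,ds.$$ (ii) For all $m,n\in\mathbb N$, $t\in[0,T]$, $x\in\mathbb R^d$, $$\bigl\lVert U^0_{n,m}(t,x)-u(t,x)\bigr\rVert_p\le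 2(p-1)^{n/2}\,e^{5cTn}\,e^{m^{p/2}/p}\,m^{-n/2}\,\bigl(V(t,x)\bigr)^{q_1}.$$ -/

import Mathlib

open MeasureTheory ProbabilityTheory Set
open scoped ENNReal unitInterval

noncomputable section

namespace MLP

/-- The state space `ℝ^d`. -/
abbrev State (d : ℕ) : Type := EuclideanSpace ℝ (Fin d)

/-- The index set `Θ = ⋃_{n ≥ 1} ℤ^n`: finite nonempty tuples of integers. -/
abbrev Index : Type := {l : List ℤ // l ≠ []}

/-- The index `0 ∈ ℤ = ℤ^1 ⊆ Θ`. -/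
def Index.root : Index := ⟨[0], by simp⟩

/-- The index `(θ, k, i)`, for `θ ∈ Θ` and `k, i ∈ ℤ`. -/
def Index.child (θ : Index) (k i : ℤ) : Index := ⟨θ.1 ++ [k, i], by simp⟩

/-- The set of pairs of times `(s, t)` with `0 ≤ s ≤ t ≤ T`. -/
abbrev TimePairs (T : ℝ) : Type := {r : ℝ × ℝ // 0 ≤ r.1 ∧ r.1 ≤ r.2 ∧ r.2 ≤ T}

/-- A random field `(X^{s,x}_t)` is given by `X s t x ω`; only its values at
`0 ≤ s ≤ t ≤ T` are used. This is the restriction of the field to these times, as a map from `Ω`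
to the product space of all its values. -/
def fieldMap {d : ℕ} {Ω : Type*} (T : ℝ) (X : ℝ → ℝ → State d → Ω → State d) :
    Ω → (TimePairs T × State d → State d) :=
  fun ω q => X q.1.1.1 q.1.1.2 q.2 ω

/-- The random field `X` on `{0 ≤ s ≤ t ≤ T} × ℝ^d × Ω` is measurable with respect to the product
of the Borel sigma-algebra and the sigma-algebra `𝒢` on `Ω`. -/
def JointlyMeasurable {d : ℕ} {Ω : Type*} (T : ℝ) (𝒢 : MeasurableSpace Ω)
    (X : ℝ → ℝ → State d → Ω → State d) : Prop :=
  Measurable fun q : (TimePairs T × State d) × Ω => fieldMap T X q.2 q.1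

/-- The random fields `X^θ`, `θ ∈ Θ`, are measurable and independent, and they are independent of
the family of random variables `τ^θ`, `θ ∈ Θ`: there are independent sigma-algebras `𝒢^θ`, jointly
independent of `τ`, such that `X^θ` is measurable on time × space × `(Ω, 𝒢^θ)`. -/
def IndependentFields {d : ℕ} {Ω : Type*} [mΩ : MeasurableSpace Ω] (P : Measure Ω) (T : ℝ)
    (X : Index → ℝ → ℝ → State d → Ω → State d) (τ : Index → Ω → I) : Prop :=
  ∃ 𝒢 : Index → MeasurableSpace Ω,
    (∀ θ, 𝒢 θ ≤ mΩ) ∧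
    (∀ θ, JointlyMeasurable T (𝒢 θ) (X θ)) ∧
    iIndep 𝒢 P ∧
    Indep (⨆ θ, 𝒢 θ) (⨆ θ, MeasurableSpace.comap (τ θ) inferInstance) P

/-- The random fields `U^θ_{n,m}`, written `U θ n m t x ω`, are the multilevel Picard
approximations driven by the fields `X^θ` and the random times `τ^θ`. -/
def IsApproximation {d : ℕ} {Ω : Type*} (T : ℝ) (f : ℝ → ℝ) (g : State d → ℝ)
    (τ : Index → Ω → I) (X : Index → ℝ → ℝ → State d → Ω → State d)
    (U : Index → ℤ → ℤ → ℝ → State d → Ω → ℝ) : Prop :=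
  ∀ n m : ℕ, 1 ≤ n → 1 ≤ m → ∀ (θ : Index), ∀ t ∈ Icc 0 T, ∀ (x : State d) (ω : Ω),
    U θ (-1) m t x ω = 0 ∧
    U θ 0 m t x ω = 0 ∧
    U θ n m t x ω =
      1 / (m : ℝ) ^ n * ∑ i ∈ Finset.Icc 1 (m ^ n), g (X (θ.child 0 (-(i : ℤ))) t T x ω)
      + ∑ k ∈ Finset.range n, (T - t) / (m : ℝ) ^ (n - k) *
          ∑ i ∈ Finset.Icc 1 (m ^ (n - k)),
            let η := θ.child k i
            let s := t + (T - t) * (τ η ω : ℝ)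
            let y := X η t s x ω
            (f (U η k m s y ω)
              - (if 1 ≤ k then 1 else 0) * f (U (θ.child (-(k : ℤ)) i) ((k : ℤ) - 1) m s y ω))

/-- `u : [0,T] × ℝ^d → ℝ` is a measurable solution, bounded relative to `V`, of
`u(t,x) = E[g(X^{t,x}_T)] + ∫_t^T E[f(u(s,X^{t,x}_s))] ds`, with finite
`E[|g(X^{t,x}_T)|]` and `∫_t^T E[|f(u(s,X^{t,x}_s))|] ds`.
Only the values `u t x` with `t ∈ [0,T]` are used. -/
def IsSolution {d : ℕ} {Ω : Type*} [MeasurableSpace Ω] (P : Measure Ω) (T : ℝ) (f : ℝ → ℝ)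
    (g : State d → ℝ) (V : ℝ → State d → ℝ) (X : ℝ → ℝ → State d → Ω → State d)
    (u : ℝ → State d → ℝ) : Prop :=
  (Measurable fun q : Icc (0 : ℝ) T × State d => u q.1 q.2) ∧
  ∀ t ∈ Icc 0 T, ∀ x : State d,
    (∫⁻ ω, ENNReal.ofReal |g (X t T x ω)| ∂P)
      + (∫⁻ s in Icc t T, ∫⁻ ω, ENNReal.ofReal |f (u s (X t s x ω))| ∂P)
      + (⨆ (y : State d) (s : Icc (0 : ℝ) T), ENNReal.ofReal (|u s y| / V s y)) < ∞ ∧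
    u t x = (∫ ω, g (X t T x ω) ∂P) + ∫ s in t..T, ∫ ω, f (u s (X t s x ω)) ∂P

end MLP

end

noncomputable section

namespace MLP

/-! ### The two-point inequality -/

/-! The argument takes place on the state space `[0,T] × ℝ^d`. With `S` uniform on `[t,T]`, the pair
`(S, X^{t,x}_S)` is a random transition out of `q = (t,x)`, and the integral equation becomes `u(q)
= E[G(q)] + h(q) E[f(u(Y(q)))]` with `h(q) = T - t`. An abstract `Scheme` keeps only the
transitions, the terminal values, their independence across indices and the equality of their laws.

Existence, uniqueness and growth of `u` come from contraction: in the weight `exp(2c(T-t)) V`, one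
Picard step halves distances (`Setting.contractive`). Comparison with `2 exp(c(T-t)) V`, which
reproduces itself under the linearised equation, gives the a priori bound `Setting.isFixed_le`.

For the error, the levels telescope in mean, so `U_n - u` is a sum of centered averages plus the
bias of level `n - 1` (`Controlled.error_eq`). This rests on index bookkeeping: an approximation
depends only on strict extensions of its index, different summands live on disjoint branches, and
laws do not depend on the index. Freezing lemmas then transfer pointwise bounds and laws to
independent random points. Averages of independent terms are controlled by Rio's inequality with
constant `p - 1`, obtained from the 2-uniform smoothness of `L^p` and ultimately from a two-point
inequality.

The decisive choice is the weight `W(t,x) = exp(m^{p/2}(T-t)/(pT)) V(t,x)`. A transition, multiplied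
by `T - t`, costs at most a factor `T m^{-1/2}` in the `L^p` norm of `W`
(`Setting.eLpNorm_exp_V_le`). Each passage through the nonlinearity therefore gains the same
`m^{-1/2}` that averaging gains per level, and the nested time integrals collapse to a scalar
recursion, solved by `errorConst`. Returning from `W` to `V` costs `exp(m^{p/2}/p)`, and `V ≤
V^{q₁}` since `V ≥ 1`. -/

/-- The inequality `tanh (r * α) ≤ r * tanh α` in algebraic form. -/
theorem rpow_sub_rpow_le {r y : ℝ} (hr : 1 ≤ r) (hy : y ∈ Icc (0 : ℝ) 1) :
    (1 + y) ^ r - (1 - y) ^ r ≤ r * y * ((1 + y) ^ r + (1 - y) ^ r) := by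
  let F : ℝ → ℝ := fun y => r * y * ((1 + y) ^ r + (1 - y) ^ r) - ((1 + y) ^ r - (1 - y) ^ r)
  have hd : ∀ z ∈ interior (Icc (0 : ℝ) 1), HasDerivAt F
      (r * ((1 + z) ^ r + (1 - z) ^ r) + r * z * (r * (1 + z) ^ (r - 1) - r * (1 - z) ^ (r - 1))
        - (r * (1 + z) ^ (r - 1) + r * (1 - z) ^ (r - 1))) z := by
    intro z hz
    rw [interior_Icc] at hz
    have h1 : HasDerivAt (fun y : ℝ => (1 + y) ^ r) (r * (1 + z) ^ (r - 1)) z := by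
      have := ((hasDerivAt_id z).const_add 1).rpow_const (p := r) (Or.inr hr)
      simpa [mul_comm] using this
    have h2 : HasDerivAt (fun y : ℝ => (1 - y) ^ r) (-(r * (1 - z) ^ (r - 1))) z := by
      have := ((hasDerivAt_id z).const_sub 1).rpow_const (p := r) (Or.inr hr)
      simpa [mul_comm] using this
    have h3 : HasDerivAt (fun y : ℝ => r * y) r z := by
      simpa using (hasDerivAt_id z).const_mul r
    refine ((h3.mul (h1.add h2)).sub (h1.sub h2)).congr_deriv ?_
    simp only [Pi.add_apply]
    ring
  have hmono : MonotoneOn F (Icc 0 1) := by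
    apply monotoneOn_of_deriv_nonneg (convex_Icc 0 1)
    · have : Continuous F := by
        have h1 : Continuous fun y : ℝ => (1 + y) ^ r :=
          (continuous_const.add continuous_id).rpow_const fun _ => Or.inr (by linarith)
        have h2 : Continuous fun y : ℝ => (1 - y) ^ r :=
          (continuous_const.sub continuous_id).rpow_const fun _ => Or.inr (by linarith)
        fun_prop
      exact this.continuousOn
    · exact fun z hz => (hd z hz).differentiableAt.differentiableWithinAt
    · intro z hz
      rw [(hd z hz).deriv]
      rw [interior_Icc] at hz
      have e1 : (1 + z) ^ r = (1 + z) ^ (r - 1) * (1 + z) := by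
        rw [← Real.rpow_add_one (by linarith [hz.1]), sub_add_cancel]
      have e2 : (1 - z) ^ r = (1 - z) ^ (r - 1) * (1 - z) := by
        rw [← Real.rpow_add_one (by linarith [hz.2]), sub_add_cancel]
      have hle : (1 - z) ^ (r - 1) ≤ (1 + z) ^ (r - 1) :=
        Real.rpow_le_rpow (by linarith [hz.2]) (by linarith [hz.1]) (by linarith)
      rw [e1, e2]
      -- With both powers reduced to exponent `r - 1`, the derivative of `F` is exactly this
      -- product.
      have : 0 ≤ (r * z + r * z * r) * ((1 + z) ^ (r - 1) - (1 - z) ^ (r - 1)) :=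
        mul_nonneg (by have := hz.1; positivity) (by linarith)
      linarith
  have h0 := hmono (left_mem_Icc.2 zero_le_one) hy hy.1
  simp only [F] at h0
  norm_num at h0
  linarith

/-- The quotient of the two sides is nonincreasing on `[0,1]` and equals 2 at `y = 0`. The sign of
its derivative is the preceding inequality with `r = p - 1`. -/
theorem two_point_unit {p y : ℝ} (hp : 2 ≤ p) (hy : y ∈ Icc (0 : ℝ) 1) :
    (1 + y) ^ p + (1 - y) ^ p ≤ 2 * (1 + (p - 1) * y ^ 2) ^ (p / 2) := by
  let F : ℝ → ℝ := fun y => ((1 + y) ^ p + (1 - y) ^ p) * (1 + (p - 1) * y ^ 2) ^ (-(p / 2))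
  have hpos : ∀ z : ℝ, 0 < 1 + (p - 1) * z ^ 2 := fun z => by nlinarith [sq_nonneg z]
  have hd : ∀ z : ℝ, HasDerivAt F
      (p * ((1 + z) ^ (p - 1) - (1 - z) ^ (p - 1)) * (1 + (p - 1) * z ^ 2) ^ (-(p / 2))
        + ((1 + z) ^ p + (1 - z) ^ p) *
          (-(p * (p - 1) * z) * (1 + (p - 1) * z ^ 2) ^ (-(p / 2) - 1))) z := by
    intro z
    have h1 : HasDerivAt (fun y : ℝ => (1 + y) ^ p) (p * (1 + z) ^ (p - 1)) z := by
      have := ((hasDerivAt_id z).const_add 1).rpow_const (p := p) (Or.inr (by linarith))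
      simpa [mul_comm] using this
    have h2 : HasDerivAt (fun y : ℝ => (1 - y) ^ p) (-(p * (1 - z) ^ (p - 1))) z := by
      have := ((hasDerivAt_id z).const_sub 1).rpow_const (p := p) (Or.inr (by linarith))
      simpa [mul_comm] using this
    have h3 : HasDerivAt (fun y : ℝ => 1 + (p - 1) * y ^ 2) ((p - 1) * (2 * z)) z := by
      have := ((hasDerivAt_pow 2 z).const_mul (p - 1)).const_add 1
      simpa using this
    have h4 := h3.rpow_const (p := -(p / 2)) (Or.inl (hpos z).ne')
    refine ((h1.add h2).mul h4).congr_deriv ?_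
    simp only [Pi.add_apply]
    ring
  have hanti : AntitoneOn F (Icc 0 1) := by
    apply antitoneOn_of_deriv_nonpos (convex_Icc 0 1)
    · exact fun z _ => (hd z).continuousAt.continuousWithinAt
    · exact fun z _ => (hd z).differentiableAt.differentiableWithinAt
    · intro z hz
      rw [(hd z).deriv]
      rw [interior_Icc] at hz
      have key := rpow_sub_rpow_le (r := p - 1) (by linarith) ⟨hz.1.le, hz.2.le⟩
      have e1 : (1 + z) ^ p = (1 + z) ^ (p - 1) * (1 + z) := by
        rw [← Real.rpow_add_one (by linarith [hz.1]), sub_add_cancel]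
      have e2 : (1 - z) ^ p = (1 - z) ^ (p - 1) * (1 - z) := by
        rw [← Real.rpow_add_one (by linarith [hz.2]), sub_add_cancel]
      have e3 : (1 + (p - 1) * z ^ 2) ^ (-(p / 2))
          = (1 + (p - 1) * z ^ 2) ^ (-(p / 2) - 1) * (1 + (p - 1) * z ^ 2) := by
        rw [← Real.rpow_add_one (hpos z).ne', sub_add_cancel]
      rw [e1, e2, e3]
      set a := (1 + z) ^ (p - 1)
      set b := (1 - z) ^ (p - 1)
      have hq : 0 < (1 + (p - 1) * z ^ 2) ^ (-(p / 2) - 1) := Real.rpow_pos_of_pos (hpos z) _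
      set w := (1 + (p - 1) * z ^ 2) ^ (-(p / 2) - 1)
      -- The terms of the derivative in `z ^ 2 * (a - b)` cancel, so the derivative is minus this
      -- expression.
      have : 0 ≤ p * w * ((p - 1) * z * (a + b) - (a - b)) :=
        mul_nonneg (by positivity) (by linarith)
      linarith
  have h0 := hanti (left_mem_Icc.2 zero_le_one) hy hy.1
  have hF0 : F 0 = 2 := by simp [F]; norm_num
  rw [hF0] at h0
  simp only [F] at h0
  rwa [Real.rpow_neg (hpos y).le, ← div_eq_mul_inv,
    div_le_iff₀ (Real.rpow_pos_of_pos (hpos y) _)] at h0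

/-- The two-point hypercontractive inequality for exponents `p ≥ 2`. -/
theorem two_point {p : ℝ} (hp : 2 ≤ p) (x y : ℝ) :
    |x + y| ^ p + |x - y| ^ p ≤ 2 * (x ^ 2 + (p - 1) * y ^ 2) ^ (p / 2) := by
  have hom : ∀ {a b : ℝ}, 0 < a → 0 ≤ b → b ≤ a →
      (a + b) ^ p + (a - b) ^ p ≤ 2 * (a ^ 2 + (p - 1) * b ^ 2) ^ (p / 2) := by
    intro a b ha hb hba
    have h := two_point_unit hp (y := b / a) ⟨by positivity, (div_le_one ha).2 hba⟩
    have e1 : a + b = a * (1 + b / a) := by field_simp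
    have e2 : a - b = a * (1 - b / a) := by field_simp
    have e3 : a ^ 2 + (p - 1) * b ^ 2 = a ^ 2 * (1 + (p - 1) * (b / a) ^ 2) := by field_simp
    have e4 : (a ^ 2) ^ (p / 2) = a ^ p := by
      rw [← Real.rpow_natCast, ← Real.rpow_mul ha.le]; congr 1; push_cast; ring
    have h1 : 0 ≤ 1 - b / a := sub_nonneg.2 ((div_le_one ha).2 hba)
    have h2 : 0 ≤ 1 + (p - 1) * (b / a) ^ 2 := by nlinarith [sq_nonneg (b / a)]
    rw [e1, e2, e3, Real.mul_rpow ha.le (by positivity), Real.mul_rpow ha.le h1,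
      Real.mul_rpow (by positivity) h2, e4]
    have := mul_le_mul_of_nonneg_left h (Real.rpow_nonneg ha.le p)
    linarith
  have habs : |x + y| ^ p + |x - y| ^ p = (|x| + |y|) ^ p + |(|x| - |y|)| ^ p := by
    rcases abs_cases x with ⟨hx, _⟩ | ⟨hx, _⟩ <;> rcases abs_cases y with ⟨hy, _⟩ | ⟨hy, _⟩ <;>
      rw [hx, hy]
    · rw [abs_of_nonneg (by linarith : 0 ≤ x + y)]
    · rw [sub_neg_eq_add, ← sub_eq_add_neg, abs_of_nonneg (by linarith : 0 ≤ x - y), add_comm]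
    · rw [← abs_neg (x + y), ← abs_neg (x - y), abs_of_nonneg (by linarith : 0 ≤ -(x - y)),
        add_comm]
      ring_nf
    · rw [← abs_neg (x + y), ← abs_neg (x - y), abs_of_nonneg (by linarith : 0 ≤ -(x + y))]
      ring_nf
  rw [habs, ← sq_abs x, ← sq_abs y]
  have hx := abs_nonneg x
  have hy := abs_nonneg y
  rcases le_total |y| |x| with h | h
  · rcases hx.eq_or_lt with h0 | h0
    · have hy0 : |y| = 0 := by linarith
      rw [← h0, hy0]
      simp [Real.zero_rpow (by linarith : p ≠ 0), Real.zero_rpow (by linarith : p / 2 ≠ 0)]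
    · rw [abs_of_nonneg (sub_nonneg.2 h)]
      exact hom h0 hy h
  · rcases hy.eq_or_lt with h0 | h0
    · have hx0 : |x| = 0 := by linarith
      rw [← h0, hx0]
      simp [Real.zero_rpow (by linarith : p ≠ 0), Real.zero_rpow (by linarith : p / 2 ≠ 0)]
    · rw [abs_sub_comm, abs_of_nonneg (sub_nonneg.2 h), add_comm |x|]
      refine (hom h0 hx h).trans ?_
      -- The left side is symmetric in `|x|` and `|y|`, and since `p - 1 ≥ 1` the right side is
      -- larger when the factor `p - 1` sits on the larger of the two.
      have : |y| ^ 2 + (p - 1) * |x| ^ 2 ≤ |x| ^ 2 + (p - 1) * |y| ^ 2 := by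
        have : |x| ^ 2 ≤ |y| ^ 2 := by gcongr
        nlinarith
      have h3 : 0 ≤ |y| ^ 2 + (p - 1) * |x| ^ 2 := by nlinarith [sq_nonneg |x|, sq_nonneg |y|]
      gcongr

/-! ### Two-uniform smoothness and orthogonality -/

/-- In a 2-uniformly smooth space, if `x` is not longer than any `x + t • y`, then
`‖x + y‖ ^ 2 ≤ ‖x‖ ^ 2 + K * ‖y‖ ^ 2`. -/
theorem norm_add_sq_le_of_smooth {B : Type*} [NormedAddCommGroup B] [NormedSpace ℝ B] {K : ℝ}
    (hsm : ∀ u v : B, ‖u + v‖ ^ 2 + ‖u - v‖ ^ 2 ≤ 2 * ‖u‖ ^ 2 + 2 * K * ‖v‖ ^ 2)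
    {x y : B} (hxy : ∀ t : ℝ, ‖x‖ ≤ ‖x + t • y‖) :
    ‖x + y‖ ^ 2 ≤ ‖x‖ ^ 2 + K * ‖y‖ ^ 2 := by
  have key : ∀ N : ℕ, 0 < N →
      ‖x + y‖ ^ 2 ≤ ‖x‖ ^ 2 + K * ‖y‖ ^ 2 + K * ‖y‖ ^ 2 * (1 / (N : ℝ)) := by
    intro N hN
    have hN' : (0 : ℝ) < N := by exact_mod_cast hN
    let s : ℝ := 1 / N
    -- Smoothness says that `k` has nonpositive second differences on the grid of mesh `1 / N`. Its
    -- increment into `0` is small because `x` is shortest on the line, so every later increment is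
    -- as small. Summing `N` of them leaves an error of order `1 / N`.
    let k : ℝ → ℝ := fun j => ‖x + (j * s) • y‖ ^ 2 - K * ‖y‖ ^ 2 * (j * s) ^ 2
    have hconc : ∀ j : ℝ, k (j + 1) - k j ≤ k j - k (j - 1) := by
      intro j
      have h := hsm (x + (j * s) • y) (s • y)
      have e1 : x + (j * s) • y + s • y = x + ((j + 1) * s) • y := by module
      have e2 : x + (j * s) • y - s • y = x + ((j - 1) * s) • y := by module
      rw [e1, e2, norm_smul, mul_pow, Real.norm_eq_abs, sq_abs] at h
      simp only [k]
      nlinarith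
    have hneg : k 0 - k (0 - 1) ≤ K * ‖y‖ ^ 2 * s ^ 2 := by
      have h := hxy ((0 - 1) * s)
      have h' : ‖x‖ ^ 2 ≤ ‖x + ((0 - 1) * s) • y‖ ^ 2 := by gcongr
      simp only [k]
      simp only [zero_mul, zero_smul, add_zero] at *
      nlinarith
    have hstep : ∀ j : ℕ, k (j + 1) - k j ≤ K * ‖y‖ ^ 2 * s ^ 2 := by
      intro j
      induction j with
      | zero => simpa using (hconc 0).trans hneg
      | succ j ih =>
        have := hconc ((j + 1 : ℕ) : ℝ)
        push_cast at this ⊢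
        rw [add_sub_cancel_right] at this
        exact this.trans ih
    have hsum : ∀ j : ℕ, k j ≤ k 0 + j * (K * ‖y‖ ^ 2 * s ^ 2) := by
      intro j
      induction j with
      | zero => simp
      | succ j ih => push_cast; linarith [hstep j]
    have h := hsum N
    have hs : (N : ℝ) * s = 1 := by simp only [s]; field_simp
    have e : (N : ℝ) * (K * ‖y‖ ^ 2 * s ^ 2) = K * ‖y‖ ^ 2 * s := by
      calc _ = K * ‖y‖ ^ 2 * s * (N * s) := by ring
        _ = _ := by rw [hs, mul_one]
    rw [e] at h
    simp only [k, hs, one_smul, zero_mul, zero_smul, add_zero] at h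
    simp only [s] at h
    linarith
  have hlim : Filter.Tendsto
      (fun N : ℕ => ‖x‖ ^ 2 + K * ‖y‖ ^ 2 + K * ‖y‖ ^ 2 * (1 / (N : ℝ))) Filter.atTop
      (nhds (‖x‖ ^ 2 + K * ‖y‖ ^ 2 + K * ‖y‖ ^ 2 * 0)) :=
    (tendsto_one_div_atTop_nhds_zero_nat.const_mul _).const_add _
  rw [mul_zero, add_zero] at hlim
  exact ge_of_tendsto hlim (Filter.eventually_atTop.2 ⟨1, fun N hN => key N hN⟩)

variable {Ω : Type*} [mΩ : MeasurableSpace Ω] {P : Measure Ω}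

theorem eLpNorm_rpow_eq_lintegral {p : ℝ} (hp : 0 < p) (f : Ω → ℝ) :
    eLpNorm f (ENNReal.ofReal p) P ^ p = ∫⁻ ω, ‖f ω‖ₑ ^ p ∂P := by
  rw [eLpNorm_eq_lintegral_rpow_enorm_toReal (by simpa using hp) ENNReal.ofReal_ne_top,
    ENNReal.toReal_ofReal hp.le, ← ENNReal.rpow_mul, one_div, inv_mul_cancel₀ hp.ne',
    ENNReal.rpow_one]

theorem enorm_two_point {p : ℝ} (hp : 2 ≤ p) (x y : ℝ) :
    ‖x + y‖ₑ ^ p + ‖x - y‖ₑ ^ p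
      ≤ 2 * (‖x‖ₑ ^ (2 : ℝ) + ENNReal.ofReal (p - 1) * ‖y‖ₑ ^ (2 : ℝ)) ^ (p / 2) := by
  have h := ENNReal.ofReal_le_ofReal (two_point hp x y)
  have hp0 : 0 ≤ p := by linarith
  have hp1 : 0 ≤ p - 1 := by linarith
  rw [ENNReal.ofReal_add (by positivity) (by positivity),
    ENNReal.ofReal_mul (by norm_num), ← ENNReal.ofReal_rpow_of_nonneg (by positivity) hp0,
    ← ENNReal.ofReal_rpow_of_nonneg (by positivity) hp0,
    ← ENNReal.ofReal_rpow_of_nonneg (by positivity) (by positivity),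
    ENNReal.ofReal_add (by positivity) (by positivity), ENNReal.ofReal_mul hp1,
    ← sq_abs x, ← sq_abs y, ENNReal.ofReal_pow (abs_nonneg _),
    ENNReal.ofReal_pow (abs_nonneg _)] at h
  simpa [← Real.enorm_eq_ofReal_abs] using h

/-- The space `L^p`, `p ≥ 2`, is 2-uniformly smooth with constant `p - 1`. -/
theorem Lp_smooth {p : ℝ} (hp : 2 ≤ p) [Fact (1 ≤ ENNReal.ofReal p)]
    (u v : Lp ℝ (ENNReal.ofReal p) P) :
    ‖u + v‖ ^ 2 + ‖u - v‖ ^ 2 ≤ 2 * ‖u‖ ^ 2 + 2 * (p - 1) * ‖v‖ ^ 2 := by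
  have hp0 : 0 < p := by linarith
  have hp1 : 0 ≤ p - 1 := by linarith
  have hen : ∀ w : Lp ℝ (ENNReal.ofReal p) P,
      ENNReal.ofReal ‖w‖ ^ p = ∫⁻ ω, ‖w ω‖ₑ ^ p ∂P := by
    intro w
    rw [Lp.norm_def, ENNReal.ofReal_toReal (Lp.eLpNorm_ne_top w), eLpNorm_rpow_eq_lintegral hp0]
  have hmeas : ∀ w : Lp ℝ (ENNReal.ofReal p) P, AEMeasurable (fun ω => ‖w ω‖ₑ) P :=
    fun w => (Lp.aestronglyMeasurable w).enorm
  have h1 : ENNReal.ofReal ‖u + v‖ ^ p + ENNReal.ofReal ‖u - v‖ ^ p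
      ≤ 2 * ∫⁻ ω, (‖u ω‖ₑ ^ (2 : ℝ) + ENNReal.ofReal (p - 1) * ‖v ω‖ₑ ^ (2 : ℝ)) ^ (p / 2) ∂P := by
    rw [hen, hen, ← lintegral_add_left' ((hmeas _).pow_const _), ← lintegral_const_mul' _ _ (by simp)]
    refine lintegral_mono_ae ?_
    filter_upwards [Lp.coeFn_add u v, Lp.coeFn_sub u v] with ω ha hb
    rw [ha, hb]
    exact enorm_two_point hp _ _
  -- Minkowski's inequality in `L^{p/2}`, which needs `p ≥ 2`, splits the pointwise two-point bound
  -- into norms of `u` and `v`.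
  have h2 := ENNReal.lintegral_Lp_add_le (p := p / 2) ((hmeas u).pow_const (2 : ℝ))
    (((hmeas v).pow_const (2 : ℝ)).const_mul (ENNReal.ofReal (p - 1))) (by linarith)
  have h3 : ∀ w : Lp ℝ (ENNReal.ofReal p) P,
      (∫⁻ ω, (‖w ω‖ₑ ^ (2 : ℝ)) ^ (p / 2) ∂P) ^ (1 / (p / 2)) = ENNReal.ofReal ‖w‖ ^ (2 : ℝ) := by
    intro w
    simp_rw [← ENNReal.rpow_mul]
    rw [show 2 * (p / 2) = p by ring, ← hen, ← ENNReal.rpow_mul]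
    congr 1
    field_simp
  have h4 : (∫⁻ ω, (ENNReal.ofReal (p - 1) * ‖v ω‖ₑ ^ (2 : ℝ)) ^ (p / 2) ∂P) ^ (1 / (p / 2))
      = ENNReal.ofReal (p - 1) * ENNReal.ofReal ‖v‖ ^ (2 : ℝ) := by
    have : 0 ≤ p / 2 := by positivity
    simp_rw [ENNReal.mul_rpow_of_nonneg _ _ this]
    rw [lintegral_const_mul' _ _ (ENNReal.rpow_ne_top_of_nonneg this ENNReal.ofReal_ne_top),
      ENNReal.mul_rpow_of_nonneg _ _ (by positivity), h3, ← ENNReal.rpow_mul]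
    congr 1
    rw [show p / 2 * (1 / (p / 2)) = 1 by field_simp, ENNReal.rpow_one]
  simp only [Pi.add_apply] at h2
  rw [h3, h4, one_div, ENNReal.rpow_inv_le_iff (by positivity)] at h2
  have h5 := h1.trans (mul_le_mul_right h2 2)
  have nn := fun w : Lp ℝ (ENNReal.ofReal p) P => norm_nonneg w
  simp only [ENNReal.ofReal_rpow_of_nonneg (nn _) hp0.le,
    ENNReal.ofReal_rpow_of_nonneg (nn _) zero_le_two] at h5
  rw [← ENNReal.ofReal_mul hp1, ← ENNReal.ofReal_add (by positivity) (by positivity),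
    ← ENNReal.ofReal_add (by positivity) (by positivity),
    ENNReal.ofReal_rpow_of_nonneg (by positivity) (by positivity),
    show (2 : ℝ≥0∞) = ENNReal.ofReal 2 by simp, ← ENNReal.ofReal_mul (by positivity),
    ENNReal.ofReal_le_ofReal_iff (by positivity)] at h5
  -- Convexity of `z ^ (p / 2)` turns the mean of the `p`-th powers into the `p / 2`-th power of the
  -- mean of the squares.
  have h6 := (convexOn_rpow (show 1 ≤ p / 2 by linarith)).2 (x := ‖u + v‖ ^ 2)
    (y := ‖u - v‖ ^ 2) (mem_Ici.2 (by positivity)) (mem_Ici.2 (by positivity))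
    (show (0 : ℝ) ≤ 1 / 2 by norm_num) (show (0 : ℝ) ≤ 1 / 2 by norm_num) (by norm_num)
  simp only [smul_eq_mul] at h6
  have e : ∀ w : Lp ℝ (ENNReal.ofReal p) P, (‖w‖ ^ 2) ^ (p / 2) = ‖w‖ ^ p := by
    intro w
    rw [← Real.rpow_natCast, ← Real.rpow_mul (nn w)]; congr 1; push_cast; ring
  rw [e, e] at h6
  simp only [Real.rpow_two] at h5
  have h7 := (Real.rpow_le_rpow_iff (z := p / 2) (by positivity) (by positivity)
    (by positivity)).1 (h6.trans (by linarith :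
      _ ≤ (‖u‖ ^ 2 + (p - 1) * ‖v‖ ^ 2) ^ (p / 2)))
  linarith

/-! ### Moment inequality for sums of independent random variables -/

variable [IsProbabilityMeasure P]

/-- Adding an independent centered random variable does not decrease the `L^p` norm. -/
theorem eLpNorm_le_add_of_indep {p : ℝ≥0∞} (hp : 1 ≤ p) {x y : Ω → ℝ} (hxm : Measurable x)
    (hym : Measurable y) (hx : Integrable x P) (hy : Integrable y P)
    (hxy : IndepFun x y P) (hy0 : ∫ ω, y ω ∂P = 0) :
    eLpNorm x p P ≤ eLpNorm (x + y) p P := by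
  -- Conditioning on `x` contracts `L^p` norms and maps `x + y` to `x`, because `y` is independent
  -- of `x` and centered.
  have h := eLpNorm_condExp_le_eLpNorm (m := MeasurableSpace.comap x inferInstance) (μ := P)
    (x + y) hp
  have h1 : P[x + y | MeasurableSpace.comap x inferInstance] =ᵐ[P] x := by
    have ha := condExp_add hx hy (MeasurableSpace.comap x inferInstance)
    have hb : P[x | MeasurableSpace.comap x inferInstance] = x :=
      condExp_of_stronglyMeasurable hxm.comap_le
        (comap_measurable x).stronglyMeasurable hx
    have hc := condExp_indep_eq (μ := P) hym.comap_le hxm.comap_le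
      (comap_measurable y).stronglyMeasurable hxy.symm
    filter_upwards [ha, hc] with ω h1 h2
    rw [h1, Pi.add_apply, hb, h2, hy0, add_zero]
  rwa [eLpNorm_congr_ae h1] at h

/-- Rio's inequality for an independent centered increment. -/
theorem eLpNorm_add_sq_le_of_indep {p : ℝ} (hp : 2 ≤ p) {x y : Ω → ℝ} (hxm : Measurable x)
    (hym : Measurable y) (hx : MemLp x (ENNReal.ofReal p) P) (hy : MemLp y (ENNReal.ofReal p) P)
    (hxy : IndepFun x y P) (hy0 : ∫ ω, y ω ∂P = 0) :
    (eLpNorm (x + y) (ENNReal.ofReal p) P).toReal ^ 2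
      ≤ (eLpNorm x (ENNReal.ofReal p) P).toReal ^ 2
        + (p - 1) * (eLpNorm y (ENNReal.ofReal p) P).toReal ^ 2 := by
  have hp1 : 1 ≤ ENNReal.ofReal p := by
    rw [← ENNReal.ofReal_one]; exact ENNReal.ofReal_le_ofReal (by linarith)
  have : Fact (1 ≤ ENNReal.ofReal p) := ⟨hp1⟩
  have h := norm_add_sq_le_of_smooth (Lp_smooth (P := P) hp) (x := hx.toLp x) (y := hy.toLp y) ?_
  · rwa [← MemLp.toLp_add, Lp.norm_toLp, Lp.norm_toLp, Lp.norm_toLp] at h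
  -- Every multiple of `y` is again centered and independent of `x`, so `x` is shortest on the whole
  -- line in direction `y`.
  · intro t
    rw [← MemLp.toLp_const_smul, ← MemLp.toLp_add, Lp.norm_toLp, Lp.norm_toLp]
    refine ENNReal.toReal_mono (hx.add (hy.const_smul t)).eLpNorm_ne_top ?_
    refine eLpNorm_le_add_of_indep hp1 hxm (hym.const_smul t) (hx.integrable hp1)
      ((hy.const_smul t).integrable hp1) ?_ ?_
    · exact hxy.comp measurable_id (measurable_const_smul t)
    · simp [integral_const_mul, hy0]

/-- The `L^p` error of a sum of independent random variables. -/
theorem eLpNorm_sum_sub_integral_le {ι : Type*} {p B : ℝ} (hp : 2 ≤ p) (hB : 0 ≤ B)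
    {Z : ι → Ω → ℝ} (hZm : ∀ i, Measurable (Z i)) (hZ : iIndepFun Z P) (s : Finset ι)
    (hZp : ∀ i ∈ s, eLpNorm (Z i) (ENNReal.ofReal p) P ≤ ENNReal.ofReal B) :
    eLpNorm (fun ω => ∑ i ∈ s, (Z i ω - ∫ ω', Z i ω' ∂P)) (ENNReal.ofReal p) P
      ≤ ENNReal.ofReal (√(p - 1) * √(s.card) * (2 * B)) := by
  classical
  have hp1 : 1 ≤ ENNReal.ofReal p := by
    rw [← ENNReal.ofReal_one]; exact ENNReal.ofReal_le_ofReal (by linarith)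
  let Y : ι → Ω → ℝ := fun i ω => Z i ω - ∫ ω', Z i ω' ∂P
  have hYm : ∀ i, Measurable (Y i) := fun i => (hZm i).sub_const _
  have hYi : iIndepFun Y P :=
    hZ.comp (fun i z => z - ∫ ω', Z i ω' ∂P) fun i => measurable_id.sub_const _
  have hZL : ∀ i ∈ s, MemLp (Z i) (ENNReal.ofReal p) P := fun i hi =>
    ⟨(hZm i).aestronglyMeasurable, (hZp i hi).trans_lt ENNReal.ofReal_lt_top⟩
  have hYL : ∀ i ∈ s, MemLp (Y i) (ENNReal.ofReal p) P := fun i hi =>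
    (hZL i hi).sub (memLp_const _)
  -- Centering at most doubles the norm, since the mean is bounded by the `L^p` norm. This is the
  -- origin of the factor 2 in the final estimate.
  have hYn : ∀ i ∈ s, (eLpNorm (Y i) (ENNReal.ofReal p) P).toReal ≤ 2 * B := by
    intro i hi
    refine ENNReal.toReal_le_of_le_ofReal (by positivity) ?_
    have hint : |∫ ω', Z i ω' ∂P| ≤ B := by
      have h1 : ‖∫ ω', Z i ω' ∂P‖ₑ ≤ ENNReal.ofReal B :=
        (enorm_integral_le_lintegral_enorm _).trans
          ((eLpNorm_one_eq_lintegral_enorm (μ := P) (f := Z i)) ▸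
            (eLpNorm_le_eLpNorm_of_exponent_le hp1 (hZm i).aestronglyMeasurable).trans (hZp i hi))
      rw [Real.enorm_eq_ofReal_abs] at h1
      exact (ENNReal.ofReal_le_ofReal_iff hB).1 h1
    refine (eLpNorm_sub_le (hZm i).aestronglyMeasurable aestronglyMeasurable_const hp1).trans ?_
    rw [two_mul, ENNReal.ofReal_add hB hB]
    refine add_le_add (hZp i hi) ?_
    rw [eLpNorm_const _ (by positivity) (NeZero.ne P)]
    simpa [Real.enorm_eq_ofReal_abs] using ENNReal.ofReal_le_ofReal hint
  have hY0 : ∀ i ∈ s, ∫ ω, Y i ω ∂P = 0 := by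
    intro i hi
    simp only [Y]
    rw [integral_sub ((hZL i hi).integrable hp1) (integrable_const _)]
    simp
  have main : ∀ t ⊆ s, MemLp (fun ω => ∑ i ∈ t, Y i ω) (ENNReal.ofReal p) P ∧
      (eLpNorm (fun ω => ∑ i ∈ t, Y i ω) (ENNReal.ofReal p) P).toReal ^ 2
        ≤ (p - 1) * t.card * (2 * B) ^ 2 := by
    intro t
    induction t using Finset.induction_on with
    | empty => intro _; simp
    | insert a t ha ih =>
      intro hts
      obtain ⟨hL, hb⟩ := ih ((Finset.subset_insert a t).trans hts)
      have has : a ∈ s := hts (Finset.mem_insert_self a t)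
      have e : (fun ω => ∑ i ∈ insert a t, Y i ω) = (fun ω => ∑ i ∈ t, Y i ω) + Y a := by
        ext ω; simp [Finset.sum_insert ha, add_comm]
      rw [e]
      refine ⟨hL.add (hYL a has), ?_⟩
      have hind : IndepFun (fun ω => ∑ i ∈ t, Y i ω) (Y a) P := by
        have := hYi.indepFun_finsetSum_of_notMem hYm ha
        convert this using 1
        ext ω; simp
      have h := eLpNorm_add_sq_le_of_indep hp (Finset.measurable_fun_sum t fun i _ => hYm i)
        (hYm a) hL (hYL a has) hind (hY0 a has)
      have h2 : (eLpNorm (Y a) (ENNReal.ofReal p) P).toReal ^ 2 ≤ (2 * B) ^ 2 := by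
        gcongr; exact hYn a has
      have h3 : (p - 1) * (eLpNorm (Y a) (ENNReal.ofReal p) P).toReal ^ 2
          ≤ (p - 1) * (2 * B) ^ 2 := mul_le_mul_of_nonneg_left h2 (by linarith)
      rw [Finset.card_insert_of_notMem ha]
      push_cast
      linarith
  obtain ⟨hL, hb⟩ := main s subset_rfl
  rw [← ENNReal.ofReal_toReal hL.eLpNorm_ne_top]
  refine ENNReal.ofReal_le_ofReal ?_
  refine le_of_sq_le_sq ?_ (by positivity)
  rw [mul_pow, mul_pow, Real.sq_sqrt (by linarith), Real.sq_sqrt (by positivity)]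
  exact hb

/-! ### Independence of sigma-algebras -/

section Independence

variable {Ω : Type*} [mΩ : MeasurableSpace Ω] {P : Measure Ω}

theorem iIndepFun_of_iIndep {ι β : Type*} [mβ : MeasurableSpace β] {m : ι → MeasurableSpace Ω}
    (h : iIndep m P) {f : ι → Ω → β} (hf : ∀ i, Measurable[m i] (f i)) : iIndepFun f P :=
  (iIndepFun_iff_iIndep _ _ _).2 (iIndep_of_iIndep_of_le h fun i => (hf i).comap_le)

variable [IsProbabilityMeasure P]

/-- Disjoint blocks of independent sigma-algebras are independent. -/
theorem iIndep_biSup_of_disjoint {ι κ : Type*} {m : ι → MeasurableSpace Ω}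
    (hle : ∀ i, m i ≤ mΩ) (h : iIndep m P) {B : κ → Set ι}
    (hB : ∀ k l, k ≠ l → Disjoint (B k) (B l)) : iIndep (fun k => ⨆ i ∈ B k, m i) P := by
  classical
  rw [iIndep_iff]
  intro s f
  induction s using Finset.induction_on with
  | empty => intro _; simp
  | insert a s ha ih =>
    intro hf
    have hd : Disjoint (B a) (⋃ k ∈ s, B k) := by
      rw [Set.disjoint_iUnion₂_right]
      exact fun k hk => hB a k fun e => ha (e ▸ hk)
    have hi := indep_iSup_of_disjoint hle h hd
    have hm : MeasurableSet[⨆ i ∈ ⋃ k ∈ s, B k, m i] (⋂ k ∈ s, f k) := by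
      refine @Finset.measurableSet_biInter _ _ (_) _ s fun k hk => ?_
      exact (biSup_mono (f := m) fun i hi => mem_biUnion (s := (s : Set κ)) hk hi :
        ⨆ i ∈ B k, m i ≤ _) _ (hf k (Finset.mem_insert_of_mem hk))
    rw [Finset.set_biInter_insert, Finset.prod_insert ha,
      (Indep_iff _ _ _).1 hi _ _ (hf a (Finset.mem_insert_self a s)) hm,
      ih fun k hk => hf k (Finset.mem_insert_of_mem hk)]

/-- Two independent families of sigma-algebras that are independent of each other can be merged. -/
theorem iIndep_sup {ι : Type*} {m₁ m₂ : ι → MeasurableSpace Ω} (hle₁ : ∀ i, m₁ i ≤ mΩ)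
    (hle₂ : ∀ i, m₂ i ≤ mΩ) (h₁ : iIndep m₁ P) (h₂ : iIndep m₂ P)
    (h : Indep (⨆ i, m₁ i) (⨆ i, m₂ i) P) : iIndep (fun i => m₁ i ⊔ m₂ i) P := by
  classical
  -- Independence of all the algebras, indexed by the disjoint union, comes first; grouping the two
  -- copies of each `i` into a block then gives the claim.
  let m : ι ⊕ ι → MeasurableSpace Ω := Sum.elim m₁ m₂
  have hle : ∀ i, m i ≤ mΩ := by rintro (i | i); exacts [hle₁ i, hle₂ i]
  have hm : iIndep m P := by
    rw [iIndep_iff]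
    intro s f hf
    have e : s = s.toLeft.disjSum s.toRight := s.toLeft_disjSum_toRight.symm
    have h1 : ∀ i ∈ s.toLeft, MeasurableSet[m₁ i] (f (Sum.inl i)) :=
      fun i hi => hf (Sum.inl i) (Finset.mem_toLeft.1 hi)
    have h2 : ∀ i ∈ s.toRight, MeasurableSet[m₂ i] (f (Sum.inr i)) :=
      fun i hi => hf (Sum.inr i) (Finset.mem_toRight.1 hi)
    have hA : MeasurableSet[⨆ i, m₁ i] (⋂ i ∈ s.toLeft, f (Sum.inl i)) :=
      @Finset.measurableSet_biInter _ _ (_) _ _ fun i hi => le_iSup m₁ i _ (h1 i hi)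
    have hB : MeasurableSet[⨆ i, m₂ i] (⋂ i ∈ s.toRight, f (Sum.inr i)) :=
      @Finset.measurableSet_biInter _ _ (_) _ _ fun i hi => le_iSup m₂ i _ (h2 i hi)
    have hinter : (⋂ i ∈ s, f i)
        = (⋂ i ∈ s.toLeft, f (Sum.inl i)) ∩ ⋂ i ∈ s.toRight, f (Sum.inr i) := by
      ext ω
      simp [Finset.mem_toLeft, Finset.mem_toRight, Sum.forall]
    have hprod : (∏ i ∈ s, P (f i))
        = (∏ i ∈ s.toLeft, P (f (Sum.inl i))) * ∏ i ∈ s.toRight, P (f (Sum.inr i)) := by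
      conv_lhs => rw [e]
      rw [Finset.prod_disjSum]
    rw [hinter, (Indep_iff _ _ _).1 h _ _ hA hB, hprod, (iIndep_iff _ _).1 h₁ _ h1,
      (iIndep_iff _ _).1 h₂ _ h2]
  refine iIndep_of_iIndep_of_le (iIndep_biSup_of_disjoint hle hm
    (B := fun i => {Sum.inl i, Sum.inr i}) fun k l hkl => ?_) fun i => ?_
  · simpa [Set.disjoint_left] using hkl
  · exact sup_le (le_biSup m (by simp : Sum.inl i ∈ ({Sum.inl i, Sum.inr i} : Set (ι ⊕ ι))))
      (le_biSup m (by simp : Sum.inr i ∈ ({Sum.inl i, Sum.inr i} : Set (ι ⊕ ι))))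

end Independence

/-! ### Random fields that are measurable with respect to a sigma-algebra -/

/-- The random field `F` on `E` is measurable with respect to the product of the sigma-algebra of
`E` and the sigma-algebra `𝒜` on `Ω`. -/
def FieldMeasurable {E Ω β : Type*} [MeasurableSpace E] [MeasurableSpace β]
    (𝒜 : MeasurableSpace Ω) (F : E → Ω → β) : Prop :=
  Measurable fun q : E × Ω => F q.1 q.2

namespace FieldMeasurable

section

variable {E E' Ω β γ : Type*} [MeasurableSpace E] [MeasurableSpace E'] [MeasurableSpace β]
  [MeasurableSpace γ]

theorem mono {𝒜 ℬ : MeasurableSpace Ω} (h : 𝒜 ≤ ℬ) {F : E → Ω → β}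
    (hF : FieldMeasurable 𝒜 F) : FieldMeasurable ℬ F :=
  Measurable.mono hF (sup_le_sup le_rfl (MeasurableSpace.comap_mono h)) le_rfl

variable [𝒜 : MeasurableSpace Ω]

theorem section_measurable {F : E → Ω → β} (hF : FieldMeasurable 𝒜 F) (q : E) :
    Measurable (F q) :=
  (show Measurable fun q : E × Ω => F q.1 q.2 from hF).comp measurable_prodMk_left

theorem comp {F : E → Ω → β} (hF : FieldMeasurable 𝒜 F) {Y : E' → Ω → E}
    (hY : FieldMeasurable 𝒜 Y) : FieldMeasurable 𝒜 fun q ω => F (Y q ω) ω :=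
  Measurable.comp hF (Measurable.prodMk hY measurable_snd)

theorem map {F : E → Ω → β} (hF : FieldMeasurable 𝒜 F) {φ : β → γ} (hφ : Measurable φ) :
    FieldMeasurable 𝒜 fun q ω => φ (F q ω) :=
  hφ.comp hF

theorem of_fst {φ : E → β} (hφ : Measurable φ) : FieldMeasurable 𝒜 fun q (_ : Ω) => φ q :=
  hφ.comp measurable_fst

theorem add {F G : E → Ω → ℝ} (hF : FieldMeasurable 𝒜 F) (hG : FieldMeasurable 𝒜 G) :
    FieldMeasurable 𝒜 fun q ω => F q ω + G q ω :=
  Measurable.add hF hG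

theorem sub {F G : E → Ω → ℝ} (hF : FieldMeasurable 𝒜 F) (hG : FieldMeasurable 𝒜 G) :
    FieldMeasurable 𝒜 fun q ω => F q ω - G q ω :=
  Measurable.sub hF hG

theorem mul {F G : E → Ω → ℝ} (hF : FieldMeasurable 𝒜 F) (hG : FieldMeasurable 𝒜 G) :
    FieldMeasurable 𝒜 fun q ω => F q ω * G q ω :=
  Measurable.mul hF hG

theorem sum {ι : Type*} (s : Finset ι) {F : ι → E → Ω → ℝ}
    (hF : ∀ i ∈ s, FieldMeasurable 𝒜 (F i)) :
    FieldMeasurable 𝒜 fun q ω => ∑ i ∈ s, F i q ω :=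
  Finset.measurable_fun_sum s hF

end

end FieldMeasurable

/-! ### Freezing lemmas for independent random points -/

section Freezing

variable {E Ω β : Type*} [MeasurableSpace E] [MeasurableSpace β]
  {𝒜 ℬ 𝒜' ℬ' : MeasurableSpace Ω} [mΩ : MeasurableSpace Ω] {P : Measure Ω}
  [IsProbabilityMeasure P]

/-- The joint law of `(Y, π)` is a product, so Tonelli applies. The target of `π` is arbitrary in
order to allow `π = id` as a map from `Ω` to `Ω` with a smaller sigma-algebra. -/
theorem lintegral_comp_of_indepFun {Ω' : Type*} [MeasurableSpace Ω'] {Y : Ω → E} {π : Ω → Ω'}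
    (hY : Measurable Y) (hπ : Measurable π) (h : IndepFun Y π P) {F : E → Ω' → ℝ≥0∞}
    (hF : Measurable fun q : E × Ω' => F q.1 q.2) :
    ∫⁻ ω, F (Y ω) (π ω) ∂P = ∫⁻ y, ∫⁻ ω, F y (π ω) ∂P ∂(P.map Y) := by
  have : IsProbabilityMeasure (P.map π) := Measure.isProbabilityMeasure_map hπ.aemeasurable
  have h1 := lintegral_map (μ := P) hF (hY.prodMk hπ)
  rw [(indepFun_iff_map_prod_eq_prod_map_map hY.aemeasurable hπ.aemeasurable).1 h,
    lintegral_prod _ hF.aemeasurable] at h1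
  rw [← h1]
  refine lintegral_congr fun y => ?_
  exact lintegral_map (hF.comp measurable_prodMk_left) hπ

/-- Freezing lemma: a random field may be integrated separately when it is evaluated at an
independent random point. -/
theorem lintegral_freeze (h𝒜 : 𝒜 ≤ mΩ) (hℬ : ℬ ≤ mΩ)
    (h : Indep ℬ 𝒜 P) {F : E → Ω → ℝ≥0∞} (hF : FieldMeasurable 𝒜 F) {Y : Ω → E}
    (hY : Measurable[ℬ] Y) :
    ∫⁻ ω, F (Y ω) ω ∂P = ∫⁻ y, ∫⁻ ω, F y ω ∂P ∂(P.map Y) := by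
  -- The field is read as a function of its parameter and of the identity map into `(Ω, 𝒜)`, and
  -- independence of that map from `Y` is independence from `𝒜`.
  refine @lintegral_comp_of_indepFun E Ω _ mΩ P _ Ω 𝒜 Y id (hY.mono hℬ le_rfl)
    (measurable_id'' h𝒜) ?_ F hF
  refine (@IndepFun_iff_Indep Ω E Ω mΩ _ 𝒜 Y id P).2 ?_
  exact indep_of_indep_of_le_left (indep_of_indep_of_le_right h
    (@MeasurableSpace.comap_id Ω 𝒜).le) hY.comap_le

theorem integral_comp_of_indepFun {Ω' : Type*} [MeasurableSpace Ω'] {Y : Ω → E} {π : Ω → Ω'}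
    (hY : Measurable Y) (hπ : Measurable π) (h : IndepFun Y π P) {F : E → Ω' → ℝ}
    (hF : Measurable fun q : E × Ω' => F q.1 q.2) (hi : Integrable (fun ω => F (Y ω) (π ω)) P) :
    ∫ ω, F (Y ω) (π ω) ∂P = ∫ y, ∫ ω, F y (π ω) ∂P ∂(P.map Y) := by
  have : IsProbabilityMeasure (P.map π) := Measure.isProbabilityMeasure_map hπ.aemeasurable
  have h1 := integral_map (μ := P) (hY.prodMk hπ).aemeasurable hF.aestronglyMeasurable
  have h2 := (integrable_map_measure (μ := P) hF.aestronglyMeasurable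
    (hY.prodMk hπ).aemeasurable).2 hi
  rw [(indepFun_iff_map_prod_eq_prod_map_map hY.aemeasurable hπ.aemeasurable).1 h] at h1 h2
  rw [integral_prod _ h2] at h1
  rw [← h1]
  refine integral_congr_ae (Filter.Eventually.of_forall fun y => ?_)
  exact integral_map hπ.aemeasurable (hF.comp measurable_prodMk_left).aestronglyMeasurable

theorem integral_freeze (h𝒜 : 𝒜 ≤ mΩ) (hℬ : ℬ ≤ mΩ)
    (h : Indep ℬ 𝒜 P) {F : E → Ω → ℝ} (hF : FieldMeasurable 𝒜 F) {Y : Ω → E}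
    (hY : Measurable[ℬ] Y) (hi : Integrable (fun ω => F (Y ω) ω) P) :
    ∫ ω, F (Y ω) ω ∂P = ∫ y, ∫ ω, F y ω ∂P ∂(P.map Y) := by
  refine @integral_comp_of_indepFun E Ω _ mΩ P _ Ω 𝒜 Y id (hY.mono hℬ le_rfl)
    (measurable_id'' h𝒜) ?_ F hF hi
  refine (@IndepFun_iff_Indep Ω E Ω mΩ _ 𝒜 Y id P).2 ?_
  exact indep_of_indep_of_le_left (indep_of_indep_of_le_right h
    (@MeasurableSpace.comap_id Ω 𝒜).le) hY.comap_le

theorem map_freeze_apply (h𝒜 : 𝒜 ≤ mΩ) (hℬ : ℬ ≤ mΩ) (h : Indep ℬ 𝒜 P) {F : E → Ω → β}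
    (hF : FieldMeasurable 𝒜 F) {Y : Ω → E} (hY : Measurable[ℬ] Y) {s : Set β}
    (hs : MeasurableSet s) :
    P.map (fun ω => F (Y ω) ω) s = ∫⁻ y, P.map (F y) s ∂(P.map Y) := by
  have hF' := hF.mono h𝒜
  have hm : Measurable fun ω => F (Y ω) ω :=
    Measurable.comp hF' ((hY.mono hℬ le_rfl).prodMk measurable_id)
  have hind : Measurable (s.indicator (1 : β → ℝ≥0∞)) := measurable_one.indicator hs
  have := lintegral_freeze h𝒜 hℬ h (F := fun y ω => s.indicator (1 : β → ℝ≥0∞) (F y ω))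
    (FieldMeasurable.map (𝒜 := 𝒜) hF hind) hY
  rw [← lintegral_indicator_one hs, lintegral_map hind hm, this]
  refine lintegral_congr fun y => ?_
  rw [← lintegral_indicator_one hs, lintegral_map hind (hF'.section_measurable y)]

/-- The law of a random field at an independent random point only depends on the laws of the field
at fixed points and on the law of the random point. -/
theorem map_freeze_eq (h𝒜 : 𝒜 ≤ mΩ) (hℬ : ℬ ≤ mΩ)
    (h : Indep ℬ 𝒜 P) (h𝒜' : 𝒜' ≤ mΩ) (hℬ' : ℬ' ≤ mΩ) (h' : Indep ℬ' 𝒜' P)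
    {F F' : E → Ω → β} (hF : FieldMeasurable 𝒜 F) (hF' : FieldMeasurable 𝒜' F') {Y Y' : Ω → E}
    (hY : Measurable[ℬ] Y) (hY' : Measurable[ℬ'] Y')
    (hlaw : ∀ y, P.map (F y) = P.map (F' y)) (hYlaw : P.map Y = P.map Y') :
    P.map (fun ω => F (Y ω) ω) = P.map (fun ω => F' (Y' ω) ω) := by
  refine Measure.ext fun s hs => ?_
  rw [map_freeze_apply h𝒜 hℬ h hF hY hs, map_freeze_apply h𝒜' hℬ' h' hF' hY' hs, hYlaw]
  simp_rw [hlaw]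

/-- Freezing lemma for `L^p` norms. -/
theorem eLpNorm_freeze_le (h𝒜 : 𝒜 ≤ mΩ) (hℬ : ℬ ≤ mΩ)
    (h : Indep ℬ 𝒜 P) {F : E → Ω → ℝ} (hF : FieldMeasurable 𝒜 F) {Y : Ω → E}
    (hY : Measurable[ℬ] Y) {p : ℝ} (hp : 0 < p) {w : E → ℝ} (hw : Measurable w)
    (hFw : ∀ y, eLpNorm (F y) (ENNReal.ofReal p) P ≤ ‖w y‖ₑ) :
    eLpNorm (fun ω => F (Y ω) ω) (ENNReal.ofReal p) P
      ≤ eLpNorm (fun ω => w (Y ω)) (ENNReal.ofReal p) P := by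
  rw [← ENNReal.rpow_le_rpow_iff hp, eLpNorm_rpow_eq_lintegral hp, eLpNorm_rpow_eq_lintegral hp,
    lintegral_freeze h𝒜 hℬ h (F := fun y ω => ‖F y ω‖ₑ ^ p)
      (FieldMeasurable.map (𝒜 := 𝒜) hF (measurable_enorm.pow_const p)) hY,
    ← lintegral_map (f := fun y => ‖w y‖ₑ ^ p) (hw.enorm.pow_const p) (hY.mono hℬ le_rfl)]
  refine lintegral_mono fun y => ?_
  rw [← eLpNorm_rpow_eq_lintegral hp]
  exact ENNReal.rpow_le_rpow (hFw y) hp.le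

end Freezing

/-- The law of a sum of independent random variables only depends on the laws of the summands. -/
theorem map_sum_eq_of_iIndepFun {Ω ι : Type*} [MeasurableSpace Ω] {P : Measure Ω} [Countable ι]
    {Z Z' : ι → Ω → ℝ} (hZm : ∀ i, Measurable (Z i)) (hZm' : ∀ i, Measurable (Z' i))
    (hZ : iIndepFun Z P) (hZ' : iIndepFun Z' P) (s : Finset ι)
    (hlaw : ∀ i ∈ s, P.map (Z i) = P.map (Z' i)) :
    P.map (fun ω => ∑ i ∈ s, Z i ω) = P.map (fun ω => ∑ i ∈ s, Z' i ω) := by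
  classical
  have hφ : ∀ i, Measurable fun z : ℝ => if i ∈ s then z else 0 := fun i => by
    split_ifs <;> fun_prop
  -- Equality of laws is known only on `s`, so the other coordinates are set to zero before the two
  -- joint product laws are compared.
  have h := IdentDistrib.pi (fun i => ?_) (hZ.comp (fun i z => if i ∈ s then z else 0) hφ)
    (hZ'.comp (fun i z => if i ∈ s then z else 0) hφ)
  · convert (h.comp (u := fun z : ι → ℝ => ∑ i ∈ s, z i) (by fun_prop)).map_eq using 2 <;>
    · ext ω
      exact Finset.sum_congr rfl fun i hi => by simp [hi]
  · by_cases hi : i ∈ s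
    · simpa [hi, Function.comp_def] using
        (⟨(hZm i).aemeasurable, (hZm' i).aemeasurable, hlaw i hi⟩ : IdentDistrib (Z i) (Z' i) P P)
    · have := hZ.isProbabilityMeasure
      simpa [hi, Function.comp_def] using IdentDistrib.refl (μ := P) (aemeasurable_const (b := (0 : ℝ)))

/-! ### Index sets -/

namespace Index

/-- The indices that strictly extend `θ`. -/
def desc (θ : Index) : Set Index := {η | ∃ l, l ≠ [] ∧ η.1 = θ.1 ++ l}

/-- The indices that extend `(θ, k, j)` or `(θ, -k, j)`. -/
def branch (θ : Index) (k : ℕ) (j : ℤ) : Set Index :=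
  {η | ∃ k' l, Int.natAbs k' = k ∧ η.1 = θ.1 ++ k' :: j :: l}

theorem child_mem_branch (θ : Index) (k j : ℤ) : θ.child k j ∈ θ.branch k.natAbs j :=
  ⟨k, [], rfl, rfl⟩

theorem desc_child_subset_branch (θ : Index) (k j : ℤ) :
    (θ.child k j).desc ⊆ θ.branch k.natAbs j := by
  rintro η ⟨l, -, h⟩
  exact ⟨k, l, rfl, by simp [h, child]⟩

theorem branch_subset_desc (θ : Index) (k : ℕ) (j : ℤ) : θ.branch k j ⊆ θ.desc := by
  rintro η ⟨k', l, -, h⟩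
  exact ⟨_, by simp, h⟩

theorem branch_disjoint (θ : Index) {k k' : ℕ} {j j' : ℤ} (h : ¬(k = k' ∧ j = j')) :
    Disjoint (θ.branch k j) (θ.branch k' j') := by
  rw [Set.disjoint_left]
  rintro η ⟨a, l, ha, h1⟩ ⟨b, l', hb, h2⟩
  rw [h1, List.append_cancel_left_eq] at h2
  simp only [List.cons.injEq] at h2
  exact h ⟨by rw [← ha, ← hb, h2.1], h2.2.1⟩

theorem not_mem_desc_of_length_le {η ζ : Index} (h : ζ.1.length ≤ η.1.length) : ζ ∉ η.desc := by
  rintro ⟨l, hl, e⟩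
  have := congrArg List.length e
  rw [List.length_append] at this
  have := List.length_pos_iff.2 hl
  omega

/-- This makes each transition independent of the approximation evaluated at it: the latter only
uses strictly longer tuples. -/
theorem child_not_mem_desc_child (θ : Index) (k k' j j' : ℤ) :
    θ.child k j ∉ (θ.child k' j').desc :=
  not_mem_desc_of_length_le (by simp [child])

theorem desc_child_disjoint (θ : Index) {k k' : ℤ} (j : ℤ) (h : k ≠ k') :
    Disjoint (θ.child k j).desc (θ.child k' j).desc := by
  rw [Set.disjoint_left]
  rintro η ⟨l, -, h1⟩ ⟨l', -, h2⟩
  rw [h1] at h2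
  simp only [child, List.append_assoc, List.append_cancel_left_eq, List.cons_append,
    List.cons.injEq] at h2
  exact h h2.1

end Index

/-! ### Abstract multilevel Picard schemes -/

/-- The data that drive a multilevel Picard approximation on a state space `E`: for every index
`θ`, a random transition `Y θ q` and a random terminal value `G θ q` out of each state `q`, which
are independent for different indices and whose laws do not depend on `θ`; and a horizon `h`. -/
structure Scheme {Ω : Type*} [mΩ : MeasurableSpace Ω] (P : Measure Ω) (E : Type*)
    [MeasurableSpace E] where
  /-- the information carried by an index -/
  info : Index → MeasurableSpace Ω
  info_le : ∀ θ, info θ ≤ mΩ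
  info_indep : iIndep info P
  /-- the random transition -/
  Y : Index → E → Ω → E
  Y_measurable : ∀ θ, FieldMeasurable (info θ) (Y θ)
  Y_law : ∀ θ θ' q, P.map (Y θ q) = P.map (Y θ' q)
  /-- the random terminal value -/
  G : Index → E → Ω → ℝ
  G_measurable : ∀ θ, FieldMeasurable (info θ) (G θ)
  G_law : ∀ θ θ' q, P.map (G θ q) = P.map (G θ' q)
  /-- the time that remains -/
  h : E → ℝ
  h_measurable : Measurable h
  h_nonneg : ∀ q, 0 ≤ h q

namespace Scheme

variable {Ω E : Type*} [mΩ : MeasurableSpace Ω] {P : Measure Ω} [MeasurableSpace E]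

/-- The information carried by a set of indices. -/
@[reducible] def infoOn (S : Scheme P E) (A : Set Index) : MeasurableSpace Ω := ⨆ θ ∈ A, S.info θ

theorem infoOn_le (S : Scheme P E) (A : Set Index) : S.infoOn A ≤ mΩ :=
  iSup₂_le fun θ _ => S.info_le θ

theorem infoOn_mono (S : Scheme P E) {A B : Set Index} (h : A ⊆ B) : S.infoOn A ≤ S.infoOn B :=
  biSup_mono fun _ hi => h hi

theorem info_le_infoOn (S : Scheme P E) {A : Set Index} {θ : Index} (h : θ ∈ A) :
    S.info θ ≤ S.infoOn A :=
  le_biSup S.info h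

theorem indep_infoOn (S : Scheme P E) {A B : Set Index} (h : Disjoint A B) :
    Indep (S.infoOn A) (S.infoOn B) P :=
  indep_iSup_of_disjoint S.info_le S.info_indep h

theorem indep_info_infoOn (S : Scheme P E) {A : Set Index} {θ : Index} (h : θ ∉ A) :
    Indep (S.info θ) (S.infoOn A) P := by
  have := S.indep_infoOn (A := {θ}) (B := A) (by simpa using h)
  exact indep_of_indep_of_le_left this (S.info_le_infoOn rfl)

/-- The difference of two consecutive levels, evaluated at a random transition. -/
def incr (S : Scheme P E) (f : ℝ → ℝ) (U : Index → ℕ → E → Ω → ℝ) (θ : Index) (k : ℕ) (j : ℤ)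
    (q : E) (ω : Ω) : ℝ :=
  f (U (θ.child k j) k (S.Y (θ.child k j) q ω) ω)
    - if 1 ≤ k then f (U (θ.child (-k) j) (k - 1) (S.Y (θ.child k j) q ω) ω) else 0

/-- The fields `U θ n` are the multilevel Picard approximations with `m` samples per level. -/
structure IsMLP (S : Scheme P E) (f : ℝ → ℝ) (m : ℕ) (U : Index → ℕ → E → Ω → ℝ) : Prop where
  zero : ∀ θ q ω, U θ 0 q ω = 0
  recursion : ∀ n, 1 ≤ n → ∀ θ q ω, U θ n q ω =
    1 / (m : ℝ) ^ n * ∑ i ∈ Finset.range (m ^ n), S.G (θ.child 0 (-((i : ℤ) + 1))) q ω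
    + ∑ k ∈ Finset.range n, S.h q / (m : ℝ) ^ (n - k) *
        ∑ i ∈ Finset.range (m ^ (n - k)), S.incr f U θ k ((i : ℤ) + 1) q ω

variable {S : Scheme P E} {f : ℝ → ℝ} {m : ℕ} {U : Index → ℕ → E → Ω → ℝ}

/-- The transition and both approximations in an increment use indices beginning with `(θ, k, j)` or
`(θ, -k, j)`, that is, one branch. Measurability is assumed only up to level `k` so that the lemma
can serve inside the strong induction below. -/
theorem incr_measurable (hf : Measurable f) {θ : Index} {k : ℕ}
    (hU : ∀ l ≤ k, ∀ η, FieldMeasurable (S.infoOn η.desc) (U η l)) (j : ℤ) :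
    FieldMeasurable (S.infoOn (θ.branch k j)) (S.incr f U θ k j) := by
  have hY : FieldMeasurable (S.infoOn (θ.branch k j)) (S.Y (θ.child k j)) :=
    (S.Y_measurable _).mono (S.info_le_infoOn (by simpa using θ.child_mem_branch k j))
  have h1 : FieldMeasurable (S.infoOn (θ.branch k j)) (U (θ.child k j) k) :=
    (hU k le_rfl _).mono (S.infoOn_mono (by simpa using θ.desc_child_subset_branch k j))
  have h2 : FieldMeasurable (S.infoOn (θ.branch k j)) (U (θ.child (-k) j) (k - 1)) :=
    (hU (k - 1) (Nat.sub_le k 1) _).mono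
      (S.infoOn_mono (by simpa using θ.desc_child_subset_branch (-k) j))
  unfold incr
  refine FieldMeasurable.sub (𝒜 := S.infoOn (θ.branch k j))
    (FieldMeasurable.map (𝒜 := S.infoOn (θ.branch k j))
      (FieldMeasurable.comp (𝒜 := S.infoOn (θ.branch k j)) h1 hY) hf) ?_
  split_ifs
  · exact FieldMeasurable.map (𝒜 := S.infoOn (θ.branch k j))
      (FieldMeasurable.comp (𝒜 := S.infoOn (θ.branch k j)) h2 hY) hf
  · exact FieldMeasurable.of_fst (𝒜 := S.infoOn (θ.branch k j)) measurable_const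

/-- The `n`-th approximation is measurable with respect to the indices that extend its index. -/
theorem IsMLP.measurable (hU : S.IsMLP f m U) (hf : Measurable f) (n : ℕ) :
    ∀ θ, FieldMeasurable (S.infoOn θ.desc) (U θ n) := by
  induction n using Nat.strong_induction_on with
  | _ n ih =>
  intro θ
  rcases Nat.eq_zero_or_pos n with rfl | hn
  · have : U θ 0 = fun _ _ => 0 := by ext q ω; exact hU.zero θ q ω
    rw [this]
    exact FieldMeasurable.of_fst (𝒜 := S.infoOn θ.desc) measurable_const
  · rw [show U θ n = _ from funext fun q => funext fun ω => hU.recursion n hn θ q ω]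
    refine FieldMeasurable.add (𝒜 := S.infoOn θ.desc)
      (FieldMeasurable.mul (𝒜 := S.infoOn θ.desc)
        (FieldMeasurable.of_fst (𝒜 := S.infoOn θ.desc) measurable_const)
        (FieldMeasurable.sum (𝒜 := S.infoOn θ.desc) _ fun i _ => ?_))
      (FieldMeasurable.sum (𝒜 := S.infoOn θ.desc) _ fun k hk =>
        FieldMeasurable.mul (𝒜 := S.infoOn θ.desc)
        (FieldMeasurable.of_fst (𝒜 := S.infoOn θ.desc) (S.h_measurable.div_const _))
        (FieldMeasurable.sum (𝒜 := S.infoOn θ.desc) _ fun i _ => ?_))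
    · exact (S.G_measurable _).mono
        (S.info_le_infoOn (θ.branch_subset_desc _ _ (θ.child_mem_branch _ _)))
    · exact (incr_measurable hf
        (fun l hl η => ih l (hl.trans_lt (Finset.mem_range.1 hk)) η) _).mono
          (S.infoOn_mono (θ.branch_subset_desc _ _))

/-- The independent summands of a multilevel Picard approximation. -/
def summand (S : Scheme P E) (f : ℝ → ℝ) (U : Index → ℕ → E → Ω → ℝ) (θ : Index) (q : E) :
    (ℕ ⊕ (_ : ℕ) × ℕ) → Ω → ℝ
  | Sum.inl i, ω => S.G (θ.child 0 (-((i : ℤ) + 1))) q ω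
  | Sum.inr x, ω => S.incr f U θ x.1 ((x.2 : ℤ) + 1) q ω

/-- The indices on which a summand depends. -/
def block (θ : Index) : (ℕ ⊕ (_ : ℕ) × ℕ) → Set Index
  | Sum.inl i => θ.branch 0 (-((i : ℤ) + 1))
  | Sum.inr x => θ.branch x.1 ((x.2 : ℤ) + 1)

/-- Terminal values and level-zero increments share the entry `0`, but the next entry is negative
for the former and positive for the latter. -/
theorem block_disjoint (θ : Index) (x y : ℕ ⊕ (_ : ℕ) × ℕ) (hxy : x ≠ y) :
    Disjoint (block θ x) (block θ y) := by
  rcases x with i | ⟨k, i⟩ <;> rcases y with i' | ⟨k', i'⟩ <;>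
    refine θ.branch_disjoint fun h => ?_
  · exact hxy (by congr 1; omega)
  · simp only at h; omega
  · simp only at h; omega
  · obtain ⟨h1, h2⟩ := h
    simp only at h1 h2
    subst h1
    have : i = i' := by omega
    exact hxy (by rw [this])

theorem IsMLP.summand_measurable (hU : S.IsMLP f m U) (hf : Measurable f) (θ : Index) (q : E)
    (x : ℕ ⊕ (_ : ℕ) × ℕ) : Measurable[S.infoOn (block θ x)] (S.summand f U θ q x) := by
  rcases x with i | x
  · have h : θ.child 0 (-((i : ℤ) + 1)) ∈ block θ (Sum.inl i) := θ.child_mem_branch 0 _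
    exact FieldMeasurable.section_measurable (𝒜 := S.infoOn (block θ (Sum.inl i)))
      ((S.G_measurable _).mono (S.info_le_infoOn h)) q
  · exact FieldMeasurable.section_measurable (𝒜 := S.infoOn (block θ (Sum.inr x)))
      (incr_measurable hf (fun l _ η => hU.measurable hf l η) _) q

theorem IsMLP.summand_measurable' (hU : S.IsMLP f m U) (hf : Measurable f) (θ : Index) (q : E)
    (x : ℕ ⊕ (_ : ℕ) × ℕ) : Measurable (S.summand f U θ q x) :=
  (hU.summand_measurable hf θ q x).mono (S.infoOn_le _) le_rfl

theorem IsMLP.iIndepFun_summand [IsProbabilityMeasure P] (hU : S.IsMLP f m U) (hf : Measurable f)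
    (θ : Index) (q : E) : iIndepFun (S.summand f U θ q) P :=
  iIndepFun_of_iIndep (iIndep_biSup_of_disjoint S.info_le S.info_indep (block_disjoint θ))
    (hU.summand_measurable hf θ q)

/-- The field `U η k` at an independent transition has a law that does not depend on the
indices. -/
theorem IsMLP.map_at_transition_eq [IsProbabilityMeasure P] (hU : S.IsMLP f m U)
    (hf : Measurable f) {k : ℕ} {η η' ζ ζ' : Index} (hη : ζ ∉ η.desc) (hη' : ζ' ∉ η'.desc)
    (hlaw : ∀ q, P.map (U η k q) = P.map (U η' k q)) (q : E) :
    P.map (fun ω => U η k (S.Y ζ q ω) ω) = P.map (fun ω => U η' k (S.Y ζ' q ω) ω) :=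
  map_freeze_eq (S.infoOn_le _) (S.info_le _) (S.indep_info_infoOn hη) (S.infoOn_le _)
    (S.info_le _) (S.indep_info_infoOn hη') (hU.measurable hf k η) (hU.measurable hf k η')
    (FieldMeasurable.section_measurable (𝒜 := S.info ζ) (S.Y_measurable ζ) q)
    (FieldMeasurable.section_measurable (𝒜 := S.info ζ') (S.Y_measurable ζ') q) hlaw
    (S.Y_law ζ ζ' q)

/-- At a fixed point the two approximations are independent, so their joint law is determined by the
marginal laws. The transition is independent of the pair, and freezing it carries the equality of
laws to the random point. -/
theorem IsMLP.map_incr_eq [IsProbabilityMeasure P] (hU : S.IsMLP f m U) (hf : Measurable f)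
    {k : ℕ} (hlaw : ∀ l ≤ k, ∀ η η' q, P.map (U η l q) = P.map (U η' l q)) (θ θ' : Index)
    (j : ℤ) (q : E) : P.map (S.incr f U θ k j q) = P.map (S.incr f U θ' k j q) := by
  let A : Index → Set Index := fun θ => (θ.child k j).desc ∪ (θ.child (-k) j).desc
  let F : Index → E → Ω → ℝ := fun θ y ω => f (U (θ.child k j) k y ω)
    - if 1 ≤ k then f (U (θ.child (-k) j) (k - 1) y ω) else 0
  have hA : ∀ θ : Index, θ.child k j ∉ A θ := by
    rintro θ (h | h) <;> exact θ.child_not_mem_desc_child _ _ _ _ h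
  have hm1 : ∀ θ, FieldMeasurable (S.infoOn (A θ)) (U (θ.child k j) k) := fun θ =>
    (hU.measurable hf k _).mono (S.infoOn_mono subset_union_left)
  have hm2 : ∀ θ, FieldMeasurable (S.infoOn (A θ)) (U (θ.child (-k) j) (k - 1)) := fun θ =>
    (hU.measurable hf (k - 1) _).mono (S.infoOn_mono subset_union_right)
  have hF : ∀ θ, FieldMeasurable (S.infoOn (A θ)) (F θ) := by
    intro θ
    refine FieldMeasurable.sub (𝒜 := S.infoOn (A θ))
      (FieldMeasurable.map (𝒜 := S.infoOn (A θ)) (hm1 θ) hf) ?_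
    split_ifs
    · exact FieldMeasurable.map (𝒜 := S.infoOn (A θ)) (hm2 θ) hf
    · exact FieldMeasurable.of_fst (𝒜 := S.infoOn (A θ)) measurable_const
  have hsec : ∀ (η : Index) (l : ℕ) (y : E), Measurable (U η l y) := fun η l y =>
    ((hU.measurable hf l η).mono (S.infoOn_le _)).section_measurable y
  refine map_freeze_eq (F := F θ) (F' := F θ') (S.infoOn_le _) (S.info_le _)
    (S.indep_info_infoOn (hA θ)) (S.infoOn_le _) (S.info_le _) (S.indep_info_infoOn (hA θ'))
    (hF θ) (hF θ')
    (FieldMeasurable.section_measurable (𝒜 := S.info _) (S.Y_measurable _) q)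
    (FieldMeasurable.section_measurable (𝒜 := S.info _) (S.Y_measurable _) q)
    (fun y => ?_) (S.Y_law _ _ q)
  have hid : ∀ (l : ℕ), l ≤ k → ∀ η η', IdentDistrib (U η l y) (U η' l y) P P := fun l hl η η' =>
    ⟨(hsec _ _ _).aemeasurable, (hsec _ _ _).aemeasurable, hlaw l hl η η' y⟩
  by_cases hk : 1 ≤ k
  · have hind : ∀ θ : Index,
        IndepFun (U (θ.child k j) k y) (U (θ.child (-k) j) (k - 1) y) P := by
      intro θ
      rw [IndepFun_iff_Indep]
      -- The indices with `k` and `-k` differ only for `k ≥ 1`; at level zero the second term is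
      -- absent.
      have hne : (k : ℤ) ≠ -k := by omega
      exact indep_of_indep_of_le_left (indep_of_indep_of_le_right
        (S.indep_infoOn (θ.desc_child_disjoint j hne))
        (FieldMeasurable.section_measurable (𝒜 := S.infoOn _)
          (hU.measurable hf (k - 1) _) y).comap_le)
        (FieldMeasurable.section_measurable (𝒜 := S.infoOn _)
          (hU.measurable hf k _) y).comap_le
    have h := IdentDistrib.prodMk (hid k le_rfl (θ.child k j) (θ'.child k j))
      (hid (k - 1) (Nat.sub_le k 1) (θ.child (-k) j) (θ'.child (-k) j)) (hind θ) (hind θ')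
    have h' := (h.comp (u := fun z : ℝ × ℝ => f z.1 - f z.2)
      ((hf.comp measurable_fst).sub (hf.comp measurable_snd))).map_eq
    simpa [F, hk, Function.comp_def] using h'
  · simpa [F, hk, Function.comp_def] using
      ((hid k le_rfl (θ.child k j) (θ'.child k j)).comp hf).map_eq

/-- The weight of a summand. -/
def weight (S : Scheme P E) (m n : ℕ) (q : E) : (ℕ ⊕ (_ : ℕ) × ℕ) → ℝ
  | Sum.inl _ => 1 / (m : ℝ) ^ n
  | Sum.inr x => S.h q / (m : ℝ) ^ (n - x.1)

/-- The summands that occur in the `n`-th approximation. -/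
def summands (m n : ℕ) : Finset (ℕ ⊕ (_ : ℕ) × ℕ) :=
  (Finset.range (m ^ n)).disjSum
    ((Finset.range n).sigma fun k => Finset.range (m ^ (n - k)))

theorem IsMLP.eq_sum_summand (hU : S.IsMLP f m U) {n : ℕ} (hn : 1 ≤ n) (θ : Index) (q : E)
    (ω : Ω) : U θ n q ω = ∑ x ∈ summands m n, S.weight m n q x * S.summand f U θ q x ω := by
  rw [hU.recursion n hn, summands, Finset.sum_disjSum, Finset.sum_sigma, Finset.mul_sum]
  simp only [Finset.mul_sum, weight, summand]

/-- The law of the approximations does not depend on the index. -/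
theorem IsMLP.map_eq [IsProbabilityMeasure P] (hU : S.IsMLP f m U) (hf : Measurable f) (n : ℕ) :
    ∀ θ θ' q, P.map (U θ n q) = P.map (U θ' n q) := by
  induction n using Nat.strong_induction_on with
  | _ n ih =>
  intro θ θ' q
  rcases Nat.eq_zero_or_pos n with rfl | hn
  · congr 1
    ext ω
    rw [hU.zero, hU.zero]
  · rw [show U θ n q = _ from funext fun ω => hU.eq_sum_summand hn θ q ω,
      show U θ' n q = _ from funext fun ω => hU.eq_sum_summand hn θ' q ω]
    refine map_sum_eq_of_iIndepFun
      (fun x => (hU.summand_measurable' hf θ q x).const_mul _)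
      (fun x => (hU.summand_measurable' hf θ' q x).const_mul _)
      ((hU.iIndepFun_summand hf θ q).comp _ fun x => measurable_const_mul (S.weight m n q x))
      ((hU.iIndepFun_summand hf θ' q).comp _ fun x => measurable_const_mul (S.weight m n q x))
      _ fun x hx => ?_
    have hlaw : P.map (S.summand f U θ q x) = P.map (S.summand f U θ' q x) := by
      rcases x with i | ⟨k, i⟩
      · exact S.G_law _ _ q
      · have hk : k < n := by
          simp only [summands, Finset.inr_mem_disjSum, Finset.mem_sigma, Finset.mem_range] at hx
          exact hx.1
        exact hU.map_incr_eq hf (fun l hl => ih l (hl.trans_lt hk)) θ θ' _ q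
    exact ((⟨(hU.summand_measurable' hf θ q x).aemeasurable,
      (hU.summand_measurable' hf θ' q x).aemeasurable, hlaw⟩ :
        IdentDistrib (S.summand f U θ q x) (S.summand f U θ' q x) P P).comp
          (measurable_const_mul (S.weight m n q x))).map_eq

end Scheme

/-! ### Error analysis of abstract schemes -/

namespace Scheme

variable {Ω E : Type*} [mΩ : MeasurableSpace Ω] {P : Measure Ω} [MeasurableSpace E]

/-- The assumptions of the error analysis: `u` is a fixed point, `W` is a weight function that
controls the terminal values, `u` and, up to the factor `κ`, the transitions. -/
structure Controlled (S : Scheme P E) (f : ℝ → ℝ) (c p K κ : ℝ) (u W : E → ℝ) : Prop where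
  f_measurable : Measurable f
  c_nonneg : 0 ≤ c
  lipschitz : ∀ a b, |f a - f b| ≤ c * |a - b|
  two_le : 2 ≤ p
  u_measurable : Measurable u
  W_measurable : Measurable W
  W_nonneg : ∀ q, 0 ≤ W q
  K_nonneg : 0 ≤ K
  u_le : ∀ q, |u q| ≤ K * W q
  fixed : ∀ q, u q = ∫ ω, S.G Index.root q ω ∂P + S.h q * ∫ ω, f (u (S.Y Index.root q ω)) ∂P
  terminal_le : ∀ q, eLpNorm (S.G Index.root q) (ENNReal.ofReal p) P ≤ ENNReal.ofReal (W q)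
  transition_memLp : ∀ q, MemLp (fun ω => W (S.Y Index.root q ω)) (ENNReal.ofReal p) P
  transition_le : ∀ q,
    S.h q * (eLpNorm (fun ω => W (S.Y Index.root q ω)) (ENNReal.ofReal p) P).toReal ≤ κ * W q

/-- The `L^p` norm of the weight after a transition. -/
def transitionNorm (S : Scheme P E) (p : ℝ) (W : E → ℝ) (q : E) : ℝ :=
  (eLpNorm (fun ω => W (S.Y Index.root q ω)) (ENNReal.ofReal p) P).toReal

theorem transitionNorm_nonneg (S : Scheme P E) (p : ℝ) (W : E → ℝ) (q : E) :
    0 ≤ S.transitionNorm p W q :=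
  ENNReal.toReal_nonneg

theorem Y_section_measurable (S : Scheme P E) (θ : Index) (q : E) : Measurable (S.Y θ q) :=
  ((S.Y_measurable θ).mono (S.info_le θ)).section_measurable q

theorem G_section_measurable (S : Scheme P E) (θ : Index) (q : E) : Measurable (S.G θ q) :=
  ((S.G_measurable θ).mono (S.info_le θ)).section_measurable q

theorem identDistrib_Y (S : Scheme P E) (θ θ' : Index) (q : E) :
    IdentDistrib (S.Y θ q) (S.Y θ' q) P P :=
  ⟨(S.Y_section_measurable θ q).aemeasurable, (S.Y_section_measurable θ' q).aemeasurable,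
    S.Y_law θ θ' q⟩

theorem identDistrib_G (S : Scheme P E) (θ θ' : Index) (q : E) :
    IdentDistrib (S.G θ q) (S.G θ' q) P P :=
  ⟨(S.G_section_measurable θ q).aemeasurable, (S.G_section_measurable θ' q).aemeasurable,
    S.G_law θ θ' q⟩

section Error

variable {S : Scheme P E} {f : ℝ → ℝ} {c p K κ : ℝ} {u W : E → ℝ}
  {m : ℕ} {U : Index → ℕ → E → Ω → ℝ}

theorem Controlled.one_le_ofReal (H : S.Controlled f c p K κ u W) : 1 ≤ ENNReal.ofReal p := by
  rw [← ENNReal.ofReal_one]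
  exact ENNReal.ofReal_le_ofReal (by linarith [H.two_le])

theorem Controlled.memLp_weight (H : S.Controlled f c p K κ u W) (ζ : Index) (q : E) :
    MemLp (fun ω => W (S.Y ζ q ω)) (ENNReal.ofReal p) P :=
  ((S.identDistrib_Y ζ Index.root q).comp H.W_measurable).memLp_iff.2 (H.transition_memLp q)

theorem Controlled.eLpNorm_weight (H : S.Controlled f c p K κ u W) (ζ : Index) (q : E) :
    eLpNorm (fun ω => W (S.Y ζ q ω)) (ENNReal.ofReal p) P
      = ENNReal.ofReal (S.transitionNorm p W q) := by
  rw [transitionNorm, ENNReal.ofReal_toReal (H.transition_memLp q).eLpNorm_ne_top]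
  exact ((S.identDistrib_Y ζ Index.root q).comp H.W_measurable).eLpNorm_eq _

theorem IsMLP.measurable_at (hU : S.IsMLP f m U) (hf : Measurable f) (k : ℕ) (η ζ : Index)
    (q : E) : Measurable fun ω => U η k (S.Y ζ q ω) ω :=
  ((hU.measurable hf k η).mono (S.infoOn_le _)).comp
    ((S.Y_measurable ζ).mono (S.info_le ζ)) |>.section_measurable q

theorem IsMLP.incr_zero (hU : S.IsMLP f m U) (θ : Index) (j : ℤ) (q : E) (ω : Ω) :
    S.incr f U θ 0 j q ω = f 0 := by
  simp [incr, hU.zero]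

variable [IsProbabilityMeasure P]

theorem Controlled.memLp_fixed (H : S.Controlled f c p K κ u W) (ζ : Index) (q : E) :
    MemLp (fun ω => f (u (S.Y ζ q ω))) (ENNReal.ofReal p) P := by
  have h : MemLp (fun ω => |f 0| + c * K * W (S.Y ζ q ω)) (ENNReal.ofReal p) P :=
    (memLp_const |f 0|).add ((H.memLp_weight ζ q).const_mul (c * K))
  refine h.of_le ((H.f_measurable.comp (H.u_measurable.comp
    (S.Y_section_measurable ζ q))).aestronglyMeasurable) (Filter.Eventually.of_forall fun ω => ?_)
  rw [Real.norm_eq_abs, Real.norm_eq_abs]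
  refine le_trans ?_ (le_abs_self _)
  have h1 := H.lipschitz (u (S.Y ζ q ω)) 0
  rw [sub_zero] at h1
  have h2 := mul_le_mul_of_nonneg_left (H.u_le (S.Y ζ q ω)) H.c_nonneg
  have h3 := abs_sub_abs_le_abs_sub (f (u (S.Y ζ q ω))) (f 0)
  linarith

/-- The transition is independent of the approximation, so the bound `b * W` at fixed points may be
integrated over the law of the transition. The Lipschitz property supplies the factor `c`. -/
theorem Controlled.eLpNorm_sub_at_le (H : S.Controlled f c p K κ u W) (hU : S.IsMLP f m U)
    {k : ℕ} {η ζ : Index} (hζ : ζ ∉ η.desc) {b : ℝ} (hb : 0 ≤ b)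
    (hbk : ∀ q, eLpNorm (fun ω => U η k q ω - u q) (ENNReal.ofReal p) P
      ≤ ENNReal.ofReal (b * W q)) (q : E) :
    eLpNorm (fun ω => f (U η k (S.Y ζ q ω) ω) - f (u (S.Y ζ q ω))) (ENNReal.ofReal p) P
      ≤ ENNReal.ofReal (c * (b * S.transitionNorm p W q)) := by
  have h1 : eLpNorm (fun ω => U η k (S.Y ζ q ω) ω - u (S.Y ζ q ω)) (ENNReal.ofReal p) P
      ≤ ENNReal.ofReal (b * S.transitionNorm p W q) := by
    refine (eLpNorm_freeze_le (F := fun y ω => U η k y ω - u y) (w := fun y => b * W y)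
      (S.infoOn_le _) (S.info_le _) (S.indep_info_infoOn hζ) ?_
      (FieldMeasurable.section_measurable (𝒜 := S.info ζ) (S.Y_measurable ζ) q)
      (by linarith [H.two_le]) (H.W_measurable.const_mul b) fun y => ?_).trans ?_
    · exact FieldMeasurable.sub (𝒜 := S.infoOn _) (hU.measurable H.f_measurable k η)
        (FieldMeasurable.of_fst (𝒜 := S.infoOn _) H.u_measurable)
    · rw [Real.enorm_of_nonneg (mul_nonneg hb (H.W_nonneg y))]
      exact hbk y
    · rw [ENNReal.ofReal_mul hb, ← H.eLpNorm_weight ζ q]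
      have := eLpNorm_const_smul (μ := P) b (fun ω => W (S.Y ζ q ω)) (ENNReal.ofReal p)
      rw [Real.enorm_of_nonneg hb] at this
      exact this.le
  have h2 : ∀ᵐ ω ∂P, ‖f (U η k (S.Y ζ q ω) ω) - f (u (S.Y ζ q ω))‖
      ≤ c * ‖U η k (S.Y ζ q ω) ω - u (S.Y ζ q ω)‖ :=
    Filter.Eventually.of_forall fun ω => H.lipschitz _ _
  refine (eLpNorm_le_mul_eLpNorm_of_ae_le_mul h2 _).trans ?_
  rw [ENNReal.ofReal_mul H.c_nonneg]
  gcongr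

/-- The error at level `k` is at most `b k` relative to the weight. -/
def LevelBound (P : Measure Ω) (p : ℝ) (u W : E → ℝ) (U : Index → ℕ → E → Ω → ℝ) (k : ℕ)
    (b : ℝ) : Prop :=
  0 ≤ b ∧ ∀ η q, eLpNorm (fun ω => U η k q ω - u q) (ENNReal.ofReal p) P
    ≤ ENNReal.ofReal (b * W q)

theorem Controlled.memLp_at (H : S.Controlled f c p K κ u W) (hU : S.IsMLP f m U)
    {k : ℕ} {η ζ : Index} (hζ : ζ ∉ η.desc) {b : ℝ} (hb : LevelBound P p u W U k b) (q : E) :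
    MemLp (fun ω => f (U η k (S.Y ζ q ω) ω)) (ENNReal.ofReal p) P := by
  have h : MemLp (fun ω => f (U η k (S.Y ζ q ω) ω) - f (u (S.Y ζ q ω))) (ENNReal.ofReal p) P :=
    ⟨((H.f_measurable.comp (hU.measurable_at H.f_measurable k η ζ q)).sub
      (H.f_measurable.comp (H.u_measurable.comp
        (S.Y_section_measurable ζ q)))).aestronglyMeasurable,
      (H.eLpNorm_sub_at_le hU hζ hb.1 (hb.2 η) q).trans_lt ENNReal.ofReal_lt_top⟩
  simpa [Pi.add_def] using h.add (H.memLp_fixed ζ q)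

/-- The mean of the nonlinearity at level `k` after a transition. -/
def levelMean (S : Scheme P E) (f : ℝ → ℝ) (U : Index → ℕ → E → Ω → ℝ) (k : ℕ) (q : E) : ℝ :=
  ∫ ω, f (U Index.root k (S.Y Index.root q ω) ω) ∂P

theorem root_not_mem_desc : Index.root ∉ Index.root.desc :=
  Index.not_mem_desc_of_length_le le_rfl

/-- Means taken at different indices coincide at equal level. This is what makes the levels
telescope. -/
theorem IsMLP.integral_at_eq (hU : S.IsMLP f m U) (hf : Measurable f) {k : ℕ} {η ζ : Index}
    (hζ : ζ ∉ η.desc) (q : E) :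
    ∫ ω, f (U η k (S.Y ζ q ω) ω) ∂P = S.levelMean f U k q := by
  have h : IdentDistrib (fun ω => U η k (S.Y ζ q ω) ω)
      (fun ω => U Index.root k (S.Y Index.root q ω) ω) P P :=
    ⟨(hU.measurable_at hf k η ζ q).aemeasurable, (hU.measurable_at hf k _ _ q).aemeasurable,
      hU.map_at_transition_eq hf hζ root_not_mem_desc (fun q => hU.map_eq hf k _ _ q) q⟩
  exact (h.comp hf).integral_eq

theorem Controlled.integral_incr (H : S.Controlled f c p K κ u W) (hU : S.IsMLP f m U)
    {k : ℕ} {b b' : ℝ} (hb : LevelBound P p u W U k b)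
    (hb' : LevelBound P p u W U (k - 1) b') (θ : Index) (j : ℤ) (q : E) :
    ∫ ω, S.incr f U θ k j q ω ∂P
      = S.levelMean f U k q - if 1 ≤ k then S.levelMean f U (k - 1) q else 0 := by
  have h1 := (H.memLp_at hU (θ.child_not_mem_desc_child k k j j) hb q).integrable H.one_le_ofReal
  have h2 := (H.memLp_at hU (θ.child_not_mem_desc_child k (-k) j j) hb' q).integrable
    H.one_le_ofReal
  unfold incr
  by_cases hk : 1 ≤ k
  · simp only [hk, if_true]
    rw [integral_sub h1 h2, hU.integral_at_eq H.f_measurable (θ.child_not_mem_desc_child _ _ _ _),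
      hU.integral_at_eq H.f_measurable (θ.child_not_mem_desc_child _ _ _ _)]
  · simp only [hk, if_false, sub_zero]
    rw [hU.integral_at_eq H.f_measurable (θ.child_not_mem_desc_child _ _ _ _)]

/-- Both approximations are evaluated at the same transition, so `f ∘ u` at that point can be
subtracted from each, leaving the errors of two consecutive levels. -/
theorem Controlled.eLpNorm_incr_le (H : S.Controlled f c p K κ u W) (hU : S.IsMLP f m U)
    {k : ℕ} (hk : 1 ≤ k) {b b' : ℝ} (hb : LevelBound P p u W U k b)
    (hb' : LevelBound P p u W U (k - 1) b') (θ : Index) (j : ℤ) (q : E) :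
    eLpNorm (S.incr f U θ k j q) (ENNReal.ofReal p) P
      ≤ ENNReal.ofReal (c * (b + b') * S.transitionNorm p W q) := by
  have hζ := θ.child_not_mem_desc_child k k j j
  have hζ' := θ.child_not_mem_desc_child k (-k) j j
  have h1 := H.eLpNorm_sub_at_le hU hζ hb.1 (hb.2 _) q
  have h2 := H.eLpNorm_sub_at_le hU hζ' hb'.1 (hb'.2 _) q
  have e : S.incr f U θ k j q
      = (fun ω => f (U (θ.child k j) k (S.Y (θ.child k j) q ω) ω) - f (u (S.Y (θ.child k j) q ω)))
        - fun ω => f (U (θ.child (-k) j) (k - 1) (S.Y (θ.child k j) q ω) ω)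
          - f (u (S.Y (θ.child k j) q ω)) := by
    ext ω
    simp [incr, hk]
  have hn := S.transitionNorm_nonneg p W q
  rw [e]
  refine (eLpNorm_sub_le
    ((H.memLp_at hU hζ hb q).sub (H.memLp_fixed _ q)).1
    ((H.memLp_at hU hζ' hb' q).sub (H.memLp_fixed _ q)).1 H.one_le_ofReal).trans ?_
  refine (add_le_add h1 h2).trans ?_
  rw [← ENNReal.ofReal_add
    (mul_nonneg H.c_nonneg (mul_nonneg hb.1 hn)) (mul_nonneg H.c_nonneg (mul_nonneg hb'.1 hn))]
  exact ENNReal.ofReal_le_ofReal (by linarith)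

theorem sqrt_pow_div {m : ℕ} (hm : 1 ≤ m) (k : ℕ) :
    1 / (m : ℝ) ^ k * √((m ^ k : ℕ) : ℝ) = (1 / √m) ^ k := by
  have hm' : (0 : ℝ) < m := by exact_mod_cast hm
  have h1 : √((m ^ k : ℕ) : ℝ) = √m ^ k := by
    push_cast
    rw [Real.sqrt_eq_iff_mul_self_eq (by positivity) (by positivity), ← mul_pow,
      Real.mul_self_sqrt hm'.le]
  have h2 : (m : ℝ) ^ k = √m ^ k * √m ^ k := by rw [← mul_pow, Real.mul_self_sqrt hm'.le]
  have h3 : 0 < √(m : ℝ) := Real.sqrt_pos.2 hm'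
  rw [h1, h2, div_pow, one_pow]
  field_simp

/-- The `L^p` error of an average of independent summands. -/
theorem eLpNorm_average_le {p B : ℝ} (hp : 2 ≤ p) (hB : 0 ≤ B) {Z : ℕ → Ω → ℝ}
    (hZm : ∀ i, Measurable (Z i)) (hZ : iIndepFun Z P)
    (hZp : ∀ i, eLpNorm (Z i) (ENNReal.ofReal p) P ≤ ENNReal.ofReal B) {m : ℕ} (hm : 1 ≤ m)
    (k : ℕ) {h : ℝ} (hh : 0 ≤ h) :
    eLpNorm (fun ω => h / (m : ℝ) ^ k * ∑ i ∈ Finset.range (m ^ k), (Z i ω - ∫ ω', Z i ω' ∂P))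
      (ENNReal.ofReal p) P ≤ ENNReal.ofReal (2 * √(p - 1) * (1 / √m) ^ k * (h * B)) := by
  have h1 := eLpNorm_sum_sub_integral_le hp hB hZm hZ (Finset.range (m ^ k)) fun i _ => hZp i
  have h2 := eLpNorm_const_smul (μ := P) (h / (m : ℝ) ^ k)
    (fun ω => ∑ i ∈ Finset.range (m ^ k), (Z i ω - ∫ ω', Z i ω' ∂P)) (ENNReal.ofReal p)
  have h0 : 0 ≤ h / (m : ℝ) ^ k := by positivity
  rw [Real.enorm_of_nonneg h0] at h2
  refine (h2.le.trans (mul_le_mul_right h1 _)).trans ?_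
  rw [← ENNReal.ofReal_mul h0, Finset.card_range]
  refine ENNReal.ofReal_le_ofReal (le_of_eq ?_)
  rw [← sqrt_pow_div hm k]
  ring

theorem sum_telescope (F : ℕ → ℝ) {n : ℕ} (hn : 1 ≤ n) :
    ∑ k ∈ Finset.range n, (F k - if 1 ≤ k then F (k - 1) else 0) = F (n - 1) := by
  induction n, hn using Nat.le_induction with
  | base => simp
  | succ n hn ih => rw [Finset.sum_range_succ, ih]; simp [hn]

/-- The decomposition of the error into statistical errors and a bias. -/
theorem Controlled.error_eq (H : S.Controlled f c p K κ u W) (hU : S.IsMLP f m U) (hm : 1 ≤ m)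
    {n : ℕ} (hn : 1 ≤ n) {b : ℕ → ℝ} (hb : ∀ k < n, LevelBound P p u W U k (b k))
    (θ : Index) (q : E) (ω : Ω) :
    U θ n q ω - u q =
      1 / (m : ℝ) ^ n * ∑ i ∈ Finset.range (m ^ n), (S.summand f U θ q (Sum.inl i) ω
        - ∫ ω', S.summand f U θ q (Sum.inl i) ω' ∂P)
      + ∑ k ∈ Finset.range n, S.h q / (m : ℝ) ^ (n - k) * ∑ i ∈ Finset.range (m ^ (n - k)),
        (S.summand f U θ q (Sum.inr ⟨k, i⟩) ω
          - ∫ ω', S.summand f U θ q (Sum.inr ⟨k, i⟩) ω' ∂P)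
      + S.h q * (S.levelMean f U (n - 1) q - ∫ ω', f (u (S.Y Index.root q ω')) ∂P) := by
  have hm' : (m : ℝ) ≠ 0 := by exact_mod_cast (by omega : m ≠ 0)
  have hG : ∀ i : ℕ, ∫ ω', S.summand f U θ q (Sum.inl i) ω' ∂P
      = ∫ ω', S.G Index.root q ω' ∂P := fun i => (S.identDistrib_G _ _ q).integral_eq
  have hI : ∀ k ∈ Finset.range n, ∀ i : ℕ, ∫ ω', S.summand f U θ q (Sum.inr ⟨k, i⟩) ω' ∂P
      = S.levelMean f U k q - if 1 ≤ k then S.levelMean f U (k - 1) q else 0 := fun k hk i =>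
    H.integral_incr hU (hb k (Finset.mem_range.1 hk))
      (hb (k - 1) ((Nat.sub_le k 1).trans_lt (Finset.mem_range.1 hk))) θ _ q
  have hlev : ∑ k ∈ Finset.range n, S.h q / (m : ℝ) ^ (n - k) *
      ∑ i ∈ Finset.range (m ^ (n - k)), (S.summand f U θ q (Sum.inr ⟨k, i⟩) ω
          - ∫ ω', S.summand f U θ q (Sum.inr ⟨k, i⟩) ω' ∂P)
      = ∑ k ∈ Finset.range n, S.h q / (m : ℝ) ^ (n - k) *
          ∑ i ∈ Finset.range (m ^ (n - k)), S.summand f U θ q (Sum.inr ⟨k, i⟩) ω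
        - S.h q * S.levelMean f U (n - 1) q := by
    -- The prefactor `1 / m ^ (n - k)` cancels the number of samples, so each level subtracts the
    -- mean of its increment once.
    rw [← sum_telescope (fun k => S.levelMean f U k q) hn, Finset.mul_sum,
      ← Finset.sum_sub_distrib]
    refine Finset.sum_congr rfl fun k hk => ?_
    simp_rw [hI k hk]
    rw [Finset.sum_sub_distrib, Finset.sum_const, Finset.card_range, nsmul_eq_mul]
    push_cast
    field_simp
  rw [hlev]
  simp_rw [hG]
  rw [Finset.sum_sub_distrib, Finset.sum_const, Finset.card_range, nsmul_eq_mul, hU.recursion n hn,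
    H.fixed q]
  simp only [summand]
  push_cast
  field_simp
  ring

/-- The statistical error at one level. -/
theorem Controlled.eLpNorm_level_le (H : S.Controlled f c p K κ u W) (hU : S.IsMLP f m U)
    (hm : 1 ≤ m) {n k : ℕ} {b b' : ℝ} (hb : LevelBound P p u W U k b)
    (hb' : LevelBound P p u W U (k - 1) b') (θ : Index) (q : E) :
    eLpNorm (fun ω => S.h q / (m : ℝ) ^ (n - k) * ∑ i ∈ Finset.range (m ^ (n - k)),
        (S.summand f U θ q (Sum.inr ⟨k, i⟩) ω
          - ∫ ω', S.summand f U θ q (Sum.inr ⟨k, i⟩) ω' ∂P)) (ENNReal.ofReal p) P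
      ≤ ENNReal.ofReal (if 1 ≤ k then
          2 * √(p - 1) * (1 / √m) ^ (n - k) * (c * (b + b') * (κ * W q)) else 0) := by
  have hnn := S.transitionNorm_nonneg p W q
  have hs : 0 ≤ c * (b + b') := mul_nonneg H.c_nonneg (add_nonneg hb.1 hb'.1)
  split_ifs with h1
  · refine (eLpNorm_average_le (Z := fun i => S.summand f U θ q (Sum.inr ⟨k, i⟩)) H.two_le
      (mul_nonneg hs hnn) (fun i => hU.summand_measurable' H.f_measurable θ q _)
      ((hU.iIndepFun_summand H.f_measurable θ q).precomp
        (g := fun i => Sum.inr (⟨k, i⟩ : (_ : ℕ) × ℕ)) fun i i' h => by simpa using h)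
      (fun i => H.eLpNorm_incr_le hU h1 hb hb' θ _ q) hm (n - k) (S.h_nonneg q)).trans ?_
    refine ENNReal.ofReal_le_ofReal (mul_le_mul_of_nonneg_left ?_ (by positivity))
    calc S.h q * (c * (b + b') * S.transitionNorm p W q)
        = c * (b + b') * (S.h q * S.transitionNorm p W q) := by ring
      _ ≤ _ := mul_le_mul_of_nonneg_left (H.transition_le q) hs
  -- At level zero every summand is the constant `f 0`, so there is no statistical error.
  · obtain rfl : k = 0 := by omega
    simp [summand, hU.incr_zero]

/-- The bias of the approximation. -/
theorem Controlled.enorm_bias_le (H : S.Controlled f c p K κ u W) (hU : S.IsMLP f m U)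
    {k : ℕ} {b : ℝ} (hb : LevelBound P p u W U k b) (q : E) :
    ‖S.h q * (S.levelMean f U k q - ∫ ω', f (u (S.Y Index.root q ω')) ∂P)‖ₑ
      ≤ ENNReal.ofReal (c * b * (κ * W q)) := by
  have hp1 := H.one_le_ofReal
  have hh := S.h_nonneg q
  have hbR := H.eLpNorm_sub_at_le hU root_not_mem_desc hb.1 (hb.2 _) q
  have hi1 := H.memLp_at hU root_not_mem_desc hb q
  have hi2 := H.memLp_fixed Index.root q
  have hint := enorm_integral_le_lintegral_enorm (μ := P) fun ω =>
    f (U Index.root k (S.Y Index.root q ω) ω) - f (u (S.Y Index.root q ω))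
  rw [← eLpNorm_one_eq_lintegral_enorm,
    integral_sub (hi1.integrable hp1) (hi2.integrable hp1)] at hint
  have h2 := hint.trans ((eLpNorm_le_eLpNorm_of_exponent_le hp1 (hi1.sub hi2).1).trans hbR)
  rw [enorm_mul, Real.enorm_of_nonneg hh]
  refine (mul_le_mul_right h2 _).trans ?_
  rw [← ENNReal.ofReal_mul hh]
  refine ENNReal.ofReal_le_ofReal ?_
  have := mul_le_mul_of_nonneg_left (H.transition_le q) (mul_nonneg H.c_nonneg hb.1)
  simp only [transitionNorm]
  linarith

theorem eLpNorm_add_sum_add_const_le {p : ℝ≥0∞} (hp : 1 ≤ p) {A : Ω → ℝ} {L : ℕ → Ω → ℝ} {R : ℝ}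
    (hAm : Measurable A) (hLm : ∀ k, Measurable (L k)) {s : Finset ℕ} {α ρ : ℝ} {l : ℕ → ℝ}
    (hα : 0 ≤ α) (hl : ∀ k ∈ s, 0 ≤ l k) (hρ : 0 ≤ ρ)
    (hA : eLpNorm A p P ≤ ENNReal.ofReal α)
    (hL : ∀ k ∈ s, eLpNorm (L k) p P ≤ ENNReal.ofReal (l k)) (hR : ‖R‖ₑ ≤ ENNReal.ofReal ρ) :
    eLpNorm (fun ω => A ω + ∑ k ∈ s, L k ω + R) p P
      ≤ ENNReal.ofReal (α + ∑ k ∈ s, l k + ρ) := by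
  have hSm : Measurable (∑ k ∈ s, L k) := by
    convert Finset.measurable_sum s (fun k _ => hLm k) using 1
    ext ω
    simp
  have e : (fun ω => A ω + ∑ k ∈ s, L k ω + R) = (A + ∑ k ∈ s, L k) + fun _ => R := by
    ext ω
    simp [Finset.sum_apply]
  have hR' : eLpNorm (fun _ : Ω => R) p P ≤ ENNReal.ofReal ρ := by
    rw [eLpNorm_const _ (by simpa using hp.trans_lt' one_pos |>.ne') (NeZero.ne P)]
    simpa using hR
  have hsum := Finset.sum_nonneg hl
  rw [e, ENNReal.ofReal_add (by positivity) hρ, ENNReal.ofReal_add hα hsum,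
    ENNReal.ofReal_sum_of_nonneg hl]
  refine (eLpNorm_add_le (hAm.add hSm).aestronglyMeasurable aestronglyMeasurable_const hp).trans ?_
  refine add_le_add ((eLpNorm_add_le hAm.aestronglyMeasurable hSm.aestronglyMeasurable hp).trans
    (add_le_add hA ?_)) hR'
  exact (eLpNorm_sum_le (fun k _ => (hLm k).aestronglyMeasurable) hp).trans (Finset.sum_le_sum hL)

/-- One step of the recursive error estimate. -/
theorem Controlled.step (H : S.Controlled f c p K κ u W) (hU : S.IsMLP f m U) (hm : 1 ≤ m)
    {n : ℕ} (hn : 1 ≤ n) {b : ℕ → ℝ} (hb : ∀ k < n, LevelBound P p u W U k (b k))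
    (θ : Index) (q : E) :
    eLpNorm (fun ω => U θ n q ω - u q) (ENNReal.ofReal p) P
      ≤ ENNReal.ofReal ((2 * √(p - 1) * (1 / √m) ^ n
        + ∑ k ∈ Finset.range n, (if 1 ≤ k then
            2 * √(p - 1) * (1 / √m) ^ (n - k) * (c * (b k + b (k - 1)) * κ) else 0)
        + c * b (n - 1) * κ) * W q) := by
  have hκW : 0 ≤ κ * W q :=
    (mul_nonneg (S.h_nonneg q) (S.transitionNorm_nonneg p W q)).trans (H.transition_le q)
  have hbn : ∀ k < n, 0 ≤ b k := fun k hk => (hb k hk).1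
  have hW := H.W_nonneg q
  have hc := H.c_nonneg
  have hsm := fun x => hU.summand_measurable' H.f_measurable θ q x
  have hA := eLpNorm_average_le (Z := fun i => S.summand f U θ q (Sum.inl i)) H.two_le hW
    (fun i => hsm (Sum.inl i))
    ((hU.iIndepFun_summand H.f_measurable θ q).precomp Sum.inl_injective)
    (fun i => ((S.identDistrib_G _ Index.root q).eLpNorm_eq _).le.trans (H.terminal_le q)) hm n
    zero_le_one
  rw [one_mul] at hA
  have hn1 := hbn (n - 1) (by omega)
  rw [funext fun ω => H.error_eq hU hm hn hb θ q ω]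
  refine (eLpNorm_add_sum_add_const_le H.one_le_ofReal
    ((Finset.measurable_fun_sum _ fun i _ => (hsm _).sub_const _).const_mul _)
    (fun k => (Finset.measurable_fun_sum _ fun i _ => (hsm _).sub_const _).const_mul _)
    (by positivity) (fun k hk => ?_) (mul_nonneg (mul_nonneg hc hn1) hκW) hA
    (fun k hk => H.eLpNorm_level_le hU hm (hb k (Finset.mem_range.1 hk))
      (hb (k - 1) ((Nat.sub_le k 1).trans_lt (Finset.mem_range.1 hk))) θ q)
    (H.enorm_bias_le hU (hb (n - 1) (by omega)) q)).trans
      (ENNReal.ofReal_le_ofReal (le_of_eq ?_))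
  · have hk' := Finset.mem_range.1 hk
    have := hbn k hk'
    have := hbn (k - 1) ((Nat.sub_le k 1).trans_lt hk')
    split_ifs <;> positivity
  · rw [add_mul, add_mul, Finset.sum_mul]
    congr 1
    · congr 1
      refine Finset.sum_congr rfl fun k _ => ?_
      split_ifs <;> ring
    · ring

/-- The constants in the error estimate. -/
def errorConst (a D K : ℝ) : ℕ → ℝ
  | 0 => K
  | n + 1 => (1 + D) ^ n * (2 * a + D * K)

theorem errorConst_nonneg {a D K : ℝ} (ha : 0 ≤ a) (hD : 0 ≤ D) (hK : 0 ≤ K) (n : ℕ) :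
    0 ≤ errorConst a D K n := by
  cases n <;> simp only [errorConst] <;> positivity

/-- Passing from `n` to `n + 1` turns half of `D * errorConst n` into a level term and adds the
other half as bias, while the old bias is absorbed by the new level term. The left side thus grows
by exactly `D * errorConst n`, which explains the ratio `1 + D`. The case `n = 1` has slack `D * K /
2`. -/
theorem errorConst_step {a D K : ℝ} (hD : 0 ≤ D) (hK : 0 ≤ K) {n : ℕ}
    (hn : 1 ≤ n) :
    2 * a + ∑ k ∈ Finset.range n, (if 1 ≤ k then
        D / 2 * (errorConst a D K k + errorConst a D K (k - 1)) else 0)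
      + D / 2 * errorConst a D K (n - 1) ≤ errorConst a D K n := by
  induction n, hn using Nat.le_induction with
  | base =>
    simp [errorConst]
    nlinarith [mul_nonneg hD hK]
  | succ n hn ih =>
    rw [Finset.sum_range_succ]
    obtain ⟨l, rfl⟩ : ∃ l, n = l + 1 := ⟨n - 1, by omega⟩
    have h : errorConst a D K (l + 1 + 1) = (1 + D) * errorConst a D K (l + 1) := by
      simp only [errorConst]; ring
    rw [h]
    simp only [Nat.le_add_left, if_true, Nat.add_sub_cancel] at ih ⊢
    linarith

/-- The error estimate for abstract multilevel Picard approximations. -/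
theorem Controlled.eLpNorm_error_le {T : ℝ} (hT : 0 ≤ T)
    (H : S.Controlled f c p K (T * (1 / √m)) u W) (hU : S.IsMLP f m U) (hm : 1 ≤ m) (n : ℕ) :
    LevelBound P p u W U n
      (errorConst (√(p - 1)) (4 * √(p - 1) * c * T) K n * (1 / √m) ^ n) := by
  have hc := H.c_nonneg
  have hK := H.K_nonneg
  have hcT : 0 ≤ c * T := mul_nonneg hc hT
  have ha : 1 ≤ √(p - 1) := Real.one_le_sqrt.2 (by linarith [H.two_le])
  set a := √(p - 1)
  have hr0 : 0 ≤ 1 / √(m : ℝ) := by positivity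
  have hr1 : 1 / √(m : ℝ) ≤ 1 := by
    have : 1 ≤ √(m : ℝ) := Real.one_le_sqrt.2 (by exact_mod_cast hm)
    exact (div_le_one (by linarith)).2 this
  set r := 1 / √(m : ℝ)
  have hD : 0 ≤ 4 * a * c * T := by positivity
  have hC := errorConst_nonneg (by linarith : 0 ≤ a) hD hK
  set D := 4 * a * c * T with hDdef
  induction n using Nat.strong_induction_on with
  | _ n ih =>
  refine ⟨mul_nonneg (hC n) (pow_nonneg hr0 n), fun θ q => ?_⟩
  rcases Nat.eq_zero_or_pos n with rfl | hn
  -- The zeroth approximation vanishes, so its error is `u` itself, which `K` controls.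
  · simp only [hU.zero, zero_sub, errorConst, pow_zero, mul_one]
    rw [eLpNorm_const _ (by simpa using H.one_le_ofReal.trans_lt' one_pos |>.ne') (NeZero.ne P)]
    simp only [measure_univ, ENNReal.one_rpow, mul_one, enorm_neg, Real.enorm_eq_ofReal_abs]
    exact ENNReal.ofReal_le_ofReal (H.u_le q)
  · refine (H.step hU hm hn ih θ q).trans (ENNReal.ofReal_le_ofReal ?_)
    refine mul_le_mul_of_nonneg_right ?_ (H.W_nonneg q)
    refine le_trans ?_ (mul_le_mul_of_nonneg_right
      (errorConst_step (a := a) hD hK hn) (pow_nonneg hr0 n))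
    rw [add_mul, add_mul, Finset.sum_mul]
    refine add_le_add (add_le_add le_rfl (Finset.sum_le_sum fun k hk => ?_)) ?_
    · have hk' := Finset.mem_range.1 hk
      split_ifs with h1
      · obtain ⟨l, rfl⟩ : ∃ l, k = l + 1 := ⟨k - 1, by omega⟩
        rw [Nat.add_sub_cancel]
        -- Averaging contributes `r ^ (n - k)`, the induction hypothesis `r ^ k` or `r ^ (k - 1)`,
        -- and the transition one more `r`. That last factor completes the term of level `k - 1` to
        -- `r ^ n`; for level `k` it is superfluous and is dropped.
        have e1 : r ^ (n - (l + 1)) * r ^ (l + 1) = r ^ n := by rw [← pow_add]; congr 1; omega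
        have e2 : r ^ (n - (l + 1)) * r ^ l * r = r ^ n := by
          rw [mul_assoc, ← pow_succ, e1]
        have hCl := hC (l + 1)
        have : r ^ n * r ≤ r ^ n := mul_le_of_le_one_right (pow_nonneg hr0 n) hr1
        calc _ = 2 * a * c * T * (errorConst a D K (l + 1) * ((r ^ (n - (l + 1)) * r ^ (l + 1)) * r)
              + errorConst a D K l * (r ^ (n - (l + 1)) * r ^ l * r)) := by ring
          _ = 2 * a * c * T * (errorConst a D K (l + 1) * (r ^ n * r)
              + errorConst a D K l * r ^ n) := by rw [e1, e2]
          _ ≤ 2 * a * c * T * (errorConst a D K (l + 1) * r ^ n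
              + errorConst a D K l * r ^ n) := by gcongr
          _ = _ := by rw [hDdef]; ring
      · simp
    · obtain ⟨l, rfl⟩ : ∃ l, n = l + 1 := ⟨n - 1, by omega⟩
      rw [Nat.add_sub_cancel]
      calc _ = c * T * (errorConst a D K l * r ^ (l + 1)) := by ring
        _ ≤ (2 * a * (c * T)) * (errorConst a D K l * r ^ (l + 1)) := by
          refine mul_le_mul_of_nonneg_right ?_ (mul_nonneg (hC l) (pow_nonneg hr0 _))
          nlinarith
        _ = _ := by rw [hDdef]; ring

end Error

end Scheme

namespace Scheme

/-! ### The fixed-point equation -/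

variable {Ω E : Type*} [mΩ : MeasurableSpace Ω] {P : Measure Ω} [MeasurableSpace E]

/-- The right-hand side of the fixed-point equation. -/
def picard (S : Scheme P E) (f : ℝ → ℝ) (u : E → ℝ) (q : E) : ℝ :=
  ∫ ω, S.G Index.root q ω ∂P + S.h q * ∫ ω, f (u (S.Y Index.root q ω)) ∂P

/-- The weight `W` halves under a transition. -/
structure Contractive (S : Scheme P E) (c : ℝ) (W : E → ℝ) : Prop where
  W_measurable : Measurable W
  W_nonneg : ∀ q, 0 ≤ W q
  integrable : ∀ q, Integrable (fun ω => W (S.Y Index.root q ω)) P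
  transition_le : ∀ q, c * (S.h q * ∫ ω, W (S.Y Index.root q ω) ∂P) ≤ W q / 2

variable [IsProbabilityMeasure P] {S : Scheme P E} {f : ℝ → ℝ} {c : ℝ} {W : E → ℝ}

theorem picard_measurable (hf : Measurable f) {u : E → ℝ} (hu : Measurable u) :
    Measurable (S.picard f u) := by
  have hG : Measurable fun q : E × Ω => S.G Index.root q.1 q.2 :=
    (S.G_measurable _).mono (S.info_le _)
  have hY : Measurable fun q : E × Ω => f (u (S.Y Index.root q.1 q.2)) :=
    hf.comp (hu.comp ((S.Y_measurable _).mono (S.info_le _)))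
  exact (hG.stronglyMeasurable.integral_prod_right' (ν := P)).measurable.add
    (S.h_measurable.mul (hY.stronglyMeasurable.integral_prod_right' (ν := P)).measurable)

theorem integrable_nonlinearity (hf : Measurable f) (hlip : ∀ a b, |f a - f b| ≤ c * |a - b|)
    (hc : 0 ≤ c) {u : E → ℝ} (hu : Measurable u) {K : ℝ} (huW : ∀ q, |u q| ≤ K * W q) {q : E}
    (hW : Integrable (fun ω => W (S.Y Index.root q ω)) P) :
    Integrable (fun ω => f (u (S.Y Index.root q ω))) P := by
  have h : Integrable (fun ω => |f 0| + c * K * W (S.Y Index.root q ω)) P :=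
    (integrable_const |f 0|).add (hW.const_mul (c * K))
  refine h.mono' ((hf.comp (hu.comp
    (S.Y_section_measurable _ q))).aestronglyMeasurable) (Filter.Eventually.of_forall fun ω => ?_)
  have h1 := hlip (u (S.Y Index.root q ω)) 0
  rw [sub_zero] at h1
  have h2 := mul_le_mul_of_nonneg_left (huW (S.Y Index.root q ω)) hc
  have h3 := abs_sub_abs_le_abs_sub (f (u (S.Y Index.root q ω))) (f 0)
  rw [Real.norm_eq_abs]
  linarith

/-- The terminal values cancel, and the Lipschitz bound leaves the weight after a transition, which
is at most half the old weight by assumption. -/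
theorem Contractive.picard_sub_le (H : S.Contractive c W) (hf : Measurable f)
    (hlip : ∀ a b, |f a - f b| ≤ c * |a - b|) (hc : 0 ≤ c) {u v : E → ℝ} (hu : Measurable u)
    (hv : Measurable v) {K K' ε : ℝ} (huW : ∀ q, |u q| ≤ K * W q) (hvW : ∀ q, |v q| ≤ K' * W q)
    (hε : 0 ≤ ε) (huv : ∀ q, |u q - v q| ≤ ε * W q) (q : E) :
    |S.picard f u q - S.picard f v q| ≤ ε / 2 * W q := by
  have hiu := integrable_nonlinearity hf hlip hc hu huW (H.integrable q)
  have hiv := integrable_nonlinearity hf hlip hc hv hvW (H.integrable q)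
  have hh := S.h_nonneg q
  have e : S.picard f u q - S.picard f v q = S.h q *
      ∫ ω, (f (u (S.Y Index.root q ω)) - f (v (S.Y Index.root q ω))) ∂P := by
    rw [integral_sub hiu hiv, picard, picard]
    ring
  have hb : |∫ ω, (f (u (S.Y Index.root q ω)) - f (v (S.Y Index.root q ω))) ∂P|
      ≤ ∫ ω, c * ε * W (S.Y Index.root q ω) ∂P := by
    refine (abs_integral_le_integral_abs).trans
      (integral_mono (hiu.sub hiv).abs ((H.integrable q).const_mul (c * ε)) fun ω => ?_)
    refine (hlip _ _).trans ?_
    have := mul_le_mul_of_nonneg_left (huv (S.Y Index.root q ω)) hc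
    linarith
  rw [integral_const_mul] at hb
  rw [e, abs_mul, abs_of_nonneg hh]
  calc S.h q * _ ≤ S.h q * (c * ε * ∫ ω, W (S.Y Index.root q ω) ∂P) :=
        mul_le_mul_of_nonneg_left hb hh
    _ = ε * (c * (S.h q * ∫ ω, W (S.Y Index.root q ω) ∂P)) := by ring
    _ ≤ ε * (W q / 2) := mul_le_mul_of_nonneg_left (H.transition_le q) hε
    _ = _ := by ring

theorem eq_zero_of_forall_le_geometric {x C : ℝ} (h : ∀ n : ℕ, |x| ≤ C * (1 / 2) ^ n) :
    x = 0 := by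
  have hlim : Filter.Tendsto (fun n : ℕ => C * (1 / 2 : ℝ) ^ n) Filter.atTop (nhds (C * 0)) :=
    (tendsto_pow_atTop_nhds_zero_of_lt_one (by norm_num) (by norm_num)).const_mul C
  rw [mul_zero] at hlim
  exact abs_nonpos_iff.1 (ge_of_tendsto' hlim h)

theorem Contractive.unique (H : S.Contractive c W) (hf : Measurable f)
    (hlip : ∀ a b, |f a - f b| ≤ c * |a - b|) (hc : 0 ≤ c) {u v : E → ℝ} (hu : Measurable u)
    (hv : Measurable v) {K K' : ℝ} (hK : 0 ≤ K) (hK' : 0 ≤ K') (huW : ∀ q, |u q| ≤ K * W q)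
    (hvW : ∀ q, |v q| ≤ K' * W q) (hfu : ∀ q, u q = S.picard f u q)
    (hfv : ∀ q, v q = S.picard f v q) (q : E) : u q = v q := by
  have key : ∀ n : ℕ, ∀ q, |u q - v q| ≤ (K + K') * (1 / 2) ^ n * W q := by
    intro n
    induction n with
    | zero =>
      intro q
      have := abs_sub (u q) (v q)
      have := huW q
      have := hvW q
      rw [pow_zero]
      linarith
    | succ n ih =>
      intro q
      rw [hfu q, hfv q]
      refine (H.picard_sub_le hf hlip hc hu hv huW hvW (by positivity) ih q).trans (le_of_eq ?_)
      ring
  refine sub_eq_zero.1 (eq_zero_of_forall_le_geometric (C := (K + K') * W q) fun n => ?_)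
  refine (key n q).trans (le_of_eq ?_)
  ring

/-- Picard iteration from zero converges geometrically at every point; measurability passes to the
pointwise limit. -/
theorem Contractive.exists_fixed (H : S.Contractive c W) (hf : Measurable f)
    (hlip : ∀ a b, |f a - f b| ≤ c * |a - b|) (hc : 0 ≤ c) {K : ℝ} (hK : 0 ≤ K)
    (h0 : ∀ q, |S.picard f (fun _ => 0) q| ≤ K * W q) :
    ∃ u : E → ℝ, Measurable u ∧ (∀ q, |u q| ≤ 2 * K * W q) ∧ ∀ q, u q = S.picard f u q := by
  let v : ℕ → E → ℝ := fun n => (S.picard f)^[n] fun _ => 0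
  have hvs : ∀ n, v (n + 1) = S.picard f (v n) := fun n => Function.iterate_succ_apply' _ _ _
  have hvm : ∀ n, Measurable (v n) := by
    intro n
    induction n with
    | zero => exact measurable_const
    | succ n ih => rw [hvs]; exact picard_measurable hf ih
  -- The factor `2 * (1 - (1 / 2) ^ n)` is the partial sum of the geometric series of increments.
  -- The size bound is carried along because the contraction estimate requires its arguments to be
  -- bounded relative to `W`.
  have hstep : ∀ n, (∀ q, |v n q| ≤ 2 * K * (1 - (1 / 2) ^ n) * W q) ∧
      ∀ q, |v (n + 1) q - v n q| ≤ K * (1 / 2) ^ n * W q := by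
    intro n
    induction n with
    | zero =>
      refine ⟨fun q => by simp [v], fun q => ?_⟩
      simpa [v] using h0 q
    | succ n ih =>
      have hb : ∀ q, |v (n + 1) q| ≤ 2 * K * (1 - (1 / 2) ^ (n + 1)) * W q := by
        intro q
        have h1 := ih.1 q
        have h2 := ih.2 q
        have h3 := abs_sub_abs_le_abs_sub (v (n + 1) q) (v n q)
        rw [pow_succ]
        linarith
      refine ⟨hb, fun q => ?_⟩
      rw [hvs (n + 1)]
      nth_rewrite 2 [hvs n]
      refine (H.picard_sub_le hf hlip hc (hvm _) (hvm _) hb ih.1 (by positivity) ih.2 q).trans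
        (le_of_eq ?_)
      ring
  have hdist : ∀ q n, dist (v n q) (v (n + 1) q) ≤ K * W q * (1 / 2) ^ n := by
    intro q n
    rw [dist_comm, Real.dist_eq]
    refine ((hstep n).2 q).trans (le_of_eq ?_)
    ring
  have hlim : ∀ q, ∃ l, Filter.Tendsto (fun n => v n q) Filter.atTop (nhds l) := fun q =>
    cauchySeq_tendsto_of_complete (cauchySeq_of_le_geometric _ _ (by norm_num) (hdist q))
  choose u hu using hlim
  have hum : Measurable u := measurable_of_tendsto_metrizable hvm (tendsto_pi_nhds.2 hu)
  have hrate : ∀ n q, |u q - v n q| ≤ 2 * K * (1 / 2) ^ n * W q := by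
    intro n q
    have h := dist_le_of_le_geometric_of_tendsto _ _ (by norm_num) (hdist q) (hu q) n
    rw [dist_comm, Real.dist_eq] at h
    refine h.trans (le_of_eq ?_)
    ring
  have hub : ∀ q, |u q| ≤ 2 * K * W q := by
    intro q
    have h := hrate 0 q
    simpa [v] using h
  refine ⟨u, hum, hub, fun q => ?_⟩
  have hvb : ∀ n q, |v n q| ≤ 2 * K * W q := by
    intro n q
    refine ((hstep n).1 q).trans (mul_le_mul_of_nonneg_right ?_ (H.W_nonneg q))
    have : (0 : ℝ) ≤ (1 / 2) ^ n := by positivity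
    nlinarith
  -- Both `u` and its Picard image are within `K * (1 / 2) ^ n * W q` of the iterate `v (n + 1)`.
  refine sub_eq_zero.1 (eq_zero_of_forall_le_geometric (C := 2 * K * W q) fun n => ?_)
  have h1 := H.picard_sub_le hf hlip hc hum (hvm n) hub (hvb n) (by positivity) (hrate n) q
  have h2 := hrate (n + 1) q
  rw [hvs] at h2
  have h3 := abs_sub_le (u q) (S.picard f (v n) q) (S.picard f u q)
  rw [abs_sub_comm (S.picard f (v n) q)] at h3
  rw [pow_succ] at h2
  linarith

/-- A Gronwall-type bound for fixed points. -/
theorem Contractive.fixed_le (H : S.Contractive c W) (hf : Measurable f)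
    (hlip : ∀ a b, |f a - f b| ≤ c * |a - b|) (hc : 0 ≤ c) {u : E → ℝ} (hu : Measurable u)
    {K : ℝ} (hK : 0 ≤ K) (huW : ∀ q, |u q| ≤ K * W q) (hfix : ∀ q, u q = S.picard f u q)
    {B : E → ℝ} (hB : ∀ q, 0 ≤ B q) (hBi : ∀ q, Integrable (fun ω => B (S.Y Index.root q ω)) P)
    (hstep : ∀ q, |∫ ω, S.G Index.root q ω ∂P| + S.h q * |f 0|
      + c * (S.h q * ∫ ω, B (S.Y Index.root q ω) ∂P) ≤ B q) (q : E) : |u q| ≤ B q := by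
  -- The function `B` is a supersolution, so each Picard step preserves it and halves the excess
  -- measured in `W`.
  have key : ∀ n : ℕ, ∀ q, |u q| ≤ B q + K * (1 / 2) ^ n * W q := by
    intro n
    induction n with
    | zero =>
      intro q
      rw [pow_zero, mul_one]
      linarith [huW q, hB q]
    | succ n ih =>
      intro q
      have hh := S.h_nonneg q
      have hi := integrable_nonlinearity hf hlip hc hu huW (H.integrable q)
      have hi1 : Integrable (fun ω => c * B (S.Y Index.root q ω)) P := (hBi q).const_mul c
      have hi2 : Integrable (fun ω => c * (K * (1 / 2) ^ n) * W (S.Y Index.root q ω)) P :=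
        (H.integrable q).const_mul _
      have hi3 : Integrable (fun ω => c * B (S.Y Index.root q ω)
          + c * (K * (1 / 2) ^ n) * W (S.Y Index.root q ω)) P := hi1.add hi2
      have hb : |∫ ω, f (u (S.Y Index.root q ω)) ∂P| ≤ ∫ ω, (|f 0| + (c * B (S.Y Index.root q ω)
          + c * (K * (1 / 2) ^ n) * W (S.Y Index.root q ω))) ∂P := by
        refine abs_integral_le_integral_abs.trans (integral_mono hi.abs
          ((integrable_const _).add hi3) fun ω => ?_)
        have h1 := hlip (u (S.Y Index.root q ω)) 0
        rw [sub_zero] at h1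
        have h2 := mul_le_mul_of_nonneg_left (ih (S.Y Index.root q ω)) hc
        have h3 := abs_sub_abs_le_abs_sub (f (u (S.Y Index.root q ω))) (f 0)
        simp only
        linarith
      rw [integral_add (integrable_const _) hi3, integral_add hi1 hi2,
        integral_const_mul, integral_const_mul] at hb
      simp only [integral_const, probReal_univ, smul_eq_mul, one_mul] at hb
      rw [hfix q, picard]
      refine (abs_add_le _ _).trans ?_
      rw [abs_mul, abs_of_nonneg hh]
      have h4 := mul_le_mul_of_nonneg_left hb hh
      have h5 := mul_le_mul_of_nonneg_left (H.transition_le q)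
        (show 0 ≤ K * (1 / 2) ^ n by positivity)
      have h6 := hstep q
      rw [pow_succ]
      linarith
  have hlim : Filter.Tendsto (fun n : ℕ => B q + K * (1 / 2 : ℝ) ^ n * W q) Filter.atTop
      (nhds (B q + K * 0 * W q)) :=
    ((((tendsto_pow_atTop_nhds_zero_of_lt_one (by norm_num) (by norm_num)).const_mul
      K).mul_const _).const_add _)
  rw [mul_zero, zero_mul, add_zero] at hlim
  exact ge_of_tendsto' hlim fun n => key n q

end Scheme

/-! ### Random transitions -/

/-- The time that divides `[t, T]` in the ratio `r`. -/
def moveTime {T : ℝ} (t : Icc (0 : ℝ) T) (r : I) : Icc (0 : ℝ) T :=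
  ⟨t + (T - t) * r, by
    have h1 := t.2.1; have h2 := t.2.2; have h3 := r.2.1; have h4 := r.2.2
    constructor
    · have := mul_nonneg (sub_nonneg.2 h2) h3
      linarith
    · have := mul_le_of_le_one_right (sub_nonneg.2 h2) h4
      linarith⟩

theorem le_moveTime {T : ℝ} (t : Icc (0 : ℝ) T) (r : I) : (t : ℝ) ≤ moveTime t r := by
  have := mul_nonneg (sub_nonneg.2 t.2.2) r.2.1
  simp only [moveTime]
  linarith

/-- A transition from time `t` to the time that divides `[t, T]` in the ratio `r`. -/
def timePair {T : ℝ} (t : Icc (0 : ℝ) T) (r : I) : TimePairs T :=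
  ⟨(t, moveTime t r), t.2.1, le_moveTime t r, (moveTime t r).2.2⟩

/-- A transition from time `t` to time `T`. -/
def endPair {T : ℝ} (t : Icc (0 : ℝ) T) : TimePairs T := ⟨(t, T), t.2.1, t.2.2, le_rfl⟩

theorem continuous_moveTime {T : ℝ} :
    Continuous fun z : Icc (0 : ℝ) T × I => moveTime z.1 z.2 := by
  unfold moveTime
  fun_prop

theorem continuous_timePair {T : ℝ} :
    Continuous fun z : Icc (0 : ℝ) T × I => timePair z.1 z.2 := by
  have := continuous_moveTime (T := T)
  unfold timePair
  fun_prop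

theorem continuous_endPair {T : ℝ} : Continuous (endPair (T := T)) := by
  unfold endPair
  fun_prop

theorem transition_measurable {d : ℕ} {Ω : Type*} {T : ℝ} {𝒜 : MeasurableSpace Ω}
    {X : ℝ → ℝ → State d → Ω → State d} (hX : JointlyMeasurable T 𝒜 X) {τ : Ω → I}
    (hτ : Measurable τ) : FieldMeasurable (E := Icc (0 : ℝ) T × State d) 𝒜
      fun q ω => (moveTime q.1 (τ ω), X q.1 (moveTime q.1 (τ ω)) q.2 ω) := by
  have h1 : Measurable fun z : (Icc (0 : ℝ) T × State d) × Ω => (z.1.1, τ z.2) := by fun_prop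
  have h2 : Measurable fun z : (Icc (0 : ℝ) T × State d) × Ω =>
      ((timePair z.1.1 (τ z.2), z.1.2), z.2) :=
    ((continuous_timePair.measurable.comp h1).prodMk (by fun_prop)).prodMk measurable_snd
  exact (continuous_moveTime.measurable.comp h1).prodMk (Measurable.comp hX h2)

/-- A transition is measurable in the ratio and in `ω`. -/
theorem ratio_measurable {d : ℕ} {Ω : Type*} {T : ℝ} {𝒜 : MeasurableSpace Ω}
    {X : ℝ → ℝ → State d → Ω → State d} (hX : JointlyMeasurable T 𝒜 X)
    (q : Icc (0 : ℝ) T × State d) : FieldMeasurable (E := I) 𝒜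
      fun r ω => (moveTime q.1 r, X q.1 (moveTime q.1 r) q.2 ω) := by
  have h1 : Measurable fun z : I × Ω => (q.1, z.1) := by fun_prop
  have h2 : Measurable fun z : I × Ω => ((timePair q.1 z.1, q.2), z.2) :=
    ((continuous_timePair.measurable.comp h1).prodMk measurable_const).prodMk measurable_snd
  exact (continuous_moveTime.measurable.comp h1).prodMk (Measurable.comp hX h2)

theorem terminal_measurable {d : ℕ} {Ω : Type*} {T : ℝ} {𝒜 : MeasurableSpace Ω}
    {X : ℝ → ℝ → State d → Ω → State d} (hX : JointlyMeasurable T 𝒜 X) {g : State d → ℝ}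
    (hg : Measurable g) : FieldMeasurable (E := Icc (0 : ℝ) T × State d) 𝒜
      fun q ω => g (X q.1 T q.2 ω) := by
  have h2 : Measurable fun z : (Icc (0 : ℝ) T × State d) × Ω =>
      ((endPair z.1.1, z.1.2), z.2) :=
    ((continuous_endPair.measurable.comp (by fun_prop)).prodMk (by fun_prop)).prodMk measurable_snd
  exact hg.comp (Measurable.comp hX h2)

/-! ### The concrete setting as an abstract scheme -/

/-- The standing assumptions, with the sigma-algebras `𝒢` of the random fields. -/
structure Setting {d : ℕ} {Ω : Type*} [mΩ : MeasurableSpace Ω] (P : Measure Ω) (p_v c T : ℝ)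
    (f : ℝ → ℝ) (g : State d → ℝ) (V : ℝ → State d → ℝ) (τ : Index → Ω → I)
    (X : Index → ℝ → ℝ → State d → Ω → State d) (𝒢 : Index → MeasurableSpace Ω) : Prop where
  c_pos : 0 < c
  T_pos : 0 < T
  f_continuous : Continuous f
  g_continuous : Continuous g
  V_continuousOn : ContinuousOn (fun q : ℝ × State d => V q.1 q.2) (Icc 0 T ×ˢ univ)
  one_le_V : ∀ t ∈ Icc 0 T, ∀ x, 1 ≤ V t x
  τ_measurable : ∀ θ, Measurable (τ θ)
  τ_indep : iIndepFun τ P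
  τ_ident : ∀ θ, IdentDistrib (τ θ) (τ Index.root) P P
  τ_unif : ∀ t ∈ Icc (0 : ℝ) 1, P {ω | (τ Index.root ω : ℝ) ≤ t} = ENNReal.ofReal t
  𝒢_le : ∀ θ, 𝒢 θ ≤ mΩ
  X_measurable : ∀ θ, JointlyMeasurable T (𝒢 θ) (X θ)
  𝒢_indep : iIndep 𝒢 P
  𝒢_indep_τ : Indep (⨆ θ, 𝒢 θ) (⨆ θ, MeasurableSpace.comap (τ θ) inferInstance) P
  X_ident : ∀ θ, IdentDistrib (fieldMap T (X θ)) (fieldMap T (X Index.root)) P P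
  g_le : ∀ x, |g x| ≤ V T x
  f_zero_le : ∀ s ∈ Icc 0 T, ∀ x, |T * f 0| ≤ V s x
  lipschitz : ∀ w₁ w₂ : ℝ, |f w₁ - f w₂| ≤ c * |w₁ - w₂|
  lyapunov : ∀ s ∈ Icc 0 T, ∀ t ∈ Icc s T, ∀ x,
    eLpNorm (fun ω => V t (X Index.root s t x ω)) (ENNReal.ofReal p_v) P ≤ ENNReal.ofReal (V s x)

namespace Setting

variable {d : ℕ} {Ω : Type*} [mΩ : MeasurableSpace Ω] {P : Measure Ω}
  {p_v c T : ℝ} {f : ℝ → ℝ} {g : State d → ℝ} {V : ℝ → State d → ℝ} {τ : Index → Ω → I}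
  {X : Index → ℝ → ℝ → State d → Ω → State d} {𝒢 : Index → MeasurableSpace Ω}

theorem indep_τ (H : Setting P p_v c T f g V τ X 𝒢) (θ : Index) :
    Indep (MeasurableSpace.comap (τ θ) inferInstance) (𝒢 θ) P :=
  (indep_of_indep_of_le_left (indep_of_indep_of_le_right H.𝒢_indep_τ
    (le_iSup (fun θ => MeasurableSpace.comap (τ θ) inferInstance) θ)) (le_iSup 𝒢 θ)).symm

theorem map_field_eq (H : Setting P p_v c T f g V τ X 𝒢) {β : Type*} [MeasurableSpace β]
    (z : TimePairs T × State d) {φ : State d → β} (hφ : Measurable φ) (θ θ' : Index) :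
    P.map (fun ω => φ (fieldMap T (X θ) ω z)) = P.map (fun ω => φ (fieldMap T (X θ') ω z)) :=
  (((H.X_ident θ).trans (H.X_ident θ').symm).comp
    (u := fun w : TimePairs T × State d → State d => φ (w z))
      (hφ.comp (measurable_pi_apply z))).map_eq

theorem fixedRatio_measurable (H : Setting P p_v c T f g V τ X 𝒢) (θ : Index)
    (q : Icc (0 : ℝ) T × State d) : FieldMeasurable (E := I) (𝒢 θ)
      fun r ω => (moveTime q.1 r, X θ q.1 (moveTime q.1 r) q.2 ω) :=
  ratio_measurable (H.X_measurable θ) q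

variable [IsProbabilityMeasure P]

/-- The scheme with random transitions `(S, X^{t,x}_S)`, where `S = t + (T - t) τ`. -/
def scheme (H : Setting P p_v c T f g V τ X 𝒢) : Scheme P (Icc (0 : ℝ) T × State d) where
  info θ := 𝒢 θ ⊔ MeasurableSpace.comap (τ θ) inferInstance
  info_le θ := sup_le (H.𝒢_le θ) (H.τ_measurable θ).comap_le
  info_indep := iIndep_sup H.𝒢_le (fun θ => (H.τ_measurable θ).comap_le) H.𝒢_indep
    H.τ_indep.iIndep H.𝒢_indep_τ
  Y θ q ω := (moveTime q.1 (τ θ ω), X θ q.1 (moveTime q.1 (τ θ ω)) q.2 ω)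
  Y_measurable θ := transition_measurable
    (FieldMeasurable.mono (F := fun z ω => fieldMap T (X θ) ω z) le_sup_left (H.X_measurable θ))
    ((comap_measurable (τ θ)).mono le_sup_right le_rfl)
  -- The fields agree in law at fixed times. Freezing the independent ratio `τ θ` transfers this to
  -- the random time.
  Y_law θ θ' q := map_freeze_eq
    (F := fun r ω => (moveTime q.1 r, X θ q.1 (moveTime q.1 r) q.2 ω))
    (F' := fun r ω => (moveTime q.1 r, X θ' q.1 (moveTime q.1 r) q.2 ω))
    (H.𝒢_le θ) (H.τ_measurable θ).comap_le (H.indep_τ θ)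
    (H.𝒢_le θ') (H.τ_measurable θ').comap_le (H.indep_τ θ')
    (H.fixedRatio_measurable θ q) (H.fixedRatio_measurable θ' q)
    (comap_measurable (τ θ)) (comap_measurable (τ θ'))
    (fun r => H.map_field_eq (timePair q.1 r, q.2)
      (φ := fun y => (moveTime q.1 r, y)) measurable_prodMk_left θ θ')
    ((H.τ_ident θ).trans (H.τ_ident θ').symm).map_eq
  G θ q ω := g (X θ q.1 T q.2 ω)
  G_measurable θ := terminal_measurable
    (FieldMeasurable.mono (F := fun z ω => fieldMap T (X θ) ω z) le_sup_left (H.X_measurable θ))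
    H.g_continuous.measurable
  G_law θ θ' q := H.map_field_eq (endPair q.1, q.2) H.g_continuous.measurable θ θ'
  h q := T - q.1
  h_measurable := by fun_prop
  h_nonneg q := sub_nonneg.2 q.1.2.2

/-- A law on the line is determined by its distribution function. The result converts expectations
over the random ratio into Lebesgue integrals. -/
theorem map_τ_eq (H : Setting P p_v c T f g V τ X 𝒢) :
    (P.map (τ Index.root)).map (Subtype.val : I → ℝ) = volume.restrict (Icc (0 : ℝ) 1) := by
  have hm : Measurable (Subtype.val ∘ τ Index.root) :=
    measurable_subtype_coe.comp (H.τ_measurable _)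
  rw [Measure.map_map measurable_subtype_coe (H.τ_measurable _)]
  have : IsProbabilityMeasure (P.map (Subtype.val ∘ τ Index.root)) :=
    Measure.isProbabilityMeasure_map hm.aemeasurable
  refine Measure.ext_of_Iic _ _ fun a => ?_
  rw [Measure.map_apply hm measurableSet_Iic, Measure.restrict_apply measurableSet_Iic]
  have e : (Subtype.val ∘ τ Index.root) ⁻¹' Iic a = {ω | (τ Index.root ω : ℝ) ≤ a} := rfl
  rw [e]
  rcases lt_or_ge a 0 with ha | ha
  · have h1 : {ω | (τ Index.root ω : ℝ) ≤ a} = ∅ := by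
      ext ω
      have := (τ Index.root ω).2.1
      simp only [mem_ofPred_eq, mem_empty_iff_false, iff_false, not_le]
      linarith
    have h2 : Iic a ∩ Icc (0 : ℝ) 1 = ∅ := by
      ext z
      simp only [mem_inter_iff, mem_Iic, mem_Icc, mem_empty_iff_false, iff_false, not_and]
      intro h h'
      linarith
    rw [h1, h2]
    simp
  · rcases le_or_gt a 1 with ha1 | ha1
    · rw [H.τ_unif a ⟨ha, ha1⟩]
      have h2 : Iic a ∩ Icc (0 : ℝ) 1 = Icc 0 a := by
        ext z
        simp only [mem_inter_iff, mem_Iic, mem_Icc]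
        constructor
        · rintro ⟨h1, h2, h3⟩; exact ⟨h2, h1⟩
        · rintro ⟨h1, h2⟩; exact ⟨h2, h1, h2.trans ha1⟩
      rw [h2, Real.volume_Icc, sub_zero]
    · have h1 : {ω | (τ Index.root ω : ℝ) ≤ a} = univ := by
        ext ω
        have := (τ Index.root ω).2.2
        simp only [mem_ofPred_eq, mem_univ, iff_true]
        linarith
      have h2 : Iic a ∩ Icc (0 : ℝ) 1 = Icc 0 1 := by
        ext z
        simp only [mem_inter_iff, mem_Iic, mem_Icc, and_iff_right_iff_imp]
        intro h
        linarith [h.2]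
      rw [h1, h2]
      simp

theorem lintegral_transition_eq_ratio (H : Setting P p_v c T f g V τ X 𝒢)
    {ψ : ℝ → State d → ℝ≥0∞} (hψ : Measurable fun q : Icc (0 : ℝ) T × State d => ψ q.1 q.2)
    (q : Icc (0 : ℝ) T × State d) :
    ∫⁻ ω, ψ (H.scheme.Y Index.root q ω).1 (H.scheme.Y Index.root q ω).2 ∂P
      = ∫⁻ r in Icc (0 : ℝ) 1, ∫⁻ ω, ψ (q.1 + (T - q.1) * r)
          (X Index.root q.1 (q.1 + (T - q.1) * r) q.2 ω) ∂P := by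
  rw [← H.map_τ_eq, (MeasurableEmbedding.subtype_coe measurableSet_Icc).lintegral_map]
  exact lintegral_freeze (H.𝒢_le _) (H.τ_measurable _).comap_le (H.indep_τ _)
    (F := fun r ω => ψ (moveTime q.1 r) (X Index.root q.1 (moveTime q.1 r) q.2 ω))
    (FieldMeasurable.map (𝒜 := 𝒢 _) (H.fixedRatio_measurable _ q) hψ) (comap_measurable _)

/-- The substitution `s = t + (T - t) r` has Jacobian `T - t`, so a uniform random time multiplied
by the remaining time is the time integral. -/
theorem lintegral_transition (H : Setting P p_v c T f g V τ X 𝒢)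
    {ψ : ℝ → State d → ℝ≥0∞} (hψ : Measurable fun q : Icc (0 : ℝ) T × State d => ψ q.1 q.2)
    (q : Icc (0 : ℝ) T × State d) :
    ENNReal.ofReal (T - q.1) *
        ∫⁻ ω, ψ (H.scheme.Y Index.root q ω).1 (H.scheme.Y Index.root q ω).2 ∂P
      = ∫⁻ s in Icc (q.1 : ℝ) T, ∫⁻ ω, ψ s (X Index.root q.1 s q.2 ω) ∂P := by
  rw [H.lintegral_transition_eq_ratio hψ]
  -- At `t = T` the substitution degenerates, but both sides vanish.
  rcases q.1.2.2.eq_or_lt with h | h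
  · rw [h]
    simp
  · have himg : (fun r : ℝ => q.1 + (T - q.1) * r) '' Icc 0 1 = Icc (q.1 : ℝ) T := by
      have := Set.image_affine_Icc' (sub_pos.2 h) (q.1 : ℝ) 0 1
      simpa [add_comm] using this
    have hderiv : ∀ r : ℝ, HasDerivWithinAt (fun r : ℝ => q.1 + (T - q.1) * r) (T - q.1)
        (Icc 0 1) r := by
      intro r
      have := ((hasDerivAt_id r).const_mul (T - (q.1 : ℝ))).const_add (q.1 : ℝ)
      simpa using this.hasDerivWithinAt
    have hinj : InjOn (fun r : ℝ => q.1 + (T - q.1) * r) (Icc 0 1) := by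
      intro r _ r' _ hr
      have h0 : T - (q.1 : ℝ) ≠ 0 := (sub_pos.2 h).ne'
      simpa [h0] using hr
    rw [← himg, lintegral_image_eq_lintegral_abs_deriv_mul measurableSet_Icc
      (f' := fun _ => T - q.1) (fun r _ => hderiv r) hinj]
    rw [lintegral_const_mul' _ _ ENNReal.ofReal_ne_top, abs_of_pos (sub_pos.2 h)]

theorem integral_transition (H : Setting P p_v c T f g V τ X 𝒢)
    {ψ : ℝ → State d → ℝ} (hψ : Measurable fun q : Icc (0 : ℝ) T × State d => ψ q.1 q.2)
    (q : Icc (0 : ℝ) T × State d)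
    (hi : Integrable (fun ω => ψ (H.scheme.Y Index.root q ω).1 (H.scheme.Y Index.root q ω).2) P) :
    (T - q.1) * ∫ ω, ψ (H.scheme.Y Index.root q ω).1 (H.scheme.Y Index.root q ω).2 ∂P
      = ∫ s in (q.1 : ℝ)..T, ∫ ω, ψ s (X Index.root q.1 s q.2 ω) ∂P := by
  have h1 : ∫ ω, ψ (H.scheme.Y Index.root q ω).1 (H.scheme.Y Index.root q ω).2 ∂P
      = ∫ r in (0 : ℝ)..1, ∫ ω, ψ (q.1 + (T - q.1) * r)
          (X Index.root q.1 (q.1 + (T - q.1) * r) q.2 ω) ∂P := by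
    rw [intervalIntegral.integral_of_le zero_le_one, ← integral_Icc_eq_integral_Ioc,
      ← H.map_τ_eq, (MeasurableEmbedding.subtype_coe measurableSet_Icc).integral_map]
    exact integral_freeze (H.𝒢_le _) (H.τ_measurable _).comap_le (H.indep_τ _)
      (F := fun r ω => ψ (moveTime q.1 r) (X Index.root q.1 (moveTime q.1 r) q.2 ω))
      (FieldMeasurable.map (𝒜 := 𝒢 _) (H.fixedRatio_measurable _ q) hψ) (comap_measurable _) hi
  rw [h1]
  have h2 := intervalIntegral.smul_integral_comp_add_mul
    (fun s => ∫ ω, ψ s (X Index.root q.1 s q.2 ω) ∂P) (T - q.1) (q.1 : ℝ) (a := 0) (b := 1)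
  rw [smul_eq_mul] at h2
  rw [h2]
  simp

end Setting

namespace Setting

variable {d : ℕ} {Ω : Type*} [mΩ : MeasurableSpace Ω] {P : Measure Ω}
  {p_v c T : ℝ} {f : ℝ → ℝ} {g : State d → ℝ} {V : ℝ → State d → ℝ} {τ : Index → Ω → I}
  {X : Index → ℝ → ℝ → State d → Ω → State d} {𝒢 : Index → MeasurableSpace Ω}

/-! ### Moment bounds -/

theorem V_measurable (H : Setting P p_v c T f g V τ X 𝒢) :
    Measurable fun q : Icc (0 : ℝ) T × State d => V q.1 q.2 :=
  (H.V_continuousOn.comp_continuous (f := fun q : Icc (0 : ℝ) T × State d => ((q.1 : ℝ), q.2))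
    (by fun_prop) fun q => ⟨q.1.2, trivial⟩).measurable

theorem weight_measurable (H : Setting P p_v c T f g V τ X 𝒢) (a : ℝ) :
    Measurable fun q : Icc (0 : ℝ) T × State d => Real.exp (a * (T - q.1)) * V q.1 q.2 :=
  Measurable.mul (by fun_prop) H.V_measurable

theorem V_pos (H : Setting P p_v c T f g V τ X 𝒢) (q : Icc (0 : ℝ) T × State d) :
    0 < V q.1 q.2 :=
  zero_lt_one.trans_le (H.one_le_V q.1 q.1.2 q.2)

theorem X_section_measurable (H : Setting P p_v c T f g V τ X 𝒢) (θ : Index) {t s : ℝ}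
    (ht : t ∈ Icc 0 T) (hs : s ∈ Icc t T) (x : State d) : Measurable (X θ t s x) :=
  ((FieldMeasurable.mono (F := fun z ω => fieldMap T (X θ) ω z) (H.𝒢_le θ)
    (H.X_measurable θ)).section_measurable (⟨(t, s), ht.1, hs.1, hs.2⟩, x))

theorem V_rpow_measurable (H : Setting P p_v c T f g V τ X 𝒢) (p a : ℝ) :
    Measurable fun q : Icc (0 : ℝ) T × State d =>
      ENNReal.ofReal (Real.exp (a * (T - q.1)) * V q.1 q.2 ^ p) :=
  (Measurable.mul (by fun_prop) (H.V_measurable.pow_const p)).ennreal_ofReal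

theorem V_le_weight (H : Setting P p_v c T f g V τ X 𝒢) {a : ℝ} (ha : 0 ≤ a)
    (q : Icc (0 : ℝ) T × State d) : V q.1 q.2 ≤ Real.exp (a * (T - q.1)) * V q.1 q.2 :=
  le_mul_of_one_le_left (H.V_pos q).le
    (Real.one_le_exp (mul_nonneg ha (sub_nonneg.2 q.1.2.2)))

theorem weight_le (H : Setting P p_v c T f g V τ X 𝒢) {a : ℝ} (ha : 0 ≤ a)
    (q : Icc (0 : ℝ) T × State d) :
    Real.exp (a * (T - q.1)) * V q.1 q.2 ≤ Real.exp (a * T) * V q.1 q.2 := by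
  have := H.V_pos q
  have := q.1.2.1
  gcongr
  linarith

theorem abs_f_zero_le (H : Setting P p_v c T f g V τ X 𝒢) (q : Icc (0 : ℝ) T × State d) :
    (T - q.1) * |f 0| ≤ V q.1 q.2 := by
  have h := H.f_zero_le q.1 q.1.2 q.2
  rw [abs_mul, abs_of_pos H.T_pos] at h
  refine (mul_le_mul_of_nonneg_right ?_ (abs_nonneg _)).trans h
  linarith [q.1.2.1]

theorem bounded_weight (H : Setting P p_v c T f g V τ X 𝒢) {a : ℝ} (ha : 0 ≤ a)
    {u : Icc (0 : ℝ) T × State d → ℝ} {K : ℝ} (hK : 0 ≤ K) (hu : ∀ q, |u q| ≤ K * V q.1 q.2)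
    (q : Icc (0 : ℝ) T × State d) :
    |u q| ≤ K * (Real.exp (a * (T - q.1)) * V q.1 q.2) :=
  (hu q).trans (mul_le_mul_of_nonneg_left (H.V_le_weight ha q) hK)

theorem integral_exp_eq {a t T : ℝ} (ha : a ≠ 0) :
    ∫ s in t..T, Real.exp (a * (T - s)) = (Real.exp (a * (T - t)) - 1) / a := by
  have h : ∀ s ∈ uIcc t T, HasDerivAt (fun s => -(Real.exp (a * (T - s)) / a))
      (Real.exp (a * (T - s))) s := by
    intro s _
    have h1 : HasDerivAt (fun s => a * (T - s)) (-a) s := by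
      simpa using ((hasDerivAt_id s).const_sub T).const_mul a
    refine (h1.exp.div_const a).neg.congr_deriv ?_
    field_simp
  rw [intervalIntegral.integral_eq_sub_of_hasDerivAt h
    (Continuous.intervalIntegrable (by fun_prop) _ _)]
  simp
  ring

variable [IsProbabilityMeasure P]

/-- On a probability space `L^p` norms increase with the exponent, so the Lyapunov bound at `p_v`
descends to every `p ≤ p_v`. -/
theorem lintegral_V_rpow_le (H : Setting P p_v c T f g V τ X 𝒢) {p : ℝ} (hp : 1 ≤ p)
    (hpv : p ≤ p_v) {t s : ℝ} (ht : t ∈ Icc 0 T) (hs : s ∈ Icc t T) (x : State d) :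
    ∫⁻ ω, ENNReal.ofReal (V s (X Index.root t s x ω) ^ p) ∂P ≤ ENNReal.ofReal (V t x ^ p) := by
  have hs0 : s ∈ Icc 0 T := ⟨ht.1.trans hs.1, hs.2⟩
  have hp0 : 0 < p := by linarith
  have hVm : Measurable fun ω => V s (X Index.root t s x ω) :=
    H.V_measurable.comp (measurable_const.prodMk (H.X_section_measurable Index.root ht hs x) :
      Measurable fun ω => ((⟨s, hs0⟩ : Icc (0 : ℝ) T), X Index.root t s x ω))
  have h := (eLpNorm_le_eLpNorm_of_exponent_le (ENNReal.ofReal_le_ofReal hpv)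
    hVm.aestronglyMeasurable).trans (H.lyapunov t ht s hs x)
  have h2 := ENNReal.rpow_le_rpow h hp0.le
  rw [eLpNorm_rpow_eq_lintegral hp0, ENNReal.ofReal_rpow_of_nonneg
    (zero_le_one.trans (H.one_le_V t ht x)) hp0.le] at h2
  refine (le_of_eq (lintegral_congr fun ω => ?_)).trans h2
  have h3 : 0 ≤ V s (X Index.root t s x ω) := zero_le_one.trans (H.one_le_V s hs0 _)
  rw [← ENNReal.ofReal_rpow_of_nonneg h3 hp0.le, Real.enorm_of_nonneg h3]

/-- The Lyapunov estimate for a random transition with an exponential weight in time. -/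
theorem lintegral_exp_V_le (H : Setting P p_v c T f g V τ X 𝒢) {p : ℝ} (hp : 1 ≤ p)
    (hpv : p ≤ p_v) {a : ℝ} (ha : 0 < a) (q : Icc (0 : ℝ) T × State d) :
    ENNReal.ofReal (T - q.1) * ∫⁻ ω, ENNReal.ofReal
      (Real.exp (a * (T - (H.scheme.Y Index.root q ω).1))
        * V (H.scheme.Y Index.root q ω).1 (H.scheme.Y Index.root q ω).2 ^ p) ∂P
      ≤ ENNReal.ofReal ((Real.exp (a * (T - q.1)) - 1) / a * V q.1 q.2 ^ p) := by
  have hVp : 0 ≤ V q.1 q.2 ^ p := Real.rpow_nonneg (H.V_pos q).le p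
  rw [H.lintegral_transition (ψ := fun s y => ENNReal.ofReal (Real.exp (a * (T - s)) * V s y ^ p))
    (H.V_rpow_measurable p a) q]
  have h1 : ∀ s ∈ Icc (q.1 : ℝ) T,
      ∫⁻ ω, ENNReal.ofReal (Real.exp (a * (T - s)) * V s (X Index.root q.1 s q.2 ω) ^ p) ∂P
        ≤ ENNReal.ofReal (Real.exp (a * (T - s))) * ENNReal.ofReal (V q.1 q.2 ^ p) := by
    intro s hs
    simp_rw [ENNReal.ofReal_mul (Real.exp_nonneg _)]
    rw [lintegral_const_mul' _ _ ENNReal.ofReal_ne_top]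
    exact mul_le_mul_right (H.lintegral_V_rpow_le hp hpv q.1.2 hs q.2) _
  refine (setLIntegral_mono' measurableSet_Icc h1).trans ?_
  rw [lintegral_mul_const' _ _ ENNReal.ofReal_ne_top, ← integral_exp_eq ha.ne',
    intervalIntegral.integral_of_le q.1.2.2, ← integral_Icc_eq_integral_Ioc,
    ENNReal.ofReal_mul (integral_nonneg fun s => Real.exp_nonneg _),
    ofReal_integral_eq_lintegral_ofReal
      (Continuous.integrableOn_Icc (by fun_prop)) (Filter.Eventually.of_forall fun s =>
        Real.exp_nonneg _)]

/-- The preceding estimate carries the factor `T - t` and says nothing at `t = T`; integrability is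
therefore read off from the form with the ratio on `[0,1]`, with exponential rate zero. -/
theorem memLp_V (H : Setting P p_v c T f g V τ X 𝒢) {p : ℝ} (hp : 1 ≤ p)
    (hpv : p ≤ p_v) (q : Icc (0 : ℝ) T × State d) :
    MemLp (fun ω => V (H.scheme.Y Index.root q ω).1 (H.scheme.Y Index.root q ω).2)
      (ENNReal.ofReal p) P := by
  have hp0 : 0 < p := by linarith
  have hm : Measurable fun ω => V (H.scheme.Y Index.root q ω).1 (H.scheme.Y Index.root q ω).2 :=
    H.V_measurable.comp (H.scheme.Y_section_measurable Index.root q)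
  refine ⟨hm.aestronglyMeasurable, ?_⟩
  rw [← ENNReal.rpow_lt_top_iff_of_pos hp0, eLpNorm_rpow_eq_lintegral hp0]
  have e : ∀ ω, ‖V (H.scheme.Y Index.root q ω).1 (H.scheme.Y Index.root q ω).2‖ₑ ^ p
      = ENNReal.ofReal (Real.exp (0 * (T - (H.scheme.Y Index.root q ω).1))
        * V (H.scheme.Y Index.root q ω).1 (H.scheme.Y Index.root q ω).2 ^ p) := by
    intro ω
    have := (H.V_pos (H.scheme.Y Index.root q ω)).le
    rw [zero_mul, Real.exp_zero, one_mul, ← ENNReal.ofReal_rpow_of_nonneg this hp0.le,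
      Real.enorm_of_nonneg this]
  simp_rw [e]
  rw [H.lintegral_transition_eq_ratio
    (ψ := fun s y => ENNReal.ofReal (Real.exp (0 * (T - s)) * V s y ^ p))
    (H.V_rpow_measurable p 0) q]
  have h1 : ∀ r ∈ Icc (0 : ℝ) 1,
      ∫⁻ ω, ENNReal.ofReal (Real.exp (0 * (T - (q.1 + (T - q.1) * r)))
        * V (q.1 + (T - q.1) * r) (X Index.root q.1 (q.1 + (T - q.1) * r) q.2 ω) ^ p) ∂P
        ≤ ENNReal.ofReal (V q.1 q.2 ^ p) := by
    intro r hr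
    simp only [zero_mul, Real.exp_zero, one_mul]
    exact H.lintegral_V_rpow_le hp hpv q.1.2
      ⟨le_moveTime q.1 ⟨r, hr⟩, (moveTime q.1 ⟨r, hr⟩).2.2⟩ q.2
  refine (setLIntegral_mono' measurableSet_Icc h1).trans_lt ?_
  simp

theorem memLp_exp_V (H : Setting P p_v c T f g V τ X 𝒢) {p : ℝ} (hp : 1 ≤ p)
    (hpv : p ≤ p_v) {a : ℝ} (ha : 0 ≤ a) (q : Icc (0 : ℝ) T × State d) :
    MemLp (fun ω => Real.exp (a * (T - (H.scheme.Y Index.root q ω).1))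
      * V (H.scheme.Y Index.root q ω).1 (H.scheme.Y Index.root q ω).2) (ENNReal.ofReal p) P := by
  have hm : Measurable fun ω => Real.exp (a * (T - (H.scheme.Y Index.root q ω).1))
      * V (H.scheme.Y Index.root q ω).1 (H.scheme.Y Index.root q ω).2 :=
    (H.weight_measurable a).comp (H.scheme.Y_section_measurable Index.root q)
  refine ((H.memLp_V hp hpv q).const_mul (Real.exp (a * T))).of_le hm.aestronglyMeasurable
    (Filter.Eventually.of_forall fun ω => ?_)
  have h0 := (H.V_pos (H.scheme.Y Index.root q ω)).le
  rw [Real.norm_of_nonneg (by positivity), Real.norm_of_nonneg (by positivity)]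
  have := (H.scheme.Y Index.root q ω).1.2.1
  gcongr
  linarith

theorem integrable_exp_V (H : Setting P p_v c T f g V τ X 𝒢) (hpv : 1 ≤ p_v) {a : ℝ}
    (ha : 0 ≤ a) (q : Icc (0 : ℝ) T × State d) :
    Integrable (fun ω => Real.exp (a * (T - (H.scheme.Y Index.root q ω).1))
      * V (H.scheme.Y Index.root q ω).1 (H.scheme.Y Index.root q ω).2) P :=
  (H.memLp_exp_V le_rfl hpv ha q).integrable (by simp)

theorem integral_exp_V_le (H : Setting P p_v c T f g V τ X 𝒢) (hpv : 1 ≤ p_v) {a : ℝ}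
    (ha : 0 < a) (q : Icc (0 : ℝ) T × State d) :
    (T - q.1) * ∫ ω, Real.exp (a * (T - (H.scheme.Y Index.root q ω).1))
      * V (H.scheme.Y Index.root q ω).1 (H.scheme.Y Index.root q ω).2 ∂P
      ≤ (Real.exp (a * (T - q.1)) - 1) / a * V q.1 q.2 := by
  have hh : 0 ≤ T - (q.1 : ℝ) := sub_nonneg.2 q.1.2.2
  have h := H.lintegral_exp_V_le le_rfl hpv ha q
  simp only [Real.rpow_one] at h
  rw [← ofReal_integral_eq_lintegral_ofReal (H.integrable_exp_V hpv ha.le q)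
    (Filter.Eventually.of_forall fun ω => mul_nonneg (Real.exp_nonneg _)
      (H.V_pos (H.scheme.Y Index.root q ω)).le), ← ENNReal.ofReal_mul hh] at h
  refine (ENNReal.ofReal_le_ofReal_iff (mul_nonneg (div_nonneg ?_ ha.le) (H.V_pos q).le)).1 h
  rw [sub_nonneg]
  exact Real.one_le_exp (mul_nonneg ha.le hh)

/-- The `L^p` version of the Lyapunov estimate for a random transition. -/
theorem eLpNorm_exp_V_le (H : Setting P p_v c T f g V τ X 𝒢) {p : ℝ} (hp : 1 ≤ p)
    (hpv : p ≤ p_v) {μ : ℝ} (hμ : 0 < μ) (q : Icc (0 : ℝ) T × State d) :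
    (T - q.1) * (eLpNorm (fun ω => Real.exp (μ / (p * T) * (T - (H.scheme.Y Index.root q ω).1))
      * V (H.scheme.Y Index.root q ω).1 (H.scheme.Y Index.root q ω).2) (ENNReal.ofReal p) P).toReal
      ≤ T * μ ^ (-(1 / p)) * (Real.exp (μ / (p * T) * (T - q.1)) * V q.1 q.2) := by
  have hp0 : 0 < p := by linarith
  have hT := H.T_pos
  have hh : 0 ≤ T - (q.1 : ℝ) := sub_nonneg.2 q.1.2.2
  have hV := H.V_pos q
  have hL := H.memLp_exp_V hp hpv (show 0 ≤ μ / (p * T) by positivity) q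
  set N := eLpNorm (fun ω => Real.exp (μ / (p * T) * (T - (H.scheme.Y Index.root q ω).1))
      * V (H.scheme.Y Index.root q ω).1 (H.scheme.Y Index.root q ω).2) (ENNReal.ofReal p) P with hN
  -- The rate `μ / (p * T)` is chosen so that the `p`-th power of the weight has rate `μ / T`.
  have hexp : ∀ z : ℝ, Real.exp (μ / (p * T) * z) ^ p = Real.exp (μ / T * z) := by
    intro z
    rw [← Real.exp_mul]
    congr 1
    field_simp
  have hNp : N ^ p = ∫⁻ ω, ENNReal.ofReal
      (Real.exp (μ / T * (T - (H.scheme.Y Index.root q ω).1))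
        * V (H.scheme.Y Index.root q ω).1 (H.scheme.Y Index.root q ω).2 ^ p) ∂P := by
    rw [hN, eLpNorm_rpow_eq_lintegral hp0]
    refine lintegral_congr fun ω => ?_
    have h0 := (H.V_pos (H.scheme.Y Index.root q ω)).le
    rw [Real.enorm_of_nonneg (by positivity), ENNReal.ofReal_rpow_of_nonneg (by positivity) hp0.le,
      Real.mul_rpow (Real.exp_nonneg _) h0, hexp]
  have h := H.lintegral_exp_V_le hp hpv (show 0 < μ / T by positivity) q
  rw [← hNp, ← ENNReal.ofReal_toReal (show N ≠ ∞ from hL.eLpNorm_ne_top),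
    ENNReal.ofReal_rpow_of_nonneg ENNReal.toReal_nonneg hp0.le, ← ENNReal.ofReal_mul hh] at h
  have hexp1 : 1 ≤ Real.exp (μ / T * (T - q.1)) := Real.one_le_exp (by positivity)
  have h' := (ENNReal.ofReal_le_ofReal_iff (mul_nonneg (div_nonneg (sub_nonneg.2 hexp1)
    (by positivity)) (by positivity))).1 h
  have hn : 0 ≤ N.toReal := ENNReal.toReal_nonneg
  set n := N.toReal
  rw [← Real.rpow_le_rpow_iff (z := p) (by positivity) (by positivity) hp0,
    Real.mul_rpow hh hn, Real.mul_rpow (by positivity) (by positivity),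
    Real.mul_rpow hT.le (by positivity), Real.mul_rpow (Real.exp_nonneg _) hV.le, hexp,
    ← Real.rpow_mul hμ.le, show -(1 / p) * p = -1 by field_simp, Real.rpow_neg_one]
  -- One factor `T - t` is used up by the time integral, which yields `T / μ`; the other `p - 1` are
  -- bounded by powers of `T`. The `p`-th root then gives `T * μ ^ (-(1 / p))`.
  have e1 : (T - (q.1 : ℝ)) ^ p = (T - q.1) ^ (p - 1) * (T - q.1) := by
    rcases hh.eq_or_lt with h0 | h0
    · rw [← h0, Real.zero_rpow hp0.ne', mul_zero]
    · rw [← Real.rpow_add_one h0.ne', sub_add_cancel]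
  have e2 : T ^ p = T ^ (p - 1) * T := by rw [← Real.rpow_add_one hT.ne', sub_add_cancel]
  have hle : (T - (q.1 : ℝ)) ^ (p - 1) ≤ T ^ (p - 1) :=
    Real.rpow_le_rpow hh (by linarith [q.1.2.1]) (by linarith)
  rw [e1, e2]
  calc (T - (q.1 : ℝ)) ^ (p - 1) * (T - q.1) * n ^ p
      = (T - (q.1 : ℝ)) ^ (p - 1) * ((T - q.1) * n ^ p) := by ring
    _ ≤ T ^ (p - 1) * ((Real.exp (μ / T * (T - q.1)) - 1) / (μ / T) * V q.1 q.2 ^ p) := by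
        gcongr
    _ ≤ T ^ (p - 1) * (Real.exp (μ / T * (T - q.1)) / (μ / T) * V q.1 q.2 ^ p) := by
        gcongr
        linarith
    _ = _ := by field_simp

theorem lintegral_g_le (H : Setting P p_v c T f g V τ X 𝒢) (hpv : 1 ≤ p_v)
    (q : Icc (0 : ℝ) T × State d) :
    ∫⁻ ω, ENNReal.ofReal |g (X Index.root q.1 T q.2 ω)| ∂P ≤ ENNReal.ofReal (V q.1 q.2) := by
  have h := H.lintegral_V_rpow_le le_rfl hpv q.1.2 ⟨q.1.2.2, le_rfl⟩ q.2
  simp only [Real.rpow_one] at h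
  exact (lintegral_mono fun ω => ENNReal.ofReal_le_ofReal (H.g_le _)).trans h

theorem eLpNorm_g_le (H : Setting P p_v c T f g V τ X 𝒢) {p : ℝ} (hp : 1 ≤ p)
    (hpv : p ≤ p_v) (q : Icc (0 : ℝ) T × State d) :
    eLpNorm (H.scheme.G Index.root q) (ENNReal.ofReal p) P ≤ ENNReal.ofReal (V q.1 q.2) := by
  have hp0 : 0 < p := by linarith
  rw [← ENNReal.rpow_le_rpow_iff hp0, eLpNorm_rpow_eq_lintegral hp0,
    ENNReal.ofReal_rpow_of_nonneg (H.V_pos q).le hp0.le]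
  refine (lintegral_mono fun ω => ?_).trans
    (H.lintegral_V_rpow_le hp hpv q.1.2 ⟨q.1.2.2, le_rfl⟩ q.2)
  rw [Real.enorm_eq_ofReal_abs, ENNReal.ofReal_rpow_of_nonneg (abs_nonneg _) hp0.le]
  exact ENNReal.ofReal_le_ofReal (Real.rpow_le_rpow (abs_nonneg _) (H.g_le _) hp0.le)

theorem abs_integral_g_le (H : Setting P p_v c T f g V τ X 𝒢) (hpv : 1 ≤ p_v)
    (q : Icc (0 : ℝ) T × State d) :
    |∫ ω, H.scheme.G Index.root q ω ∂P| ≤ V q.1 q.2 := by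
  have h := enorm_integral_le_lintegral_enorm (μ := P) (H.scheme.G Index.root q)
  simp only [Real.enorm_eq_ofReal_abs] at h
  exact (ENNReal.ofReal_le_ofReal_iff (H.V_pos q).le).1 (h.trans (H.lintegral_g_le hpv q))

/-! ### Solutions -/

/-- Integrating the exponential of rate `2 * c` produces `1 / (2 * c)`, which turns the Lipschitz
constant into one half. -/
theorem contractive (H : Setting P p_v c T f g V τ X 𝒢) (hpv : 1 ≤ p_v) :
    H.scheme.Contractive c fun q => Real.exp (2 * c * (T - q.1)) * V q.1 q.2 where
  W_measurable := H.weight_measurable _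
  W_nonneg q := mul_nonneg (Real.exp_nonneg _) (H.V_pos q).le
  integrable q := H.integrable_exp_V hpv (by linarith [H.c_pos]) q
  transition_le q := by
    have hc := H.c_pos
    have h := mul_le_mul_of_nonneg_left
      (H.integral_exp_V_le hpv (show 0 < 2 * c by linarith) q) hc.le
    refine h.trans ?_
    have e : c * ((Real.exp (2 * c * (T - q.1)) - 1) / (2 * c) * V q.1 q.2)
        = (Real.exp (2 * c * (T - q.1)) * V q.1 q.2 - V q.1 q.2) / 2 := by field_simp
    rw [e]
    linarith [H.V_pos q]

/-- Solutions of the fixed-point equation on the state space `[0, T] × ℝ^d`. -/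
structure IsFixed (H : Setting P p_v c T f g V τ X 𝒢)
    (u : Icc (0 : ℝ) T × State d → ℝ) : Prop where
  measurable : Measurable u
  bounded : ∃ K, 0 ≤ K ∧ ∀ q, |u q| ≤ K * V q.1 q.2
  fixed : ∀ q, u q = H.scheme.picard f u q

theorem integrable_f (H : Setting P p_v c T f g V τ X 𝒢) (hpv : 1 ≤ p_v)
    {u : Icc (0 : ℝ) T × State d → ℝ} (hu : Measurable u) {K : ℝ}
    (hK : ∀ q, |u q| ≤ K * V q.1 q.2) (q : Icc (0 : ℝ) T × State d) :
    Integrable (fun ω => f (u (H.scheme.Y Index.root q ω))) P :=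
  Scheme.integrable_nonlinearity (W := fun q => V q.1 q.2) H.f_continuous.measurable H.lipschitz
    H.c_pos.le hu hK ((H.memLp_V le_rfl hpv q).integrable (by simp))

/-- A finite supremum is a bound by a multiple of `V`, and such a bound makes the other two
finiteness conditions automatic. The time integral is `T - t` times the expectation over a
transition. -/
theorem isSolution_iff (H : Setting P p_v c T f g V τ X 𝒢) (hpv : 1 ≤ p_v)
    (u : ℝ → State d → ℝ) :
    IsSolution P T f g V (X Index.root) u
      ↔ H.IsFixed fun q : Icc (0 : ℝ) T × State d => u q.1 q.2 := by
  have hpic : ∀ (_ : Measurable fun q : Icc (0 : ℝ) T × State d => u q.1 q.2) {K : ℝ}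
      (_ : ∀ q : Icc (0 : ℝ) T × State d, |u q.1 q.2| ≤ K * V q.1 q.2)
      (q : Icc (0 : ℝ) T × State d),
      H.scheme.picard f (fun q => u q.1 q.2) q = (∫ ω, g (X Index.root q.1 T q.2 ω) ∂P)
        + ∫ s in (q.1 : ℝ)..T, ∫ ω, f (u s (X Index.root q.1 s q.2 ω)) ∂P := by
    intro hm K hK q
    rw [Scheme.picard, ← H.integral_transition (ψ := fun s y => f (u s y))
      (H.f_continuous.measurable.comp hm) q (H.integrable_f hpv hm hK q)]
    rfl
  constructor
  · rintro ⟨hm, h⟩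
    -- The supremum does not depend on `(t, x)`, so any single point serves.
    have h0 := (h 0 ⟨le_rfl, H.T_pos.le⟩ 0).1
    set S := ⨆ (y : State d) (s : Icc (0 : ℝ) T), ENNReal.ofReal (|u s y| / V s y) with hS
    have hSt : S ≠ ∞ := fun e => by simp [e] at h0
    have hK : ∀ q : Icc (0 : ℝ) T × State d, |u q.1 q.2| ≤ S.toReal * V q.1 q.2 := by
      intro q
      rw [← div_le_iff₀ (H.V_pos q)]
      refine (ENNReal.ofReal_le_iff_le_toReal hSt).1 ?_
      exact le_iSup₂ (f := fun (y : State d) (s : Icc (0 : ℝ) T) =>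
        ENNReal.ofReal (|u s y| / V s y)) q.2 q.1
    refine ⟨hm, ⟨S.toReal, ENNReal.toReal_nonneg, hK⟩, fun q => ?_⟩
    rw [hpic hm hK q]
    exact (h q.1 q.1.2 q.2).2
  · rintro ⟨hm, ⟨K, hK0, hK⟩, hfix⟩
    refine ⟨hm, fun t ht x => ⟨?_, ?_⟩⟩
    · refine ENNReal.add_lt_top.2 ⟨ENNReal.add_lt_top.2 ⟨?_, ?_⟩, ?_⟩
      · exact (H.lintegral_g_le hpv (⟨t, ht⟩, x)).trans_lt ENNReal.ofReal_lt_top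
      · have h1 := H.lintegral_transition (ψ := fun s y => ENNReal.ofReal |f (u s y)|)
          (by have := H.f_continuous.measurable.comp hm
              exact (continuous_abs.measurable.comp this).ennreal_ofReal) (⟨t, ht⟩, x)
        simp only at h1
        rw [← h1]
        refine ENNReal.mul_lt_top ENNReal.ofReal_lt_top ?_
        have h2 := (H.integrable_f hpv hm hK (⟨t, ht⟩, x)).2
        simpa only [HasFiniteIntegral, Real.enorm_eq_ofReal_abs] using h2
      · refine (iSup₂_le fun y s => ?_).trans_lt (ENNReal.ofReal_lt_top (r := K))
        exact ENNReal.ofReal_le_ofReal ((div_le_iff₀ (H.V_pos (s, y))).2 (hK (s, y)))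
    · exact (hfix (⟨t, ht⟩, x)).trans (hpic hm hK (⟨t, ht⟩, x))

theorem exists_isFixed (H : Setting P p_v c T f g V τ X 𝒢) (hpv : 1 ≤ p_v) :
    ∃ u, H.IsFixed u := by
  have hc := H.c_pos
  obtain ⟨u, hm, hb, hfix⟩ := (H.contractive hpv).exists_fixed H.f_continuous.measurable
    -- The first Picard iterate is at most `2 * V`: one `V` from `g` and one from `(T - t) * |f 0|`.
    H.lipschitz hc.le (K := 2) (by norm_num) fun q => by
      have h1 := H.abs_integral_g_le hpv q
      have h2 := H.abs_f_zero_le q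
      have h3 := H.V_le_weight (show 0 ≤ 2 * c by linarith) q
      have hh : |H.scheme.h q * f 0| = (T - q.1) * |f 0| := by
        rw [abs_mul, abs_of_nonneg (H.scheme.h_nonneg q)]
        rfl
      simp only [Scheme.picard, integral_const, probReal_univ, smul_eq_mul, one_mul]
      refine (abs_add_le _ _).trans ?_
      rw [hh]
      linarith
  refine ⟨u, hm, ⟨2 * 2 * Real.exp (2 * c * T), by positivity, fun q => ?_⟩, hfix⟩
  have := H.weight_le (a := 2 * c) (by linarith) q
  have := hb q
  linarith

theorem isFixed_unique (H : Setting P p_v c T f g V τ X 𝒢) (hpv : 1 ≤ p_v)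
    {u v : Icc (0 : ℝ) T × State d → ℝ} (hu : H.IsFixed u) (hv : H.IsFixed v)
    (q : Icc (0 : ℝ) T × State d) : u q = v q := by
  obtain ⟨K, hK0, hK⟩ := hu.bounded
  obtain ⟨K', hK0', hK'⟩ := hv.bounded
  have hc : 0 ≤ 2 * c := by linarith [H.c_pos]
  exact (H.contractive hpv).unique H.f_continuous.measurable H.lipschitz H.c_pos.le
    hu.measurable hv.measurable hK0 hK0' (H.bounded_weight hc hK0 hK)
    (H.bounded_weight hc hK0' hK') hu.fixed hv.fixed q

/-- The comparison function reproduces itself: `g` and `f 0` contribute `2 V`, and the Lipschitz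
part at most `2 (exp(c(T-t)) - 1) V`. -/
theorem isFixed_le (H : Setting P p_v c T f g V τ X 𝒢) (hpv : 1 ≤ p_v)
    {u : Icc (0 : ℝ) T × State d → ℝ} (hu : H.IsFixed u) (q : Icc (0 : ℝ) T × State d) :
    |u q| ≤ 2 * (Real.exp (c * (T - q.1)) * V q.1 q.2) := by
  obtain ⟨K, hK0, hK⟩ := hu.bounded
  have hc := H.c_pos
  have hc2 : 0 ≤ 2 * c := by linarith
  refine (H.contractive hpv).fixed_le H.f_continuous.measurable H.lipschitz hc.le
    hu.measurable hK0 (H.bounded_weight hc2 hK0 hK) hu.fixed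
    (B := fun q => 2 * (Real.exp (c * (T - q.1)) * V q.1 q.2))
    (fun q => ?_) (fun q => (H.integrable_exp_V hpv hc.le q).const_mul 2) (fun q => ?_) q
  · have := H.V_pos q
    positivity
  · have h1 := H.abs_integral_g_le hpv q
    have h2 := H.abs_f_zero_le q
    have h3 := mul_le_mul_of_nonneg_left (H.integral_exp_V_le hpv hc q) hc.le
    have e : c * ((Real.exp (c * (T - q.1)) - 1) / c * V q.1 q.2)
        = Real.exp (c * (T - q.1)) * V q.1 q.2 - V q.1 q.2 := by field_simp
    rw [e] at h3
    rw [integral_const_mul]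
    have e2 : H.scheme.h q = T - q.1 := rfl
    rw [e2]
    linarith

end Setting

/-! ### The error of the multilevel Picard approximations -/

theorem sum_Icc_one_eq_sum_range {M : Type*} [AddCommMonoid M] (F : ℕ → M) (N : ℕ) :
    ∑ i ∈ Finset.Icc 1 N, F i = ∑ i ∈ Finset.range N, F (i + 1) := by
  induction N with
  | zero => simp
  | succ N ih => rw [Finset.sum_Icc_succ_top (by omega), ih, Finset.sum_range_succ]

/-- The bound `1 + 4 x ≤ exp (4 x)` controls each factor of the product; the remaining `exp x` of
`exp (5 x)` absorbs the size of `u`. -/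
theorem errorConst_le {a x : ℝ} (ha : 1 ≤ a) (hx : 0 ≤ x) {n : ℕ} (hn : 1 ≤ n) :
    Scheme.errorConst a (4 * a * x) (2 * Real.exp x) n ≤ 2 * a ^ n * Real.exp (5 * x * n) := by
  obtain ⟨l, rfl⟩ : ∃ l, n = l + 1 := ⟨n - 1, by omega⟩
  have h4 : 1 + 4 * x ≤ Real.exp (4 * x) := by linarith [Real.add_one_le_exp (4 * x)]
  have hx1 : 1 ≤ Real.exp x := Real.one_le_exp hx
  have e5 : Real.exp (5 * x) = Real.exp (4 * x) * Real.exp x := by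
    rw [← Real.exp_add]; congr 1; ring
  have h1 : 1 + 4 * a * x ≤ a * Real.exp (5 * x) := by
    rw [e5]
    calc 1 + 4 * a * x ≤ a * (1 + 4 * x) := by linarith
      _ ≤ a * (Real.exp (4 * x) * Real.exp x) := by
        gcongr
        exact h4.trans (le_mul_of_one_le_right (Real.exp_nonneg _) hx1)
  have h2 : 2 * a + 4 * a * x * (2 * Real.exp x) ≤ 2 * a * Real.exp (5 * x) := by
    rw [e5]
    calc 2 * a + 4 * a * x * (2 * Real.exp x) ≤ 2 * a * ((1 + 4 * x) * Real.exp x) := by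
          nlinarith
      _ ≤ _ := by gcongr
  have e : Real.exp (5 * x * ((l + 1 : ℕ) : ℝ)) = Real.exp (5 * x) ^ l * Real.exp (5 * x) := by
    rw [← pow_succ, ← Real.exp_nat_mul]
    congr 1
    ring
  have h0 : 0 ≤ 1 + 4 * a * x := by positivity
  rw [Scheme.errorConst, e]
  calc (1 + 4 * a * x) ^ l * (2 * a + 4 * a * x * (2 * Real.exp x))
      ≤ (a * Real.exp (5 * x)) ^ l * (2 * a * Real.exp (5 * x)) := by gcongr
    _ = _ := by rw [mul_pow, pow_succ]; ring

theorem one_div_sqrt_pow {m : ℝ} (hm : 0 < m) (n : ℕ) :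
    (1 / √m) ^ n = m ^ (-(n : ℝ) / 2) := by
  rw [Real.sqrt_eq_rpow, one_div, ← Real.rpow_neg hm.le, ← Real.rpow_natCast,
    ← Real.rpow_mul hm.le]
  congr 1
  ring

namespace Setting

variable {d : ℕ} {Ω : Type*} [mΩ : MeasurableSpace Ω] {P : Measure Ω} [IsProbabilityMeasure P]
  {p_v c T : ℝ} {f : ℝ → ℝ} {g : State d → ℝ} {V : ℝ → State d → ℝ} {τ : Index → Ω → I}
  {X : Index → ℝ → ℝ → State d → Ω → State d} {𝒢 : Index → MeasurableSpace Ω}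

theorem isMLP (H : Setting P p_v c T f g V τ X 𝒢) {U : Index → ℤ → ℤ → ℝ → State d → Ω → ℝ}
    (hU : IsApproximation T f g τ X U) {m : ℕ} (hm : 1 ≤ m) :
    H.scheme.IsMLP f m fun θ n q ω => U θ n m q.1 q.2 ω where
  -- The initial values are stated together with the recursion for `n ≥ 1`; any such `n` provides
  -- them.
  zero θ q ω := (hU 1 m le_rfl hm θ q.1 q.1.2 q.2 ω).2.1
  recursion n hn θ q ω := by
    rw [(hU n m hn hm θ q.1 q.1.2 q.2 ω).2.2]
    congr 1
    · rw [sum_Icc_one_eq_sum_range]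
      push_cast
      rfl
    · refine Finset.sum_congr rfl fun k _ => ?_
      rw [sum_Icc_one_eq_sum_range]
      congr 1
      refine Finset.sum_congr rfl fun i _ => ?_
      rw [Scheme.incr]
      push_cast
      by_cases hk : 1 ≤ k
      · simp only [hk, if_true, one_mul, Nat.cast_sub hk, Nat.cast_one]
        rfl
      · simp only [hk, if_false, zero_mul]
        rfl

/-- The rate is fixed by `μ = m ^ (p / 2)`, for which `μ ^ (-(1 / p)) = 1 / √m`: a transition gains
as much as one level of averaging. -/
theorem controlled (H : Setting P p_v c T f g V τ X 𝒢) {u : Icc (0 : ℝ) T × State d → ℝ}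
    (hu : H.IsFixed u) {p : ℝ} (hp : 2 ≤ p) (hpv : p ≤ p_v) {m : ℕ} (hm : 1 ≤ m) :
    H.scheme.Controlled f c p (2 * Real.exp (c * T)) (T * (1 / √m)) u
      fun q => Real.exp ((m : ℝ) ^ (p / 2) / (p * T) * (T - q.1)) * V q.1 q.2 := by
  have hm0 : (0 : ℝ) < m := by exact_mod_cast hm
  have hμ : 0 < (m : ℝ) ^ (p / 2) := Real.rpow_pos_of_pos hm0 _
  have ha : 0 ≤ (m : ℝ) ^ (p / 2) / (p * T) :=
    div_nonneg hμ.le (mul_nonneg (by linarith) H.T_pos.le)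
  exact
  { f_measurable := H.f_continuous.measurable
    c_nonneg := H.c_pos.le
    lipschitz := H.lipschitz
    two_le := hp
    u_measurable := hu.measurable
    W_measurable := H.weight_measurable _
    W_nonneg := fun q => mul_nonneg (Real.exp_nonneg _) (H.V_pos q).le
    K_nonneg := by positivity
    u_le := fun q => by
      have h1 := H.isFixed_le (by linarith) hu q
      have h2 := H.weight_le H.c_pos.le q
      have h3 := mul_le_mul_of_nonneg_left (H.V_le_weight ha q) (Real.exp_nonneg (c * T))
      linarith
    fixed := hu.fixed
    terminal_le := fun q => (H.eLpNorm_g_le (by linarith) hpv q).trans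
      (ENNReal.ofReal_le_ofReal (H.V_le_weight ha q))
    transition_memLp := fun q => H.memLp_exp_V (by linarith) hpv ha q
    transition_le := fun q => by
      have h := H.eLpNorm_exp_V_le (by linarith) hpv hμ q
      have e : ((m : ℝ) ^ (p / 2)) ^ (-(1 / p)) = 1 / √(m : ℝ) := by
        have := one_div_sqrt_pow hm0 1
        rw [pow_one] at this
        rw [this, ← Real.rpow_mul hm0.le]
        congr 1
        field_simp
        simp
      rw [e] at h
      exact h }

/-- Since `T - t ≤ T`, replacing the weight by `V` costs at most `exp (m ^ (p / 2) / p)`, the only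
exponential term that depends on `m`. -/
theorem eLpNorm_approximation_sub_le (H : Setting P p_v c T f g V τ X 𝒢)
    {U : Index → ℤ → ℤ → ℝ → State d → Ω → ℝ} (hU : IsApproximation T f g τ X U)
    {u : Icc (0 : ℝ) T × State d → ℝ} (hu : H.IsFixed u) {p : ℝ} (hp : 2 ≤ p) (hpv : p ≤ p_v)
    {m n : ℕ} (hm : 1 ≤ m) (hn : 1 ≤ n) (θ : Index) (q : Icc (0 : ℝ) T × State d) :
    eLpNorm (fun ω => U θ n m q.1 q.2 ω - u q) (ENNReal.ofReal p) P
      ≤ ENNReal.ofReal (2 * (p - 1) ^ ((n : ℝ) / 2) * Real.exp (5 * c * T * n)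
          * Real.exp ((m : ℝ) ^ (p / 2) / p) * (m : ℝ) ^ (-(n : ℝ) / 2) * V q.1 q.2) := by
  have hm0 : (0 : ℝ) < m := by exact_mod_cast hm
  have hT := H.T_pos
  have h := ((H.controlled hu hp hpv hm).eLpNorm_error_le hT.le (H.isMLP hU hm) hm n).2 θ q
  refine h.trans (ENNReal.ofReal_le_ofReal ?_)
  have ha : 1 ≤ √(p - 1) := Real.one_le_sqrt.2 (by linarith)
  have hC := errorConst_le ha (mul_nonneg H.c_pos.le hT.le) hn
  have hW := H.weight_le (a := (m : ℝ) ^ (p / 2) / (p * T)) (by positivity) q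
  have e1 : (m : ℝ) ^ (p / 2) / (p * T) * T = (m : ℝ) ^ (p / 2) / p := by field_simp
  have e2 : √(p - 1) ^ n = (p - 1) ^ ((n : ℝ) / 2) := by
    rw [Real.sqrt_eq_rpow, ← Real.rpow_natCast, ← Real.rpow_mul (by linarith)]
    congr 1
    ring
  rw [e1] at hW
  rw [e2, ← mul_assoc 5 c T, ← mul_assoc (4 * √(p - 1)) c T] at hC
  rw [one_div_sqrt_pow hm0]
  have hW0 : 0 ≤ Real.exp ((m : ℝ) ^ (p / 2) / (p * T) * (T - q.1)) * V q.1 q.2 :=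
    mul_nonneg (Real.exp_nonneg _) (H.V_pos q).le
  have hp1 : 0 ≤ p - 1 := by linarith
  calc _ ≤ 2 * (p - 1) ^ ((n : ℝ) / 2) * Real.exp (5 * c * T * n) * (m : ℝ) ^ (-(n : ℝ) / 2)
        * (Real.exp ((m : ℝ) ^ (p / 2) / p) * V q.1 q.2) := by gcongr
    _ = _ := by ring

end Setting

end MLP

end

/-! ### Assembly of the theorem -/

theorem theorem2p2
    {Ω : Type*} [MeasurableSpace Ω] (P : Measure Ω) [IsProbabilityMeasure P]
    (d : ℕ) (hd : 1 ≤ d) (p_v c T : ℝ) (hp_v : 1 ≤ p_v) (hc : 0 < c) (hT : 0 < T)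
    (f : ℝ → ℝ) (hf : Continuous f)
    (g : MLP.State d → ℝ) (hg : Continuous g)
    (V : ℝ → MLP.State d → ℝ)
    (hV : ContinuousOn (fun q : ℝ × MLP.State d => V q.1 q.2) (Icc 0 T ×ˢ univ))
    (hV1 : ∀ t ∈ Icc 0 T, ∀ x, 1 ≤ V t x)
    -- the random times: independent and uniformly distributed on `[0,1]`
    (τ : MLP.Index → Ω → I) (hτm : ∀ θ, Measurable (τ θ))
    (hτ_indep : iIndepFun τ P)
    (hτ_ident : ∀ θ, IdentDistrib (τ θ) (τ MLP.Index.root) P P)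
    (hτ_unif : ∀ t ∈ Icc (0 : ℝ) 1,
      P {ω | (τ MLP.Index.root ω : ℝ) ≤ t} = ENNReal.ofReal t)
    -- the driving random fields: measurable, i.i.d., and independent of the random times
    (X : MLP.Index → ℝ → ℝ → MLP.State d → Ω → MLP.State d)
    (hX_indep : MLP.IndependentFields P T X τ)
    (hX_ident : ∀ θ, IdentDistrib (MLP.fieldMap T (X θ))
      (MLP.fieldMap T (X MLP.Index.root)) P P)
    (hgV : ∀ x, |g x| ≤ V T x)
    (hfV : ∀ s ∈ Icc 0 T, ∀ x, |T * f 0| ≤ V s x)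
    (hf_lip : ∀ w₁ w₂ : ℝ, |f w₁ - f w₂| ≤ c * |w₁ - w₂|)
    (hV_lyap : ∀ s ∈ Icc 0 T, ∀ t ∈ Icc s T, ∀ x,
      eLpNorm (fun ω => V t (X MLP.Index.root s t x ω)) (ENNReal.ofReal p_v) P
        ≤ ENNReal.ofReal (V s x))
    (U : MLP.Index → ℤ → ℤ → ℝ → MLP.State d → Ω → ℝ)
    (hU : MLP.IsApproximation T f g τ X U)
    (p q₁ : ℝ) (hp : 2 ≤ p) (hq₁ : 1 ≤ q₁) (hpq : p * q₁ ≤ p_v) :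
    (∃ u : ℝ → MLP.State d → ℝ,
      MLP.IsSolution P T f g V (X MLP.Index.root) u ∧
      ∀ v : ℝ → MLP.State d → ℝ, MLP.IsSolution P T f g V (X MLP.Index.root) v →
        ∀ t ∈ Icc 0 T, ∀ x, v t x = u t x) ∧
    (∀ u : ℝ → MLP.State d → ℝ, MLP.IsSolution P T f g V (X MLP.Index.root) u →
      ∀ m n : ℕ, 1 ≤ m → 1 ≤ n → ∀ t ∈ Icc 0 T, ∀ x,
        eLpNorm (fun ω => U MLP.Index.root n m t x ω - u t x) (ENNReal.ofReal p) P
          ≤ ENNReal.ofReal (2 * (p - 1) ^ ((n : ℝ) / 2) * Real.exp (5 * c * T * n)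
              * Real.exp ((m : ℝ) ^ (p / 2) / p) * (m : ℝ) ^ (-(n : ℝ) / 2)
              * V t x ^ q₁)) :=
by
  obtain ⟨𝒢, h𝒢_le, hX_meas, h𝒢_indep, h𝒢τ⟩ := hX_indep
  have H : MLP.Setting P p_v c T f g V τ X 𝒢 :=
    ⟨hc, hT, hf, hg, hV, hV1, hτm, hτ_indep, hτ_ident, hτ_unif, h𝒢_le, hX_meas, h𝒢_indep, h𝒢τ,
      hX_ident, hgV, hfV, hf_lip, hV_lyap⟩
  have hp_le : p ≤ p_v := (le_mul_of_one_le_right (by linarith) hq₁).trans hpq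
  refine ⟨?_, fun u hu m n hm hn t ht x => ?_⟩
  · obtain ⟨w, hw⟩ := H.exists_isFixed hp_v
    -- The solution on `[0,T]` is extended to all real times by projection; the extension plays no
    -- role in the equation.
    let u : ℝ → MLP.State d → ℝ := fun t x => w (projIcc 0 T hT.le t, x)
    have hu : (fun q : Icc (0 : ℝ) T × MLP.State d => u q.1 q.2) = w := by
      ext q
      simp [u]
    refine ⟨u, (H.isSolution_iff hp_v u).2 (hu ▸ hw), fun v hv t ht x => ?_⟩
    exact H.isFixed_unique hp_v ((H.isSolution_iff hp_v v).1 hv) (hu ▸ hw) (⟨t, ht⟩, x)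
  · refine (H.eLpNorm_approximation_sub_le hU ((H.isSolution_iff hp_v u).1 hu) hp hp_le hm hn
      MLP.Index.root (⟨t, ht⟩, x)).trans (ENNReal.ofReal_le_ofReal ?_)
    have hV0 := hV1 t ht x
    have hp1 : 0 ≤ p - 1 := by linarith
    have hVq : V t x ≤ V t x ^ q₁ := by
      simpa using Real.rpow_le_rpow_of_exponent_le hV0 hq₁
    gcongr
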